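/- Let $T^k=(S^1)^k$. A smooth action of $T^k$ on a smooth manifold $M$ (Hausdorff, second countable, without boundary, not necessarily compact) is called locally standard if every orbit has an invariant open neighbourhood which is equivariantly diffeomorphic to some $V=\mathbb{C}^n\times T^{k-n}\times\mathbb{R}^m$ ($n$, $m$ may depend on the orbit), with the following action: there is a splitting $T^k\cong T^n\times T^{k-n}$ such that $T^n$ acts linearly and effectively on $\mathbb{C}^n$, $T^{k-n}$ acts on itself by left multiplication, $T^k$ acts trivially on $\mathbb{R}^m$, and the action on $V$ is the product of these actions. The orbit space $P=M/T^k$ is then a smooth manifold with corners, whose charts are induced as follows: for an equivariant diffeomorphism from an invariant open subset of $M$ onto $\mathbb{C}^n\times T^{k-n}\times\mathbb{R}^m$ for which $T^n$ acts on $\mathbb{C}^n$ by coordinatewise multiplication, the corresponding chart of $P$ sends the orbit of the point with coordinates $(z,t,y)$ to $(|z_1|^2,\dots,|z_n|^2,y)\in\mathbb{R}_{\ge 0}^n\times\mathbb{R}^m$. The characteristic function $\lambda$ of $M$ is the map from $P$ to the set of subgroups of $T^k$ which assigns to each orbit its isotropy group (these groups are subtori). **Theorem.** Let $M_1$ and $M_2$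 be locally standard $T^k$-manifolds with orbit spaces $P_1,P_2$, orbit maps $\pi_i:M_i\to P_i$ and characteristic functions $\lambda_1,\lambda_2$. Assume that there are continuous sections $s_i:P_i\to M_i$ of the orbit maps, i.e. $\pi_i\circ s_i=\mathrm{id}_{P_i}$ for $i=1,2$. If there is a diffeomorphism of manifolds with corners $\Phi:P_1\to P_2$ such that $\lambda_1=\lambda_2\circ\Phi$, then there is a diffeomorphism $\Psi:M_1\to M_2$ with $\Psi(t\cdot x)=t\cdot\Psi(x)$ for all $t\in T^k$ and $x\in M_1$. -/

import Mathlib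

open scoped Manifold ContDiff Topology

noncomputable section

namespace LocallyStandard

/-- The compact torus `T^k`, a `k`-fold product of circles. -/
abbrev Torus (k : ℕ) : Type := Fin k → Circle

/-- The model with corners (in fact without boundary) over which the torus `T^k` is charted. -/
abbrev torusModel (k : ℕ) :
    ModelWithCorners ℝ (Fin k → EuclideanSpace ℝ (Fin 1))
      (ModelPi fun _ : Fin k => EuclideanSpace ℝ (Fin 1)) :=
  ModelWithCorners.pi fun _ : Fin k => 𝓡 1

/-- The underlying manifold `ℂ^n × T^l × ℝ^m` of a local model. -/
abbrev LocalModel (n l m : ℕ) : Type :=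
  (Fin n → ℂ) × Torus l × EuclideanSpace ℝ (Fin m)

/-- The model with corners over which `ℂ^n × T^l × ℝ^m`, regarded as a real manifold, is charted. -/
abbrev localModelCorners (n l m : ℕ) :=
  𝓘(ℝ, Fin n → ℂ).prod ((torusModel l).prod (𝓡 m))

/-- The data of an action of `T^k` on `ℂ^n × T^l × ℝ^m` (here `n + l = k`): a splitting
`T^k = T^n × T^l` and a linear and effective action of `T^n` on `ℂ^n`. -/
structure ModelAction (k n l : ℕ) where
  splitting : Torus k ≃ₜ* Torus n × Torus l
  rep : Representation ℂ (Torus n) (Fin n → ℂ)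
  continuous_rep : Continuous fun p : Torus n × (Fin n → ℂ) => rep p.1 p.2
  effective : Function.Injective rep

/-- The action of `T^k` on `ℂ^n × T^l × ℝ^m`: the product of the linear action of `T^n` on `ℂ^n`,
the action of `T^l` on itself by left multiplication, and the trivial action on `ℝ^m`. -/
def ModelAction.act {k n l m : ℕ} (A : ModelAction k n l) (t : Torus k) (v : LocalModel n l m) :
    LocalModel n l m :=
  (A.rep (A.splitting t).1 v.1, (A.splitting t).2 * v.2.1, v.2.2)

/-- The linear action of `T^n` on `ℂ^n` is the standard one, by coordinatewise multiplication. -/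
def ModelAction.IsStandard {k n l : ℕ} (A : ModelAction k n l) : Prop :=
  ∀ (t : Torus n) (z : Fin n → ℂ) (i : Fin n), A.rep t z i = (t i : ℂ) * z i

/-- An equivariant diffeomorphism from an invariant open subset of the `T^k`-manifold `M` onto
`ℂ^n × T^l × ℝ^m` with the action `A`. -/
structure InvariantChart {k n l : ℕ} (d : ℕ) (M : Type*) [TopologicalSpace M]
    [ChartedSpace (EuclideanSpace ℝ (Fin d)) M] [MulAction (Torus k) M]
    (A : ModelAction k n l) (m : ℕ) extends OpenPartialHomeomorph M (LocalModel n l m) where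
  target_eq_univ : target = Set.univ
  contMDiffOn_toFun : ContMDiffOn (𝓡 d) (localModelCorners n l m) ∞ toFun source
  contMDiffOn_invFun : ContMDiffOn (localModelCorners n l m) (𝓡 d) ∞ invFun target
  smul_mem : ∀ (t : Torus k), ∀ x ∈ source, t • x ∈ source
  map_smul : ∀ (t : Torus k), ∀ x ∈ source, toFun (t • x) = A.act t (toFun x)

/-- A `T^k`-action on the manifold `M` is locally standard if every point (equivalently, every
orbit) has an invariant open neighbourhood which is equivariantly diffeomorphic to some
`ℂ^n × T^(k-n) × ℝ^m`. -/
def IsLocallyStandard (k d : ℕ) (M : Type*) [TopologicalSpace M]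
    [ChartedSpace (EuclideanSpace ℝ (Fin d)) M] [MulAction (Torus k) M] : Prop :=
  ∀ x : M, ∃ (n l m : ℕ) (_ : n + l = k) (A : ModelAction k n l) (c : InvariantChart d M A m),
    x ∈ c.source

/-- The orbit space `M / T^k`, with the quotient topology. -/
abbrev OrbitSpace (k : ℕ) (M : Type*) [MulAction (Torus k) M] : Type _ :=
  MulAction.orbitRel.Quotient (Torus k) M

/-- The orbit map `M → M / T^k`. -/
def orbitMap (k : ℕ) {M : Type*} [MulAction (Torus k) M] (x : M) : OrbitSpace k M :=
  Quotient.mk _ x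

/-- The characteristic function of a `T^k`-manifold: it assigns to each orbit the isotropy group
of its points. -/
def charFun (k : ℕ) (M : Type*) [MulAction (Torus k) M] : OrbitSpace k M → Subgroup (Torus k) :=
  Quotient.lift (fun x => MulAction.stabilizer (Torus k) x) (by
    rintro x y ⟨g, rfl⟩
    ext t
    simp only [MulAction.mem_stabilizer_iff]
    rw [← mul_smul, mul_comm, mul_smul, smul_left_cancel_iff])

/-- The corner `ℝ_{≥0}^n × ℝ^m`. -/
abbrev Corner (n m : ℕ) : Type := ModelProd (EuclideanQuadrant n) (EuclideanSpace ℝ (Fin m))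

/-- The standard structure of a manifold with corners on `ℝ_{≥0}^n × ℝ^m`. -/
abbrev cornerModel (n m : ℕ) :
    ModelWithCorners ℝ (EuclideanSpace ℝ (Fin n) × EuclideanSpace ℝ (Fin m)) (Corner n m) :=
  (modelWithCornersEuclideanQuadrant n).prod (𝓡 m)

/-- The map `(z, t, y) ↦ (|z_1|^2, …, |z_n|^2, y)` from `ℂ^n × T^l × ℝ^m` to
`ℝ_{≥0}^n × ℝ^m`. -/
def momentMap {n l m : ℕ} (v : LocalModel n l m) : Corner n m :=
  (⟨WithLp.toLp 2 fun i => ‖v.1 i‖ ^ 2, fun i => sq_nonneg ‖v.1 i‖⟩, v.2.2)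

/-- The map `(x, y) ↦ (√x_1, …, √x_n, 1, y)` from `ℝ_{≥0}^n × ℝ^m` to `ℂ^n × T^l × ℝ^m`,
a right inverse of `momentMap`. -/
def stdSection {n m : ℕ} (l : ℕ) (p : Corner n m) : LocalModel n l m :=
  (fun i => (Real.sqrt (p.1.1 i) : ℂ), 1, p.2)

theorem momentMap_stdSection {n m : ℕ} (l : ℕ) (p : Corner n m) :
    momentMap (stdSection l p) = p := by
  obtain ⟨x, y⟩ := p
  refine Prod.ext ?_ rfl
  refine Subtype.ext ?_
  ext i
  have := x.2 i
  simp [momentMap, stdSection, Real.sq_sqrt this]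

theorem continuous_momentMap {n l m : ℕ} :
    Continuous (momentMap : LocalModel n l m → Corner n m) := by
  refine Continuous.prodMk (Continuous.subtype_mk ?_ _) (by fun_prop)
  exact (PiLp.continuous_toLp 2 _).comp (by fun_prop)

theorem continuous_stdSection {n m : ℕ} (l : ℕ) :
    Continuous (stdSection l : Corner n m → LocalModel n l m) := by
  refine Continuous.prodMk ?_ (Continuous.prodMk continuous_const continuous_snd)
  refine continuous_pi fun i => Complex.continuous_ofReal.comp (Real.continuous_sqrt.comp ?_)
  exact (PiLp.continuous_apply 2 _ i).comp (continuous_subtype_val.comp continuous_fst)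

theorem ModelAction.IsStandard.momentMap_act {k n l m : ℕ} {A : ModelAction k n l}
    (hA : A.IsStandard) (t : Torus k) (v : LocalModel n l m) :
    momentMap (A.act t v) = momentMap v := by
  refine Prod.ext (Subtype.ext ?_) rfl
  ext i
  simp [momentMap, ModelAction.act, hA _ _ i, Circle.norm_coe]

theorem exists_circle_mul_eq {z w : ℂ} (h : ‖z‖ ^ 2 = ‖w‖ ^ 2) : ∃ u : Circle, (u : ℂ) * z = w := by
  have h' : ‖z‖ = ‖w‖ := by
    rwa [sq_eq_sq₀ (norm_nonneg z) (norm_nonneg w)] at h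
  by_cases hz : z = 0
  · subst hz
    refine ⟨1, ?_⟩
    rw [norm_zero] at h'
    simp [norm_eq_zero.mp h'.symm]
  · have hz' : ‖z‖ ≠ 0 := norm_ne_zero_iff.mpr hz
    refine ⟨⟨w / z, ?_⟩, ?_⟩
    · exact mem_sphere_zero_iff_norm.mpr (by rw [norm_div, ← h', div_self hz'])
    · exact div_mul_cancel₀ w hz

theorem ModelAction.IsStandard.exists_act_eq {k n l m : ℕ} {A : ModelAction k n l}
    (hA : A.IsStandard) {v w : LocalModel n l m} (h : momentMap v = momentMap w) :
    ∃ t : Torus k, A.act t v = w := by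
  have h1 : ∀ i, ‖v.1 i‖ ^ 2 = ‖w.1 i‖ ^ 2 := fun i =>
    congrArg (fun p : Corner n m => p.1.1 i) h
  have h2 : v.2.2 = w.2.2 := congrArg (fun p : Corner n m => p.2) h
  choose u hu using fun i => exists_circle_mul_eq (h1 i)
  refine ⟨A.splitting.symm (u, w.2.1 * v.2.1⁻¹), ?_⟩
  refine Prod.ext ?_ (Prod.ext ?_ h2)
  · ext1 i
    simp [ModelAction.act, hA _ _ i, hu i]
  · simp [ModelAction.act]

theorem orbitMap_out {k : ℕ} {M : Type*} [MulAction (Torus k) M] (p : OrbitSpace k M) :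
    orbitMap k (Quotient.out p) = p :=
  Quotient.out_eq p

section OrbitChart

variable {k d n l m : ℕ} {M : Type*} [TopologicalSpace M]
  [ChartedSpace (EuclideanSpace ℝ (Fin d)) M] [MulAction (Torus k) M]
  {A : ModelAction k n l}

theorem InvariantChart.momentMap_eq_iff (c : InvariantChart d M A m) (hA : A.IsStandard)
    {x y : M} (hx : x ∈ c.source) (hy : y ∈ c.source) :
    momentMap (c.toFun x) = momentMap (c.toFun y) ↔ orbitMap k x = orbitMap k y := by
  constructor
  · intro h
    obtain ⟨t, ht⟩ := hA.exists_act_eq h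
    have h1 : t • x = y := by
      rw [← c.map_smul t x hx] at ht
      exact c.toOpenPartialHomeomorph.injOn (c.smul_mem t x hx) hy ht
    exact (Quotient.sound ⟨t, h1⟩ : orbitMap k y = orbitMap k x).symm
  · intro h
    obtain ⟨t, rfl⟩ := (Quotient.exact h : MulAction.orbitRel (Torus k) M x y)
    change momentMap (c.toFun (t • y)) = _
    rw [c.map_smul t y hy, hA.momentMap_act]

theorem InvariantChart.mem_source_of_orbitMap_eq (c : InvariantChart d M A m) {x y : M}
    (h : orbitMap k x = orbitMap k y) (hy : y ∈ c.source) : x ∈ c.source := by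
  obtain ⟨t, rfl⟩ := (Quotient.exact h : MulAction.orbitRel (Torus k) M x y)
  exact c.smul_mem t y hy

theorem continuous_orbitMap : Continuous (orbitMap k : M → OrbitSpace k M) :=
  continuous_quotient_mk'

theorem InvariantChart.out_mem (c : InvariantChart d M A m) {p : OrbitSpace k M}
    (hp : p ∈ orbitMap k '' c.source) : Quotient.out p ∈ c.source := by
  obtain ⟨x, hx, rfl⟩ := hp
  exact c.mem_source_of_orbitMap_eq (orbitMap_out _) hx

theorem InvariantChart.preimage_image_source (c : InvariantChart d M A m) :
    orbitMap k ⁻¹' (orbitMap k '' c.source) = c.source := by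
  refine Set.Subset.antisymm ?_ (Set.subset_preimage_image _ _)
  rintro x ⟨y, hy, h⟩
  exact c.mem_source_of_orbitMap_eq h.symm hy

theorem InvariantChart.isOpen_image_source (c : InvariantChart d M A m) :
    IsOpen (orbitMap k '' c.source : Set (OrbitSpace k M)) := by
  refine isOpen_coinduced.mpr ?_
  exact c.preimage_image_source.symm ▸ c.open_source

/-- The chart of the orbit space `M / T^k` with values in `ℝ_{≥0}^n × ℝ^m` which is induced by an
equivariant diffeomorphism from an invariant open subset of `M` to `ℂ^n × T^l × ℝ^m` with the
standard action: it sends the orbit of a point with coordinates `(z, t, y)` to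
`(|z_1|^2, …, |z_n|^2, y)`. -/
def InvariantChart.orbitChart (c : InvariantChart d M A m) (hA : A.IsStandard) :
    OpenPartialHomeomorph (OrbitSpace k M) (Corner n m) where
  toFun p := momentMap (c.toFun (Quotient.out p))
  invFun q := orbitMap k (c.invFun (stdSection l q))
  source := orbitMap k '' c.source
  target := Set.univ
  map_source' _ _ := Set.mem_univ _
  map_target' q _ := ⟨_, c.map_target' (by rw [c.target_eq_univ]; trivial), rfl⟩
  left_inv' p hp := by
    have h1 := c.out_mem hp
    have hT : stdSection l (momentMap (c.toFun (Quotient.out p))) ∈ c.target := by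
      rw [c.target_eq_univ]; trivial
    conv_rhs => rw [← orbitMap_out p]
    rw [← c.momentMap_eq_iff hA (c.map_target' hT) h1, c.right_inv' hT, momentMap_stdSection]
  right_inv' q _ := by
    have hT : stdSection l q ∈ c.target := by rw [c.target_eq_univ]; trivial
    have hS := c.map_target' hT
    have h1 := c.mem_source_of_orbitMap_eq (orbitMap_out (orbitMap k (c.invFun _))) hS
    rw [(c.momentMap_eq_iff hA h1 hS).mpr (orbitMap_out _), c.right_inv' hT, momentMap_stdSection]
  open_source := c.isOpen_image_source
  open_target := isOpen_univ
  continuousOn_toFun := by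
    rw [continuousOn_open_iff c.isOpen_image_source]
    intro W hW
    refine isOpen_coinduced.mpr ?_
    have h : orbitMap k ⁻¹' (orbitMap k '' c.source ∩
        (fun p : OrbitSpace k M => momentMap (c.toFun (Quotient.out p))) ⁻¹' W) =
        c.source ∩ c.toFun ⁻¹' (momentMap ⁻¹' W) := by
      rw [Set.preimage_inter, c.preimage_image_source]
      ext x
      refine and_congr_right fun hx => ?_
      have h1 := c.mem_source_of_orbitMap_eq (orbitMap_out (orbitMap k x)) hx
      simp only [Set.mem_preimage]
      rw [(c.momentMap_eq_iff hA h1 hx).mpr (orbitMap_out _)]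
    exact h.symm ▸ c.toOpenPartialHomeomorph.isOpen_inter_preimage (hW.preimage continuous_momentMap)
  continuousOn_invFun := by
    refine continuous_orbitMap.comp_continuousOn (c.continuousOn_invFun.comp
      (continuous_stdSection l).continuousOn fun q _ => ?_)
    rw [c.target_eq_univ]; trivial

theorem InvariantChart.orbitChart_orbitMap (c : InvariantChart d M A m) (hA : A.IsStandard)
    {x : M} (hx : x ∈ c.source) : c.orbitChart hA (orbitMap k x) = momentMap (c.toFun x) :=
  (c.momentMap_eq_iff hA (c.mem_source_of_orbitMap_eq (orbitMap_out _) hx) hx).mpr (orbitMap_out _)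

end OrbitChart

/-- A chart of the orbit space `M / T^k` with values in `ℝ_{≥0}^n × ℝ^m`, belonging to the atlas
which makes the orbit space of a locally standard `T^k`-manifold a manifold with corners. -/
def IsOrbitChart {k n m : ℕ} (d : ℕ) {M : Type*} [TopologicalSpace M]
    [ChartedSpace (EuclideanSpace ℝ (Fin d)) M] [MulAction (Torus k) M]
    (φ : OpenPartialHomeomorph (OrbitSpace k M) (Corner n m)) : Prop :=
  ∃ (l : ℕ) (A : ModelAction k n l) (hA : A.IsStandard) (c : InvariantChart d M A m),
    φ = c.orbitChart hA

/-- A continuous map between orbit spaces is smooth, as a map of manifolds with corners, if around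
every point of the source it is smooth in suitable charts of the orbit spaces. -/
def IsOrbitSmooth {k : ℕ} (d₁ d₂ : ℕ) {M₁ M₂ : Type*}
    [TopologicalSpace M₁] [ChartedSpace (EuclideanSpace ℝ (Fin d₁)) M₁] [MulAction (Torus k) M₁]
    [TopologicalSpace M₂] [ChartedSpace (EuclideanSpace ℝ (Fin d₂)) M₂] [MulAction (Torus k) M₂]
    (f : OrbitSpace k M₁ → OrbitSpace k M₂) : Prop :=
  Continuous f ∧ ∀ p : OrbitSpace k M₁, ∃ (n₁ m₁ n₂ m₂ : ℕ)
    (φ₁ : OpenPartialHomeomorph (OrbitSpace k M₁) (Corner n₁ m₁))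
    (φ₂ : OpenPartialHomeomorph (OrbitSpace k M₂) (Corner n₂ m₂)),
    IsOrbitChart d₁ φ₁ ∧ IsOrbitChart d₂ φ₂ ∧ p ∈ φ₁.source ∧ f p ∈ φ₂.source ∧
    ContMDiffOn (cornerModel n₁ m₁) (cornerModel n₂ m₂) ∞ (φ₂ ∘ f ∘ φ₁.symm)
      (φ₁.target ∩ φ₁.symm ⁻¹' (f ⁻¹' φ₂.source))

/-- A diffeomorphism of manifolds with corners between the orbit spaces of two
`T^k`-manifolds. -/
structure OrbitDiffeo (k d₁ d₂ : ℕ) (M₁ M₂ : Type*)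
    [TopologicalSpace M₁] [ChartedSpace (EuclideanSpace ℝ (Fin d₁)) M₁] [MulAction (Torus k) M₁]
    [TopologicalSpace M₂] [ChartedSpace (EuclideanSpace ℝ (Fin d₂)) M₂] [MulAction (Torus k) M₂]
    extends OrbitSpace k M₁ ≃ OrbitSpace k M₂ where
  smooth_toFun : IsOrbitSmooth d₁ d₂ toFun
  smooth_invFun : IsOrbitSmooth d₂ d₁ invFun

end LocallyStandard

end

/-! A map of orbit spaces that preserves isotropy groups lifts locally to the manifolds. In standard
charts the lift keeps the phases of a point and changes the moduli through the standard sections: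
`localLift` sends `x` to `phases x • std (f (orbit of x))`. Equality of isotropy groups makes it
well behaved under the action. Smoothness where coordinates vanish is the real issue. The circle
rotating a vanishing coordinate `z_i` must also rotate a vanishing coordinate `w_j` of the target
(`exists_facet_eq`), and it does so with weight `±1` (`exists_circ_eq`). The squared modulus of
`w_j` is `|z_i|^2 g` with `g` smooth (`exists_sq_eq_mul`), and the same argument for the inverse map
forces `g > 0` (`exists_sq_le_sq_map`). Hence `w_j` is `z_i √g` or its conjugate form, which is
smooth. The division results rest on an explicit integral formula for quotients of functions of
given weight (`eq_coord_mul_divCoord`).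

The sections make the local lifts compatible. Over free orbits, `s₂ ∘ f` and the image of `s₁` under
a local lift `Ψ_p` differ by a continuous torus-valued function. Locally the free orbits form a
convex set in coordinates, so this function is the exponential of a continuous `a_p` with values in
`ℝ^k`. The sections are only continuous, and so are the `a_p`. But two local lifts differ by a
smooth torus-valued multiplier, so `a_p - a_p'` extends to a smooth function even across the
non-free orbits (`exists_smooth_difference`). A partition of unity and averaging over the torus give
smooth invariant `v_p` with the same differences (`exists_smooth_splitting`). The maps `exp(v_p) •
Ψ_p` then agree on overlaps and glue to a global lift (`IsCharDiffeo.exists_isLift_univ`).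

A global lift is bijective because orbits and isotropy groups correspond. Its inverse is smooth
because it differs from a global lift of the inverse map by a smooth multiplier. -/

namespace LocallyStandard

/-! ### Smooth dependence of integrals on parameters. -/

section ParametricIntegral

theorem continuousOn_slice {E G : Type} [TopologicalSpace E] [TopologicalSpace G]
    {f : E → ℝ → G} {x : E} {K : Set ℝ} (hf : ∀ s ∈ K, ContinuousAt (Function.uncurry f) (x, s)) : ContinuousOn (f x) K := by
  intro s hs
  have : ContinuousAt (fun s => Function.uncurry f (x, s)) s :=
    ContinuousAt.comp (f := fun s => (x, s)) (hf s hs) (by fun_prop)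
  exact this.continuousWithinAt

variable {E F : Type} [NormedAddCommGroup E] [NormedSpace ℝ E] [NormedAddCommGroup F]
  [NormedSpace ℝ F]

theorem contDiffAt_partial_fderiv {f : E → ℝ → F} {p : E × ℝ}
    (hf : ContDiffAt ℝ ∞ (Function.uncurry f) p) :
    ContDiffAt ℝ ∞ (Function.uncurry fun x s =>
      (fderiv ℝ (Function.uncurry f) (x, s)).comp (ContinuousLinearMap.inl ℝ E ℝ)) p := by
  have h1 : ContDiffAt ℝ ∞ (fderiv ℝ (Function.uncurry f)) p := hf.fderiv_right (by simp)
  exact h1.clm_comp contDiffAt_const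

theorem hasFDerivAt_integral_of_contDiffAt {U : Set E} (hU : IsOpen U)
    {f : E → ℝ → F}
    (hf : ∀ x ∈ U, ∀ s ∈ Set.Icc (0 : ℝ) 1, ContDiffAt ℝ ∞ (Function.uncurry f) (x, s))
    {x : E} (hx : x ∈ U) :
    HasFDerivAt (fun x => ∫ s in (0 : ℝ)..1, f x s)
      (∫ s in (0 : ℝ)..1,
        (fderiv ℝ (Function.uncurry f) (x, s)).comp (ContinuousLinearMap.inl ℝ E ℝ)) x := by
  set F' : E → ℝ → E →L[ℝ] F := fun x s =>
    (fderiv ℝ (Function.uncurry f) (x, s)).comp (ContinuousLinearMap.inl ℝ E ℝ) with hF'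
  have hcont : ∀ x ∈ U, ContinuousOn (f x) (Set.Icc 0 1) := fun x hx =>
    continuousOn_slice fun s hs => (hf x hx s hs).continuousAt
  have hcF' : ∀ s ∈ Set.Icc (0 : ℝ) 1, ContinuousAt (Function.uncurry F') (x, s) :=
    fun s hs => (contDiffAt_partial_fderiv (hf x hx s hs)).continuousAt
  have hcont' : ContinuousOn (F' x) (Set.Icc 0 1) := continuousOn_slice hcF'
  obtain ⟨C, hC⟩ := isCompact_Icc.exists_bound_of_continuousOn hcont'
  -- Compactness of `[0,1]` makes the bound uniform in `s` near `x`; the constant `C + 1` is then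
  -- the dominating function.
  have hev : ∀ᶠ y in 𝓝 x, ∀ s ∈ Set.Icc (0 : ℝ) 1, ‖F' y s‖ ≤ C + 1 := by
    refine isCompact_Icc.eventually_forall_of_forall_eventually fun s hs => ?_
    have h1 : ‖Function.uncurry F' (x, s)‖ < C + 1 := (hC s hs).trans_lt (lt_add_one C)
    filter_upwards [(hcF' s hs).norm.eventually_lt_const h1] with z hz using hz.le
  have hsub : ∀ t, t ∈ Set.uIoc (0 : ℝ) 1 → t ∈ Set.Icc (0 : ℝ) 1 := fun t ht => by
    rw [Set.uIoc_of_le zero_le_one] at ht; exact ⟨ht.1.le, ht.2⟩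
  have hmeas : ∀ {G : Type} [NormedAddCommGroup G] {g : ℝ → G},
      ContinuousOn g (Set.Icc 0 1) → MeasureTheory.AEStronglyMeasurable g
        (MeasureTheory.volume.restrict (Set.uIoc (0 : ℝ) 1)) := fun {G} _ {g} hg => by
    have := (hg.intervalIntegrable_of_Icc (μ := MeasureTheory.volume) zero_le_one)
    rw [Set.uIoc_of_le zero_le_one]
    exact this.1.aestronglyMeasurable
  refine intervalIntegral.hasFDerivAt_integral_of_dominated_of_fderiv_le
    (s := U ∩ {y | ∀ s ∈ Set.Icc (0 : ℝ) 1, ‖F' y s‖ ≤ C + 1}) (bound := fun _ => C + 1)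
    (F' := F') (Filter.inter_mem (hU.mem_nhds hx) hev) ?_ ?_ ?_ ?_ ?_ ?_
  · filter_upwards [hU.mem_nhds hx] with y hy using hmeas (hcont y hy)
  · exact (hcont x hx).intervalIntegrable_of_Icc zero_le_one
  · exact hmeas hcont'
  · exact Filter.Eventually.of_forall fun t ht y hy => hy.2 t (hsub t ht)
  · simp
  · refine Filter.Eventually.of_forall fun t ht y hy => ?_
    have h1 : HasFDerivAt (Function.uncurry f) (fderiv ℝ (Function.uncurry f) (y, t)) (y, t) :=
      ((hf y hy.1 t (hsub t ht)).differentiableAt (by simp)).hasFDerivAt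
    exact h1.comp (f := fun y => (y, t)) y (hasFDerivAt_prodMk_left y t)

theorem contDiffOn_integral {U : Set E} (hU : IsOpen U) {f : E → ℝ → F}
    (hf : ∀ x ∈ U, ∀ s ∈ Set.Icc (0 : ℝ) 1, ContDiffAt ℝ ∞ (Function.uncurry f) (x, s)) :
    ContDiffOn ℝ ∞ (fun x => ∫ s in (0 : ℝ)..1, f x s) U := by
  rw [contDiffOn_infty]
  intro n
  -- The derivative is an integral of the same kind with values in `E →L[ℝ] F`, so the target space
  -- has to vary in the induction.
  induction n generalizing F with
  | zero =>
    exact contDiffOn_zero.mpr fun x hx =>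
      (hasFDerivAt_integral_of_contDiffAt hU hf hx).continuousAt.continuousWithinAt
  | succ n ih =>
    rw [Nat.cast_succ, contDiffOn_succ_iff_fderiv_of_isOpen hU]
    refine ⟨fun x hx => (hasFDerivAt_integral_of_contDiffAt hU hf
      hx).differentiableAt.differentiableWithinAt, by simp, ?_⟩
    refine ContDiffOn.congr (ih fun x hx s hs => contDiffAt_partial_fderiv (hf x hx s hs))
      fun x hx => (hasFDerivAt_integral_of_contDiffAt hU hf hx).fderiv

end ParametricIntegral

theorem eqOn_of_dense_inter {X Y : Type*} [TopologicalSpace X] [TopologicalSpace Y] [T2Space Y]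
    {D U : Set X} (hD : Dense D) (hU : IsOpen U) {f g : X → Y} (hf : ContinuousOn f U)
    (hg : ContinuousOn g U) (h : ∀ x ∈ U, x ∈ D → f x = g x) : ∀ x ∈ U, f x = g x :=
  Set.EqOn.of_subset_closure (s := U ∩ D) (fun x hx => h x hx.1 hx.2) hf hg
    Set.inter_subset_left (hD.open_subset_closure_inter hU)

/-! ### Division of a function of given weight by a complex coordinate. -/

section Division

variable {E : Type} [NormedAddCommGroup E] [NormedSpace ℝ E]

/-- Multiplication of the complex coordinate `w` by the scalar `c`; here `j` is a right inverse
of `w`. -/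
noncomputable def scaleCoord (w : E →L[ℝ] ℂ) (j : ℂ →L[ℝ] E) (c : ℂ) (x : E) : E :=
  x + j ((c - 1) * w x)

/-- The quotient of a function `F` by the coordinate `w`, as an integral. -/
noncomputable def divCoord (w : E →L[ℝ] ℂ) (j : ℂ →L[ℝ] E) (κ : ℕ) (F : E → ℂ) (x : E) : ℂ :=
  ∫ s in (0 : ℝ)..1, (s : ℂ) ^ κ * (fderiv ℝ F (scaleCoord w j s x) (j 1) -
    Complex.I * fderiv ℝ F (scaleCoord w j s x) (j Complex.I))

theorem coord_scaleCoord {w : E →L[ℝ] ℂ} {j : ℂ →L[ℝ] E} (hwj : ∀ c, w (j c) = c) (c : ℂ) (x : E) :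
    w (scaleCoord w j c x) = c * w x := by
  simp only [scaleCoord, map_add, hwj]; ring

theorem contDiffOn_divCoord {w : E →L[ℝ] ℂ} {j : ℂ →L[ℝ] E} {U : Set E} (hU : IsOpen U)
    (hs : ∀ x ∈ U, ∀ s ∈ Set.Icc (0 : ℝ) 1, scaleCoord w j s x ∈ U) {F : E → ℂ}
    (hF : ContDiffOn ℝ ∞ F U) (κ : ℕ) : ContDiffOn ℝ ∞ (divCoord w j κ F) U := by
  refine contDiffOn_integral hU fun x hx s hs' => ?_
  have h1 : ContDiffAt ℝ ∞ (fderiv ℝ F) (scaleCoord w j s x) :=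
    (hF.contDiffAt (hU.mem_nhds (hs x hx s hs'))).fderiv_right (by simp)
  have hof : ContDiff ℝ ∞ (fun p : E × ℝ => (p.2 : ℂ)) :=
    Complex.ofRealCLM.contDiff.comp contDiff_snd
  have h2 : ContDiff ℝ ∞ (fun p : E × ℝ => scaleCoord w j p.2 p.1) := by
    unfold scaleCoord
    exact contDiff_fst.add
      (j.contDiff.comp ((hof.sub contDiff_const).mul (w.contDiff.comp contDiff_fst)))
  have h3 : ContDiffAt ℝ ∞ (fun p : E × ℝ => fderiv ℝ F (scaleCoord w j p.2 p.1)) (x, s) :=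
    ContDiffAt.comp (x, s) (f := fun p : E × ℝ => scaleCoord w j p.2 p.1) h1 h2.contDiffAt
  exact (hof.contDiffAt.pow κ).mul ((h3.clm_apply contDiffAt_const).sub
    (contDiffAt_const.mul (h3.clm_apply contDiffAt_const)))

/-- The expression `L a - i L (i a)` is twice the complex linear part of `L`. -/
theorem real_linear_sub_I (L : ℂ →L[ℝ] ℂ) (a : ℂ) :
    L a - Complex.I * L (Complex.I * a) = a * (L 1 - Complex.I * L Complex.I) := by
  have h : ∀ x y : ℝ, L (x + y * Complex.I) = x * L 1 + y * L Complex.I := fun x y => by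
    have : (x + y * Complex.I : ℂ) = x • (1 : ℂ) + y • Complex.I := by simp
    rw [this, map_add, map_smul, map_smul]; simp
  obtain ⟨x, y⟩ := a
  have e1 : (⟨x, y⟩ : ℂ) = x + y * Complex.I := by apply Complex.ext <;> simp
  have e2 : Complex.I * (⟨x, y⟩ : ℂ) = ((-y : ℝ) : ℂ) + x * Complex.I := by
    apply Complex.ext <;> simp
  rw [e2, h, e1, h]
  push_cast
  linear_combination (y * L Complex.I) * Complex.I_mul_I

/-- Integrate the derivative of `s^κ F` along the segment that scales the coordinate `w` from `0` to
its value. The derivative of `F` in the radial direction is its complex linear part plus a multiple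
of the angular derivative. The latter is `κ i F` by the rotation law, and the factor `s^κ` makes it
cancel, leaving a multiple of `w x`. -/
theorem eq_coord_mul_divCoord {w : E →L[ℝ] ℂ} {j : ℂ →L[ℝ] E} (hwj : ∀ c, w (j c) = c)
    {U : Set E} (hU : IsOpen U)
    (hs : ∀ x ∈ U, ∀ s ∈ Set.Icc (0 : ℝ) 1, scaleCoord w j s x ∈ U) {F : E → ℂ}
    (hF : ContDiffOn ℝ ∞ F U) {κ : ℕ}
    (hrot : ∀ x ∈ U, ∀ u : Circle, scaleCoord w j u x ∈ U →
      F (scaleCoord w j u x) = (u : ℂ) ^ κ * F x)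
    (h0 : ∀ x ∈ U, w x = 0 → F x = 0) {x : E} (hx : x ∈ U) :
    F x = w x * divCoord w j κ F x := by
  have hd : ∀ y ∈ U, HasFDerivAt F (fderiv ℝ F y) y := fun y hy =>
    ((hF.contDiffAt (hU.mem_nhds hy)).differentiableAt (by simp)).hasFDerivAt
  -- The rotation law differentiated at the identity. Only small angles are used, so `U` need not be
  -- invariant under rotations.
  have hder : ∀ y ∈ U, fderiv ℝ F y (j (Complex.I * w y)) = κ * Complex.I * F y := by
    intro y hy
    have hγ : HasDerivAt (fun θ : ℝ => scaleCoord w j (Circle.exp θ) y) (j (Complex.I * w y)) 0 := by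
      have h1 : HasDerivAt (fun θ : ℝ => ((Circle.exp θ : Circle) : ℂ)) Complex.I 0 := by
        have h2 : HasDerivAt (fun θ : ℝ => (θ : ℂ) * Complex.I) (1 * Complex.I) 0 :=
          (Complex.ofRealCLM.hasDerivAt (x := (0 : ℝ))).mul_const _
        have := h2.cexp
        simpa [Circle.coe_exp] using this
      have h3 : HasDerivAt (fun θ : ℝ => ((Circle.exp θ : Circle) : ℂ) - 1) Complex.I 0 := h1.sub_const 1
      have := (j.hasFDerivAt (x := ((Circle.exp 0 : Circle) - 1 : ℂ) * w y)).comp_hasDerivAt (0 : ℝ)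
        (h3.mul_const (w y))
      exact this.const_add y
    have hy0 : scaleCoord w j (Circle.exp 0) y = y := by simp [scaleCoord]
    have h1 : HasDerivAt (fun θ : ℝ => F (scaleCoord w j (Circle.exp θ) y))
        (fderiv ℝ F y (j (Complex.I * w y))) 0 := by
      have := hd y hy
      rw [← hy0] at this
      have := this.comp_hasDerivAt (0 : ℝ) hγ
      rwa [hy0] at this
    have h2 : HasDerivAt (fun θ : ℝ => Complex.exp ((κ * θ : ℝ) * Complex.I) * F y)
        (κ * Complex.I * F y) 0 := by
      have h2 : HasDerivAt (fun θ : ℝ => ((κ * θ : ℝ) : ℂ) * Complex.I) (κ * Complex.I) 0 := by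
        have := ((Complex.ofRealCLM.hasDerivAt (x := (0 : ℝ))).const_mul (κ : ℂ)).mul_const Complex.I
        simpa using this
      have := h2.cexp.mul_const (F y)
      simpa using this
    refine h1.unique (h2.congr_of_eventuallyEq ?_)
    have hev : ∀ᶠ θ in 𝓝 (0 : ℝ), scaleCoord w j (Circle.exp θ) y ∈ U :=
      hγ.continuousAt.eventually_mem (by rw [hy0]; exact hU.mem_nhds hy)
    filter_upwards [hev] with θ hθ
    rw [hrot y hy _ hθ, Circle.coe_exp, ← Complex.exp_nat_mul]
    congr 2
    push_cast; ring
  set a := w x with ha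
  set G : ℝ → ℂ := fun s => (s : ℂ) ^ κ * (fderiv ℝ F (scaleCoord w j s x) (j 1) -
    Complex.I * fderiv ℝ F (scaleCoord w j s x) (j Complex.I)) with hG
  have hline : ∀ s : ℝ, HasDerivAt (fun s : ℝ => scaleCoord w j s x) (j a) s := by
    intro s
    have h3 : HasDerivAt (fun s : ℝ => ((s : ℂ) - 1) * a) (1 * a) s :=
      ((Complex.ofRealCLM.hasDerivAt (x := s)).sub_const 1).mul_const a
    have := (j.hasFDerivAt (x := ((s : ℂ) - 1) * a)).comp_hasDerivAt s h3
    rw [one_mul] at this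
    exact this.const_add x
  have hcF : ContinuousOn (fun s : ℝ => fderiv ℝ F (scaleCoord w j s x)) (Set.Icc 0 1) := by
    intro s hs'
    have h1 : ContDiffAt ℝ ∞ (fderiv ℝ F) (scaleCoord w j s x) :=
      (hF.contDiffAt (hU.mem_nhds (hs x hx s hs'))).fderiv_right (by simp)
    exact (ContinuousAt.comp (f := fun s : ℝ => scaleCoord w j s x) h1.continuousAt
      (hline s).continuousAt).continuousWithinAt
  have hGc : ContinuousOn G (Set.Icc 0 1) := by
    have h1 : ContinuousOn (fun s : ℝ => (s : ℂ) ^ κ) (Set.Icc 0 1) := by fun_prop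
    exact h1.mul ((hcF.clm_apply continuousOn_const).sub
      (continuousOn_const.mul (hcF.clm_apply continuousOn_const)))
  have key := intervalIntegral.integral_eq_sub_of_hasDerivAt_of_le (zero_le_one (α := ℝ))
    (f := fun s : ℝ => (s : ℂ) ^ κ * F (scaleCoord w j s x)) (f' := fun s => a * G s) ?_ ?_
    ((continuousOn_const.mul hGc).intervalIntegrable_of_Icc zero_le_one)
  · rw [intervalIntegral.integral_const_mul] at key
    have e1 : scaleCoord w j ((1 : ℝ) : ℂ) x = x := by simp [scaleCoord]
    have e0 : F (scaleCoord w j ((0 : ℝ) : ℂ) x) = 0 := by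
      refine h0 _ (hs x hx 0 (by simp)) ?_
      rw [coord_scaleCoord hwj]; simp
    rw [e1, e0] at key
    simpa [divCoord, hG] using key.symm
  · intro s hs'
    refine ContinuousWithinAt.mul (by fun_prop) ?_
    exact (ContinuousAt.comp (f := fun s : ℝ => scaleCoord w j s x)
      (hd _ (hs x hx s hs')).continuousAt (hline s).continuousAt).continuousWithinAt
  · intro s hs'
    have hy := hs x hx s ⟨hs'.1.le, hs'.2.le⟩
    set y := scaleCoord w j s x with hyd
    have h1 : HasDerivAt (fun s : ℝ => F (scaleCoord w j s x)) (fderiv ℝ F y (j a)) s :=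
      (hd y hy).comp_hasDerivAt s (hline s)
    have h2 : HasDerivAt (fun s : ℝ => (s : ℂ) ^ κ) (κ * (s : ℂ) ^ (κ - 1)) s := by
      have := (Complex.ofRealCLM.hasDerivAt (x := s)).fun_pow κ
      simpa using this
    refine (h2.mul h1).congr_deriv ?_
    have hs0 : (s : ℂ) ≠ 0 := by exact_mod_cast hs'.1.ne'
    have h3 := hder y hy
    have h4 : w y = s * a := coord_scaleCoord hwj _ _
    have h5 : j (Complex.I * w y) = s • j (Complex.I * a) := by
      rw [h4, ← map_smul]; congr 1; simp; ring
    rw [h5, map_smul] at h3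
    -- With `h3`, this expresses the radial derivative through the integrand and the term `-κ F /
    -- s`, which cancels the derivative of `s^κ`.
    have h6 := real_linear_sub_I ((fderiv ℝ F y).comp j) a
    simp only [ContinuousLinearMap.comp_apply] at h6
    have h7 : (s : ℂ) * (κ * (s : ℂ) ^ (κ - 1)) = κ * (s : ℂ) ^ κ := by
      cases κ with
      | zero => simp
      | succ q => simp [pow_succ]; ring
    refine mul_left_cancel₀ hs0 ?_
    simp only [hG]
    simp only [Complex.real_smul] at h3
    linear_combination F y * h7 + (s ^ κ * Complex.I) * h3 + (s * s ^ κ : ℂ) * h6 +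
      κ * s ^ κ * F y * Complex.I_mul_I

end Division

/-! ### Division on open sets invariant under coordinate rotations. -/

section Reinhardt

/-- The action of `T^n` on the first factor of `ℂ^n × V` by coordinatewise multiplication. -/
def rot {n : ℕ} {V : Type} (u : Torus n) (x : (Fin n → ℂ) × V) :
    (Fin n → ℂ) × V := (fun i => u i * x.1 i, x.2)

theorem continuous_rot {n : ℕ} {V : Type} [TopologicalSpace V] (u : Torus n) :
    Continuous (rot u : (Fin n → ℂ) × V → _) := by
  unfold rot; fun_prop

theorem dense_coord_ne_zero {n : ℕ} {V : Type} [TopologicalSpace V] :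
    Dense {x : (Fin n → ℂ) × V | ∀ i, x.1 i ≠ 0} := by
  have h : Dense (Set.pi Set.univ fun _ : Fin n => ({0}ᶜ : Set ℂ)) :=
    dense_pi _ fun i _ => dense_compl_singleton 0
  refine (h.prod (dense_univ (X := V))).mono ?_
  rintro x ⟨hx, -⟩ i
  exact hx i trivial

variable {n : ℕ} {V : Type} [NormedAddCommGroup V] [NormedSpace ℝ V]

/-- The integral formula needs a domain stable under scaling one coordinate, which holds only near
the hyperplane `z_i = 0`; elsewhere the quotient is smooth anyway. The weight of the quotient
follows by cancelling `z_i` on a dense set. -/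
theorem exists_division {Ω : Set ((Fin n → ℂ) × V)} (hΩ : IsOpen Ω)
    (hrot : ∀ x ∈ Ω, ∀ u, rot u x ∈ Ω) (i : Fin n) (κ : ℕ) {F : (Fin n → ℂ) × V → ℂ}
    (hF : ContDiffOn ℝ ∞ F Ω) (hFrot : ∀ x ∈ Ω, ∀ u, F (rot u x) = (u i : ℂ) ^ κ * F x)
    (h0 : ∀ x ∈ Ω, x.1 i = 0 → F x = 0) :
    ∃ g : (Fin n → ℂ) × V → ℂ, ContDiffOn ℝ ∞ g Ω ∧ (∀ x ∈ Ω, F x = x.1 i * g x) ∧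
      ∀ x ∈ Ω, ∀ u : Torus n, (u i : ℂ) * g (rot u x) = (u i : ℂ) ^ κ * g x := by
  classical
  let w : (Fin n → ℂ) × V →L[ℝ] ℂ :=
    (ContinuousLinearMap.proj (R := ℝ) (φ := fun _ : Fin n => ℂ) i).comp
      (ContinuousLinearMap.fst ℝ _ V)
  let j : ℂ →L[ℝ] (Fin n → ℂ) × V := (ContinuousLinearMap.inl ℝ (Fin n → ℂ) V).comp
    (ContinuousLinearMap.single ℝ (fun _ : Fin n => ℂ) i)
  have hw : ∀ x, w x = x.1 i := fun x => rfl
  have hwj : ∀ c, w (j c) = c := fun c => by simp [w, j]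
  have hsc : ∀ c x, scaleCoord w j c x = (Function.update x.1 i (c * x.1 i), x.2) := by
    intro c x
    refine Prod.ext ?_ ?_
    · ext l
      by_cases hl : l = i
      · subst hl; simp [scaleCoord, w, j]; ring
      · simp [scaleCoord, w, j, hl]
    · simp [scaleCoord, w, j]
  have hscrot : ∀ (u : Circle) x, scaleCoord w j u x = rot (Function.update 1 i u) x := by
    intro u x
    rw [hsc]
    refine Prod.ext ?_ rfl
    ext l
    by_cases hl : l = i
    · subst hl; simp [rot]
    · simp [rot, hl]
  set g : (Fin n → ℂ) × V → ℂ := fun x => if x.1 i = 0 then divCoord w j κ F x else F x / x.1 i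
    with hg
  have hFg : ∀ x ∈ Ω, F x = x.1 i * g x := by
    intro x hx
    by_cases hxi : x.1 i = 0
    · rw [h0 x hx hxi, hxi, zero_mul]
    · simp only [hg, hxi, if_false]; field_simp
  have hgs : ContDiffOn ℝ ∞ g Ω := by
    intro x hx
    refine ContDiffAt.contDiffWithinAt ?_
    by_cases hxi : x.1 i = 0
    · obtain ⟨ε, hε, hball⟩ := Metric.isOpen_iff.mp hΩ x hx
      -- The centre has `z_i = 0` and the metric is a supremum, so shrinking the `i`-th coordinate
      -- does not increase the distance to it.
      have hst : ∀ y ∈ Metric.ball x ε, ∀ s ∈ Set.Icc (0 : ℝ) 1,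
          scaleCoord w j s y ∈ Metric.ball x ε := by
        intro y hy s hs
        rw [Metric.mem_ball] at hy ⊢
        refine lt_of_le_of_lt ?_ hy
        rw [hsc, Prod.dist_eq, Prod.dist_eq]
        refine max_le_max ?_ le_rfl
        rw [dist_pi_le_iff dist_nonneg]
        intro l
        refine le_trans ?_ (dist_le_pi_dist y.1 x.1 l)
        by_cases hl : l = i
        · subst hl
          simp only [Function.update_self, hxi, dist_zero_right, norm_mul, Complex.norm_real,
            Real.norm_eq_abs, abs_of_nonneg hs.1]
          exact mul_le_of_le_one_left (norm_nonneg _) hs.2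
        · simp [hl]
      have hF' := hF.mono hball
      have hdiv := fun y hy => eq_coord_mul_divCoord hwj Metric.isOpen_ball hst hF' (κ := κ)
        (fun y hy u _ => by rw [hscrot, hFrot y (hball hy)]; simp)
        (fun y hy h => h0 y (hball hy) h) (x := y) hy
      have hsm := contDiffOn_divCoord Metric.isOpen_ball hst hF' κ
      refine (hsm.contDiffAt (Metric.ball_mem_nhds x hε)).congr_of_eventuallyEq ?_
      filter_upwards [Metric.ball_mem_nhds x hε] with y hy
      by_cases hyi : y.1 i = 0
      · simp [hg, hyi]
      · simp only [hg, hyi, if_false]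
        rw [hdiv y hy, hw]; field_simp
    · have hc : ContinuousAt (fun y : (Fin n → ℂ) × V => y.1 i) x := by fun_prop
      have h1 : ContDiffAt ℝ ∞ (fun y => F y / y.1 i) x :=
        (hF.contDiffAt (hΩ.mem_nhds hx)).mul (w.contDiff.contDiffAt.inv hxi)
      refine h1.congr_of_eventuallyEq ?_
      filter_upwards [hc.eventually_ne hxi] with y hy
      simp [hg, hy]
  refine ⟨g, hgs, hFg, fun x hx u => ?_⟩
  have hcr : ContinuousOn (fun x => g (rot u x)) Ω :=
    hgs.continuousOn.comp (continuous_rot u).continuousOn fun x hx => hrot x hx u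
  refine eqOn_of_dense_inter (f := fun x => (u i : ℂ) * g (rot u x))
    (g := fun x => (u i : ℂ) ^ κ * g x) dense_coord_ne_zero hΩ (continuousOn_const.mul hcr)
    (continuousOn_const.mul hgs.continuousOn) ?_ x hx
  intro x hx hxD
  have h1 := hFg _ (hrot x hx u)
  rw [hFrot x hx u, hFg x hx] at h1
  refine mul_left_cancel₀ (hxD i) ?_
  simp only [rot] at h1 ⊢
  linear_combination -h1

end Reinhardt

/-! ### Extension from dense sets, lifting to `ℝ`, and characters of tori. -/

theorem extendFrom_eq_of_continuousOn {X Y : Type*} [TopologicalSpace X] [TopologicalSpace Y]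
    [T2Space Y] {D W : Set X} (hD : Dense D) (hW : IsOpen W) {f F : X → Y} (hF : ContinuousOn F W)
    (h : ∀ x ∈ W, x ∈ D → f x = F x) {x : X} (hx : x ∈ W) : extendFrom D f x = F x := by
  refine extendFrom_eq (hD x) ?_
  have h1 : Filter.Tendsto F (𝓝[D] x) (𝓝 (F x)) :=
    (hF.continuousAt (hW.mem_nhds hx)).mono_left nhdsWithin_le_nhds
  refine h1.congr' ?_
  filter_upwards [self_mem_nhdsWithin, mem_nhdsWithin_of_mem_nhds (hW.mem_nhds hx)] with y hy hy'
  exact (h y hy' hy).symm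

theorem exists_lift_of_convex {E : Type*} [NormedAddCommGroup E] [NormedSpace ℝ E] {C : Set E}
    (hC : Convex ℝ C) (hCo : IsOpen C) {θ : E → Circle} (hθ : ContinuousOn θ C) :
    ∃ a : E → ℝ, ContinuousOn a C ∧ ∀ x ∈ C, Circle.exp (a x) = θ x := by
  classical
  by_cases hne : C.Nonempty
  · have := hC.contractibleSpace hne
    have := hCo.locallyPathConnectedSpace
    obtain ⟨x₀, hx₀⟩ := hne
    obtain ⟨r, hr⟩ := Circle.exp_surjective (θ x₀)
    obtain ⟨F, ⟨-, hF⟩, -⟩ := Circle.isCoveringMap_exp.existsUnique_continuousMap_lifts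
      (⟨C.domRestrict θ, hθ.domRestrict⟩ : C(C, Circle)) ⟨x₀, hx₀⟩ r hr
    refine ⟨fun x => if h : x ∈ C then F ⟨x, h⟩ else 0, ?_, fun x hx => ?_⟩
    · rw [continuousOn_iff_continuous_domRestrict]
      refine F.continuous.congr fun x => ?_
      simp
    · simp only [hx, dif_pos]
      exact congrFun hF ⟨x, hx⟩
  · rw [Set.not_nonempty_iff_eq_empty] at hne
    subst hne
    exact ⟨0, by simp, by simp⟩

theorem const_of_exp_eq_one {X : Type*} [TopologicalSpace X] {S : Set X} (hS : IsPreconnected S)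
    {g : X → ℝ} (hg : ContinuousOn g S) (h : ∀ x ∈ S, Circle.exp (g x) = 1) {x y : X}
    (hx : x ∈ S) (hy : y ∈ S) : g x = g y :=
  Circle.isCoveringMap_exp.constOn_of_comp hS hg (fun a ha b hb => by rw [h a ha, h b hb])
    hx hy

/-- The lift of `θ ↦ f (exp θ)` to `ℝ` is additive, hence linear by continuity, and its slope is an
integer because `2π` goes to the kernel of `exp`. -/
theorem circleHom_eq_zpow (f : Circle →* Circle) (hf : Continuous f) :
    ∃ N : ℤ, ∀ u, f u = u ^ N := by
  have hc : Continuous fun θ : ℝ => f (Circle.exp θ) := hf.comp Circle.exp.continuous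
  obtain ⟨g₀, ⟨hg0, hg⟩, -⟩ := Circle.isCoveringMap_exp.existsUnique_continuousMap_lifts
    (⟨_, hc⟩ : C(ℝ, Circle)) 0 0 (by simp)
  have hg' : ∀ θ, Circle.exp (g₀ θ) = f (Circle.exp θ) := fun θ => congrFun hg θ
  have hadd : ∀ x y, g₀ (x + y) = g₀ x + g₀ y := by
    intro x y
    -- The defect of additivity lies in the discrete kernel of `exp`, so it is constant, and it
    -- vanishes at the origin.
    have h := const_of_exp_eq_one (S := Set.univ)
      (g := fun p : ℝ × ℝ => g₀ (p.1 + p.2) - (g₀ p.1 + g₀ p.2))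
      isPreconnected_univ (by fun_prop) (fun p _ => by
        rw [Circle.exp_sub, Circle.exp_add, hg', hg', hg', Circle.exp_add, map_mul, div_self']) 
        (Set.mem_univ (x, y)) (Set.mem_univ (0, 0))
    simp only [add_zero, hg0, sub_zero] at h
    linarith
  let G : ℝ →+ ℝ := AddMonoidHom.mk' g₀ hadd
  have hlin : ∀ x, g₀ x = x * g₀ 1 := by
    intro x
    have := map_real_smul G g₀.continuous x 1
    simpa [G] using this
  have h2 : Circle.exp (g₀ (2 * Real.pi)) = 1 := by rw [hg', Circle.exp_two_pi, map_one]
  obtain ⟨N, hN⟩ := Circle.exp_eq_one.mp h2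
  have h1 : g₀ 1 = N := by
    rw [hlin] at hN
    have : (2 * Real.pi) ≠ 0 := by positivity
    exact mul_left_cancel₀ this (by linarith)
  refine ⟨N, fun u => ?_⟩
  obtain ⟨θ, rfl⟩ := Circle.exp_surjective u
  rw [← hg', hlin, h1, mul_comm]
  simp

theorem circleHom_injective_eq (f : Circle →* Circle) (hf : Continuous f)
    (hinj : Function.Injective f) : (∀ u, f u = u) ∨ ∀ u, f u = u⁻¹ := by
  obtain ⟨N, hN⟩ := circleHom_eq_zpow f hf
  have h1 : ∀ θ : ℝ, Circle.exp (N * θ) = 1 → Circle.exp θ = 1 := by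
    intro θ h
    refine hinj ?_
    rw [hN, map_one, ← h, ← zsmul_eq_mul, Circle.exp_zsmul]
  by_cases hN0 : N = 0
  · have := h1 Real.pi (by simp [hN0])
    have h3 := congrArg (fun z : Circle => (z : ℂ)) this
    simp only [Circle.coe_exp, Complex.exp_pi_mul_I, Circle.coe_one] at h3
    norm_num at h3
  · have hNr : (N : ℝ) ≠ 0 := by exact_mod_cast hN0
    have := h1 (2 * Real.pi / N) (by rw [mul_div_cancel₀ _ hNr]; simp)
    obtain ⟨q, hq⟩ := Circle.exp_eq_one.mp this
    have h2 : (1 : ℝ) = q * N := by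
      have hpi : (2 * Real.pi) ≠ 0 := by positivity
      field_simp at hq
      linarith
    have h3 : (1 : ℤ) = q * N := by exact_mod_cast h2
    rcases Int.isUnit_iff.mp
      (IsUnit.of_mul_eq_one (a := N) q (by rw [mul_comm]; exact h3.symm)) with h | h
    · left; intro u; rw [hN, h, zpow_one]
    · right; intro u; rw [hN, h, zpow_neg, zpow_one]

theorem torusHom_eq_prod {n : ℕ} (χ : Torus n →* Circle) (hχ : Continuous χ) :
    ∃ N : Fin n → ℤ, ∀ u, χ u = ∏ i, u i ^ N i := by
  have h : ∀ i, ∃ N : ℤ, ∀ u : Circle, χ (Pi.mulSingle i u) = u ^ N := fun i =>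
    circleHom_eq_zpow (χ.comp (MonoidHom.mulSingle (fun _ : Fin n => Circle) i))
      (hχ.comp (continuous_mulSingle (A := fun _ : Fin n => Circle) i))
  choose N hN using h
  refine ⟨N, fun u => ?_⟩
  conv_lhs => rw [← Finset.univ_prod_mulSingle u]
  rw [map_prod]
  exact Finset.prod_congr rfl fun i _ => hN i _

/-! ### Smooth maps into the torus. -/

section TorusSmooth

variable {E H M : Type*} [NormedAddCommGroup E] [NormedSpace ℝ E] [TopologicalSpace H]
  {I : ModelWithCorners ℝ E H} [TopologicalSpace M] [ChartedSpace H M]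

theorem contMDiffAt_torus_iff {k : ℕ} {f : M → Torus k} {x : M} :
    ContMDiffAt I (torusModel k) ∞ f x ↔ ∀ i, ContMDiffAt I (𝓡 1) ∞ (fun y => f y i) x := by
  have h : extChartAt (torusModel k) (f x) ∘ f =
      fun y i => extChartAt (𝓡 1) (f x i) (f y i) := rfl
  rw [contMDiffAt_iff_target, h, contMDiffAt_pi_space, continuousAt_pi, ← forall_and]
  refine forall_congr' fun i => ?_
  exact (contMDiffAt_iff_target (I' := 𝓡 1) (f := fun y => f y i)).symm

theorem contMDiffAt_circle_coe {f : M → Circle} {x : M} (hf : ContMDiffAt I (𝓡 1) ∞ f x) :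
    ContMDiffAt I 𝓘(ℝ, ℂ) ∞ (fun y => (f y : ℂ)) x := by
  have : ContMDiff (𝓡 1) 𝓘(ℝ, ℂ) ∞ (fun z : Circle => (z : ℂ)) := by
    have := finrank_real_complex_fact'
    exact contMDiff_coe_sphere
  exact this.contMDiffAt.comp x hf

theorem contMDiffAt_arg {f : M → Circle} {x : M} (hf : ContMDiffAt I (𝓡 1) ∞ f x)
    (h : (f x : ℂ) ∈ Complex.slitPlane) :
    ContMDiffAt I 𝓘(ℝ, ℝ) ∞ (fun y => Complex.arg (f y)) x := by
  have h1 : ContDiffAt ℝ ∞ (fun z : ℂ => (Complex.log z).im) (f x) :=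
    Complex.imCLM.contDiff.contDiffAt.comp (f x : ℂ) ((Complex.contDiffAt_log h).restrict_scalars ℝ)
  simp only [Complex.log_im] at h1
  exact h1.contMDiffAt.comp x (contMDiffAt_circle_coe hf)

/-- Near `x` the function is `f x * exp (arg ((f x)⁻¹ f y))`, where the argument is taken near `1`
and is therefore smooth. -/
theorem contMDiffAt_circle_of_coe {f : M → Circle} {x : M}
    (hf : ContMDiffAt I 𝓘(ℝ, ℂ) ∞ (fun y => (f y : ℂ)) x) : ContMDiffAt I (𝓡 1) ∞ f x := by
  have h1 : f = fun y => f x * Circle.exp (Complex.arg ((f x : ℂ)⁻¹ * f y)) := by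
    ext1 y
    have := Circle.exp_arg ((f x)⁻¹ * f y)
    rw [Circle.coe_mul, Circle.coe_inv] at this
    rw [this, mul_inv_cancel_left]
  have h2 : ContDiffAt ℝ ∞ (fun z : ℂ => (Complex.log z).im) ((f x : ℂ)⁻¹ * f x) := by
    refine Complex.imCLM.contDiff.contDiffAt.comp (_ : ℂ)
      ((Complex.contDiffAt_log ?_).restrict_scalars ℝ)
    simp
  simp only [Complex.log_im] at h2
  have h4 : ContMDiffAt I 𝓘(ℝ, ℂ) ∞ (fun y => (f x : ℂ)⁻¹ * f y) x :=
    ((contDiff_const.mul contDiff_id).contDiffAt (x := (f x : ℂ))).contMDiffAt.comp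
      (I' := 𝓘(ℝ, ℂ)) (g := fun z : ℂ => ((f x : ℂ))⁻¹ * z) x hf
  have h3 : ContMDiffAt I 𝓘(ℝ, ℝ) ∞ (fun y => Complex.arg ((f x : ℂ)⁻¹ * f y)) x :=
    ContMDiffAt.comp (I' := 𝓘(ℝ, ℂ)) (g := fun z : ℂ => Complex.arg z) x h2.contMDiffAt h4
  rw [h1]
  exact contMDiffAt_const.mul (contMDiff_circleExp.contMDiffAt.comp x h3)

theorem contMDiffAt_torus_mul {k : ℕ} {f g : M → Torus k} {x : M}
    (hf : ContMDiffAt I (torusModel k) ∞ f x) (hg : ContMDiffAt I (torusModel k) ∞ g x) :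
    ContMDiffAt I (torusModel k) ∞ (fun y => f y * g y) x :=
  contMDiffAt_torus_iff.mpr fun i =>
    (contMDiffAt_torus_iff.mp hf i).mul (contMDiffAt_torus_iff.mp hg i)

theorem contMDiffAt_torus_inv {k : ℕ} {f : M → Torus k} {x : M}
    (hf : ContMDiffAt I (torusModel k) ∞ f x) :
    ContMDiffAt I (torusModel k) ∞ (fun y => (f y)⁻¹) x :=
  contMDiffAt_torus_iff.mpr fun i => (contMDiffAt_torus_iff.mp hf i).inv

theorem contMDiffAt_circle_zpow {f : M → Circle} {x : M} (hf : ContMDiffAt I (𝓡 1) ∞ f x) (N : ℤ) :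
    ContMDiffAt I (𝓡 1) ∞ (fun y => f y ^ N) x := by
  have h : ∀ q : ℕ, ContMDiffAt I (𝓡 1) ∞ (fun y => f y ^ q) x := by
    intro q
    induction q with
    | zero => simpa using contMDiffAt_const
    | succ q ih => simp only [pow_succ]; exact ih.mul hf
  cases N with
  | ofNat q => simpa using h q
  | negSucc q => simpa only [zpow_negSucc] using (h (q + 1)).inv

theorem contMDiffAt_torusHom {n : ℕ} {χ : Torus n →* Circle} (hχ : Continuous χ) {f : M → Torus n}
    {x : M} (hf : ContMDiffAt I (torusModel n) ∞ f x) :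
    ContMDiffAt I (𝓡 1) ∞ (fun y => χ (f y)) x := by
  obtain ⟨N, hN⟩ := torusHom_eq_prod χ hχ
  simp only [hN]
  have h : ∀ s : Finset (Fin n), ContMDiffAt I (𝓡 1) ∞ (fun y => ∏ i ∈ s, f y i ^ N i) x := by
    intro s
    induction s using Finset.induction_on with
    | empty => simpa using contMDiffAt_const
    | insert i s hi ih =>
      simp only [Finset.prod_insert hi]
      exact (contMDiffAt_circle_zpow (contMDiffAt_torus_iff.mp hf i) _).mul ih
  exact h _

/-- Continuous characters of a torus are monomials, hence smooth. This makes the splitting of the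
torus, assumed only continuous, smooth in both directions. -/
theorem contMDiffAt_torusProdHom {n l k : ℕ} {χ : Torus n × Torus l →* Torus k} (hχ : Continuous χ)
    {f : M → Torus n} {g : M → Torus l} {x : M} (hf : ContMDiffAt I (torusModel n) ∞ f x)
    (hg : ContMDiffAt I (torusModel l) ∞ g x) :
    ContMDiffAt I (torusModel k) ∞ (fun y => χ (f y, g y)) x := by
  have h : ∀ y, χ (f y, g y) = χ (f y, 1) * χ (1, g y) := fun y => by
    rw [← map_mul]; simp
  simp only [h]
  refine contMDiffAt_torus_mul (contMDiffAt_torus_iff.mpr fun i => ?_)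
    (contMDiffAt_torus_iff.mpr fun i => ?_)
  · exact contMDiffAt_torusHom (χ := (Pi.evalMonoidHom (fun _ : Fin k => Circle) i).comp
      (χ.comp (MonoidHom.inl _ _)))
      ((continuous_apply i).comp (hχ.comp (Continuous.prodMk continuous_id continuous_const))) hf
  · exact contMDiffAt_torusHom (χ := (Pi.evalMonoidHom (fun _ : Fin k => Circle) i).comp
      (χ.comp (MonoidHom.inr _ _)))
      ((continuous_apply i).comp (hχ.comp (Continuous.prodMk continuous_const continuous_id))) hg

/-- The exponential map `ℝ^k → T^k`. -/
noncomputable def torusExp {k : ℕ} (a : Fin k → ℝ) : Torus k := fun i => Circle.exp (a i)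

theorem torusExp_sub {k : ℕ} (a b : Fin k → ℝ) : torusExp (a - b) = torusExp a / torusExp b := by
  ext i; simp [torusExp, Circle.exp_sub]

theorem contMDiffAt_torusExp {k : ℕ} {a : M → Fin k → ℝ} {x : M}
    (ha : ContMDiffAt I 𝓘(ℝ, Fin k → ℝ) ∞ a x) :
    ContMDiffAt I (torusModel k) ∞ (fun y => torusExp (a y)) x :=
  contMDiffAt_torus_iff.mpr fun i =>
    contMDiff_circleExp.contMDiffAt.comp x (contMDiffAt_pi_space.mp ha i)

/-- A right inverse of the exponential map of the torus, smooth near the point `t₀`. -/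
noncomputable def torusLog {k : ℕ} (t₀ t : Torus k) : Fin k → ℝ :=
  fun i => Complex.arg (t₀ i) + Complex.arg (((t₀ i)⁻¹ * t i : Circle) : ℂ)

theorem torusExp_torusLog {k : ℕ} (t₀ t : Torus k) : torusExp (torusLog t₀ t) = t := by
  funext i
  simp only [torusExp, torusLog]
  rw [Circle.exp_add, Circle.exp_arg, Circle.exp_arg, mul_inv_cancel_left]

theorem contMDiffAt_torusLog {k : ℕ} {t₀ : Torus k} {f : M → Torus k} {x : M}
    (hf : ContMDiffAt I (torusModel k) ∞ f x)
    (h : ∀ i, (((t₀ i)⁻¹ * f x i : Circle) : ℂ) ∈ Complex.slitPlane) :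
    ContMDiffAt I 𝓘(ℝ, Fin k → ℝ) ∞ (fun y => torusLog t₀ (f y)) x := by
  refine contMDiffAt_pi_space.mpr fun i => ?_
  exact contMDiffAt_const.add
    (contMDiffAt_arg (contMDiffAt_const.mul (contMDiffAt_torus_iff.mp hf i)) (h i))

theorem torus_log_nhds {k : ℕ} (t₀ : Torus k) :
    ∀ᶠ t in 𝓝 t₀, ∀ i, (((t₀ i)⁻¹ * t i : Circle) : ℂ) ∈ Complex.slitPlane := by
  rw [Filter.eventually_all]
  intro i
  have hc : Continuous fun t : Torus k => (((t₀ i)⁻¹ * t i : Circle) : ℂ) := by fun_prop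
  refine hc.continuousAt.eventually_mem (Complex.isOpen_slitPlane.mem_nhds ?_)
  simp

end TorusSmooth

/-! ### Averaging over the torus, one circle at a time. -/

section Average

variable {k d q : ℕ} {M : Type*} [MulAction (Torus k) M]

/-- The element of `T^k` with `i`-th coordinate `u` and all other coordinates trivial. -/
noncomputable abbrev coordCircle {k : ℕ} (i : Fin k) (u : Circle) : Torus k := Pi.mulSingle i u

theorem contMDiffAt_coordCircle_exp {k : ℕ} (i : Fin k) (s : ℝ) :
    ContMDiffAt 𝓘(ℝ, ℝ) (torusModel k) ∞
      (fun s : ℝ => coordCircle i (Circle.exp (2 * Real.pi * s))) s := by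
  refine contMDiffAt_torus_iff.mpr fun l => ?_
  by_cases h : l = i
  · subst h
    simp only [coordCircle, Pi.mulSingle_eq_same]
    have h1 : ContDiff ℝ ∞ fun s : ℝ => 2 * Real.pi * s := contDiff_const.mul contDiff_id
    exact contMDiff_circleExp.contMDiffAt.comp s h1.contMDiff.contMDiffAt
  · simp only [coordCircle, Pi.mulSingle_eq_of_ne h]
    exact contMDiffAt_const

/-- The average of a function over the `i`-th circle of the torus. -/
noncomputable def circleAvg (i : Fin k) (w : M → Fin q → ℝ) (x : M) : Fin q → ℝ :=
  ∫ s in (0 : ℝ)..1, w (coordCircle i (Circle.exp (2 * Real.pi * s)) • x)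

/-- The average of a function over the circles in a list. -/
noncomputable def listAvg (L : List (Fin k)) (w : M → Fin q → ℝ) : M → Fin q → ℝ :=
  L.foldr circleAvg w

theorem circleAvg_coordCircle_smul (i : Fin k) (w : M → Fin q → ℝ) (u : Circle) (x : M) :
    circleAvg i w (coordCircle i u • x) = circleAvg i w x := by
  obtain ⟨θ, rfl⟩ := Circle.exp_surjective u
  set r := θ / (2 * Real.pi) with hr
  have hθ : θ = 2 * Real.pi * r := by rw [hr]; field_simp
  set g : ℝ → Fin q → ℝ := fun s => w (coordCircle i (Circle.exp (2 * Real.pi * s)) • x) with hg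
  have hper : Function.Periodic g 1 := by
    intro s
    simp only [hg, mul_add, mul_one, Circle.exp_add_two_pi]
  have h1 : circleAvg i w (coordCircle i (Circle.exp θ) • x) = ∫ s in (0 : ℝ)..1, g (s + r) := by
    refine intervalIntegral.integral_congr fun s _ => ?_
    simp only [hg]
    rw [← mul_smul, ← Pi.mulSingle_mul, ← Circle.exp_add, hθ, mul_add]
  rw [h1, intervalIntegral.integral_comp_add_right, zero_add, add_comm]
  have := hper.intervalIntegral_add_eq r 0
  rwa [zero_add] at this

theorem circleAvg_smul {V : Set M} (hV : ∀ t : Torus k, ∀ x ∈ V, t • x ∈ V) (i : Fin k)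
    {w : M → Fin q → ℝ} {t : Torus k} (ht : ∀ x ∈ V, w (t • x) = w x) :
    ∀ x ∈ V, circleAvg i w (t • x) = circleAvg i w x := by
  intro x hx
  refine intervalIntegral.integral_congr fun s _ => ?_
  rw [← mul_smul, mul_comm, mul_smul, ht _ (hV _ x hx)]

/-- Averaging over a circle produces invariance under that circle, and later averages preserve it
because the torus is commutative. -/
theorem listAvg_smul {V : Set M} (hV : ∀ t : Torus k, ∀ x ∈ V, t • x ∈ V) (w : M → Fin q → ℝ)
    {L : List (Fin k)} {i : Fin k} (hi : i ∈ L) (u : Circle) :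
    ∀ x ∈ V, listAvg L w (coordCircle i u • x) = listAvg L w x := by
  induction L with
  | nil => simp at hi
  | cons l L ih =>
    rcases List.mem_cons.mp hi with rfl | h
    · exact fun x _ => circleAvg_coordCircle_smul i _ u x
    · exact circleAvg_smul hV l (ih h)

theorem invariant_of_coordCircle {X : Type*} {V : Set M} (hV : ∀ t : Torus k, ∀ x ∈ V, t • x ∈ V)
    {w : M → X} (h : ∀ (i : Fin k) (u : Circle), ∀ x ∈ V, w (coordCircle i u • x) = w x)
    (t : Torus k) :
    ∀ x ∈ V, w (t • x) = w x := by
  have key : ∀ s : Finset (Fin k), ∀ x ∈ V, w ((∏ i ∈ s, coordCircle i (t i)) • x) = w x := by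
    intro s
    induction s using Finset.induction_on with
    | empty => simp
    | insert i s hi ih =>
      intro x hx
      rw [Finset.prod_insert hi, mul_smul, h _ _ _ (hV _ x hx), ih x hx]
  intro x hx
  have := key Finset.univ x hx
  rwa [Finset.univ_prod_mulSingle] at this

variable [TopologicalSpace M] [ChartedSpace (EuclideanSpace ℝ (Fin d)) M]
  [ContMDiffSMul (torusModel k) (𝓡 d) ∞ (Torus k) M]

theorem intervalIntegrable_orbit {V : Set M} (hV : ∀ t : Torus k, ∀ x ∈ V, t • x ∈ V)
    (i : Fin k) {w : M → Fin q → ℝ}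
    (hw : ∀ x ∈ V, ContMDiffAt (𝓡 d) 𝓘(ℝ, Fin q → ℝ) ∞ w x) {x : M} (hx : x ∈ V) :
    IntervalIntegrable (fun s : ℝ => w (coordCircle i (Circle.exp (2 * Real.pi * s)) • x))
      MeasureTheory.volume 0 1 := by
  refine Continuous.intervalIntegrable ?_ _ _
  refine continuous_iff_continuousAt.mpr fun s => ?_
  have h1 := (contMDiffAt_coordCircle_exp i s).smul
    (contMDiffAt_const (I' := 𝓡 d) (c := x))
  exact ContinuousAt.comp (g := w) (hw _ (hV _ _ hx)).continuousAt h1.continuousAt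

variable [IsManifold (𝓡 d) ∞ M]

theorem contMDiffAt_circleAvg {V : Set M} (hVo : IsOpen V) (hV : ∀ t : Torus k, ∀ x ∈ V, t • x ∈ V)
    (i : Fin k) {w : M → Fin q → ℝ} (hw : ∀ x ∈ V, ContMDiffAt (𝓡 d) 𝓘(ℝ, Fin q → ℝ) ∞ w x) :
    ∀ x ∈ V, ContMDiffAt (𝓡 d) 𝓘(ℝ, Fin q → ℝ) ∞ (circleAvg i w) x := by
  intro x hx
  set φ := extChartAt (𝓡 d) x with hφ
  set U : Set (EuclideanSpace ℝ (Fin d)) := φ.target ∩ φ.symm ⁻¹' V with hUdef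
  have hUo : IsOpen U :=
    (continuousOn_extChartAt_symm x).isOpen_inter_preimage (isOpen_extChartAt_target x) hVo
  set f : EuclideanSpace ℝ (Fin d) → ℝ → Fin q → ℝ := fun v s =>
    w (coordCircle i (Circle.exp (2 * Real.pi * s)) • φ.symm v) with hf
  have hint : ContDiffOn ℝ ∞ (fun v => ∫ s in (0 : ℝ)..1, f v s) U := by
    refine contDiffOn_integral hUo fun v hv s _ => ?_
    rw [← contMDiffAt_iff_contDiffAt]
    have h1 : ContMDiffAt 𝓘(ℝ, EuclideanSpace ℝ (Fin d) × ℝ) (torusModel k) ∞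
        (fun p : EuclideanSpace ℝ (Fin d) × ℝ =>
          coordCircle i (Circle.exp (2 * Real.pi * p.2))) (v, s) :=
      ContMDiffAt.comp (v, s) (g := fun s : ℝ => coordCircle i (Circle.exp (2 * Real.pi * s)))
        (contMDiffAt_coordCircle_exp i s)
        contDiff_snd.contMDiff.contMDiffAt
    have h2 : ContMDiffAt 𝓘(ℝ, EuclideanSpace ℝ (Fin d) × ℝ) (𝓡 d) ∞
        (fun p : EuclideanSpace ℝ (Fin d) × ℝ => φ.symm p.1) (v, s) := by
      have h3 : ContMDiffAt 𝓘(ℝ, EuclideanSpace ℝ (Fin d)) (𝓡 d) ∞ φ.symm v :=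
        (contMDiffOn_extChartAt_symm x).contMDiffAt ((isOpen_extChartAt_target x).mem_nhds hv.1)
      exact ContMDiffAt.comp (v, s) (g := φ.symm) h3 contDiff_fst.contMDiff.contMDiffAt
    have h4 := h1.smul h2
    exact ContMDiffAt.comp (v, s) (g := w) (hw _ (hV _ _ hv.2)) h4
  have hxU : φ x ∈ U := ⟨mem_extChartAt_target x, by
    simp only [Set.mem_preimage, hφ, extChartAt_to_inv]; exact hx⟩
  have h5 : ContMDiffAt (𝓡 d) 𝓘(ℝ, Fin q → ℝ) ∞
      (fun y => ∫ s in (0 : ℝ)..1, f (φ y) s) x :=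
    ContMDiffAt.comp x (g := fun v => ∫ s in (0 : ℝ)..1, f v s)
      (hint.contDiffAt (hUo.mem_nhds hxU)).contMDiffAt contMDiffAt_extChartAt
  refine h5.congr_of_eventuallyEq ?_
  filter_upwards [extChartAt_source_mem_nhds (I := 𝓡 d) x] with y hy
  refine intervalIntegral.integral_congr fun s _ => ?_
  simp only [hf]
  rw [φ.left_inv hy]

theorem contMDiffAt_listAvg {V : Set M} (hVo : IsOpen V) (hV : ∀ t : Torus k, ∀ x ∈ V, t • x ∈ V)
    (L : List (Fin k)) {w : M → Fin q → ℝ}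
    (hw : ∀ x ∈ V, ContMDiffAt (𝓡 d) 𝓘(ℝ, Fin q → ℝ) ∞ w x) :
    ∀ x ∈ V, ContMDiffAt (𝓡 d) 𝓘(ℝ, Fin q → ℝ) ∞ (listAvg L w) x := by
  induction L with
  | nil => exact hw
  | cons l L ih => exact contMDiffAt_circleAvg hVo hV l ih

/-- Averaging is linear and fixes invariant functions, so making functions invariant does not
disturb their invariant differences. -/
theorem listAvg_sub {V : Set M} (hVo : IsOpen V) (hV : ∀ t : Torus k, ∀ x ∈ V, t • x ∈ V)
    (L : List (Fin k)) {w w' c : M → Fin q → ℝ}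
    (hw : ∀ x ∈ V, ContMDiffAt (𝓡 d) 𝓘(ℝ, Fin q → ℝ) ∞ w x)
    (hw' : ∀ x ∈ V, ContMDiffAt (𝓡 d) 𝓘(ℝ, Fin q → ℝ) ∞ w' x)
    (hc : ∀ t : Torus k, ∀ x ∈ V, c (t • x) = c x) (h : ∀ x ∈ V, w x - w' x = c x) :
    ∀ x ∈ V, listAvg L w x - listAvg L w' x = c x := by
  induction L with
  | nil => exact h
  | cons l L ih =>
    intro x hx
    change circleAvg l (listAvg L w) x - circleAvg l (listAvg L w') x = c x
    unfold circleAvg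
    rw [← intervalIntegral.integral_sub
      (intervalIntegrable_orbit hV l (contMDiffAt_listAvg hVo hV L hw) hx)
      (intervalIntegrable_orbit hV l (contMDiffAt_listAvg hVo hV L hw') hx)]
    have : ∀ s : ℝ, listAvg L w (coordCircle l (Circle.exp (2 * Real.pi * s)) • x) -
        listAvg L w' (coordCircle l (Circle.exp (2 * Real.pi * s)) • x) = c x := fun s => by
      rw [ih _ (hV _ x hx), hc _ x hx]
    simp [this]

end Average

/-! ### Polar coordinates. -/

section Phase

/-- The phase of a complex number. -/
noncomputable def phase (z : ℂ) : Circle := Circle.exp (Complex.arg z)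

theorem phase_mul_norm (z : ℂ) : (phase z : ℂ) * ‖z‖ = z := by
  rw [phase, Circle.coe_exp, mul_comm]
  exact Complex.norm_mul_exp_arg_mul_I z

theorem coe_phase {z : ℂ} (hz : z ≠ 0) : (phase z : ℂ) = z * (‖z‖ : ℂ)⁻¹ := by
  have h : (‖z‖ : ℂ) ≠ 0 := by simpa using hz
  rw [eq_mul_inv_iff_mul_eq₀ h, phase_mul_norm]

theorem contMDiffAt_phase {z : ℂ} (hz : z ≠ 0) : ContMDiffAt 𝓘(ℝ, ℂ) (𝓡 1) ∞ phase z := by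
  refine contMDiffAt_circle_of_coe (ContDiffAt.contMDiffAt ?_)
  have h1 : ContDiffAt ℝ ∞ (fun z : ℂ => (‖z‖ : ℂ)) z :=
    Complex.ofRealCLM.contDiff.contDiffAt.comp z (contDiffAt_norm ℝ hz)
  have h2 : ContDiffAt ℝ ∞ (fun z : ℂ => z * (‖z‖ : ℂ)⁻¹) z :=
    contDiffAt_id.mul (h1.inv (by simpa using hz))
  refine h2.congr_of_eventuallyEq ?_
  filter_upwards [continuousAt_id.eventually_ne hz] with y hy
  exact coe_phase hy

theorem circle_neg_one_ne_one : Circle.exp Real.pi ≠ 1 := by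
  intro h
  have h3 := congrArg (fun z : Circle => (z : ℂ)) h
  simp only [Circle.coe_exp, Complex.exp_pi_mul_I, Circle.coe_one] at h3
  norm_num at h3

end Phase

/-- An equivariant diffeomorphism from an invariant open subset of `M` to `ℂ^n × T^l × ℝ^m` with
the standard action. -/
structure StdChart (k d : ℕ) (M : Type*) [TopologicalSpace M]
    [ChartedSpace (EuclideanSpace ℝ (Fin d)) M] [MulAction (Torus k) M] where
  n : ℕ
  l : ℕ
  m : ℕ
  A : ModelAction k n l
  standard : A.IsStandard
  chart : InvariantChart d M A m

/-! ### Standard charts, their slices and isotropy groups. -/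

namespace StdChart

variable {k d : ℕ} {M : Type*} [TopologicalSpace M]
  [ChartedSpace (EuclideanSpace ℝ (Fin d)) M] [MulAction (Torus k) M] (S : StdChart k d M)

/-- The torus-free part `ℂ^n × ℝ^m` of the local model. -/
abbrev E : Type := (Fin S.n → ℂ) × EuclideanSpace ℝ (Fin S.m)

/-- The domain of the chart. -/
def source : Set M := S.chart.source

/-- The coordinates in `ℂ^n × ℝ^m`. -/
def coord (x : M) : S.E := ((S.chart.toFun x).1, (S.chart.toFun x).2.2)

/-- The coordinate in `T^l`. -/
def ang (x : M) : Torus S.l := (S.chart.toFun x).2.1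

/-- The slice `ℂ^n × {1} × ℝ^m`. -/
noncomputable def slice (v : S.E) : M := S.chart.invFun (v.1, 1, v.2)

/-- The inverse of the splitting of the torus. -/
noncomputable def unsplit (u : Torus S.n) (τ : Torus S.l) : Torus k := S.A.splitting.symm (u, τ)

theorem isOpen_source : IsOpen S.source := S.chart.open_source

theorem smul_mem (t : Torus k) {x : M} (hx : x ∈ S.source) : t • x ∈ S.source :=
  S.chart.smul_mem t x hx

theorem slice_mem (v : S.E) : S.slice v ∈ S.source :=
  S.chart.map_target' (by rw [S.chart.target_eq_univ]; trivial)

theorem chart_invFun (p : LocalModel S.n S.l S.m) : S.chart.toFun (S.chart.invFun p) = p :=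
  S.chart.right_inv' (by rw [S.chart.target_eq_univ]; trivial)

@[simp] theorem coord_slice (v : S.E) : S.coord (S.slice v) = v := by
  simp only [coord, slice, chart_invFun]

@[simp] theorem ang_slice (v : S.E) : S.ang (S.slice v) = 1 := by
  simp only [ang, slice, chart_invFun]

theorem coord_smul (t : Torus k) {x : M} (hx : x ∈ S.source) :
    S.coord (t • x) = rot (S.A.splitting t).1 (S.coord x) := by
  have h := S.chart.map_smul t x hx
  refine Prod.ext ?_ ?_
  · ext i
    simp only [coord, rot, h, ModelAction.act]
    exact S.standard _ _ i
  · simp only [coord, rot, h, ModelAction.act]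

theorem ang_smul (t : Torus k) {x : M} (hx : x ∈ S.source) :
    S.ang (t • x) = (S.A.splitting t).2 * S.ang x := by
  have h := S.chart.map_smul t x hx
  simp only [ang, h, ModelAction.act]

theorem ext_coord {x y : M} (hx : x ∈ S.source) (hy : y ∈ S.source) (h1 : S.coord x = S.coord y)
    (h2 : S.ang x = S.ang y) : x = y := by
  have h3 : (S.chart.toFun x).1 = (S.chart.toFun y).1 := congrArg (fun p : S.E => p.1) h1
  have h4 : (S.chart.toFun x).2.2 = (S.chart.toFun y).2.2 := congrArg (fun p : S.E => p.2) h1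
  exact S.chart.injOn hx hy (Prod.ext h3 (Prod.ext h2 h4))

@[simp] theorem splitting_unsplit (u : Torus S.n) (τ : Torus S.l) :
    S.A.splitting (S.unsplit u τ) = (u, τ) := S.A.splitting.apply_symm_apply _

theorem unsplit_mul (u u' : Torus S.n) (τ τ' : Torus S.l) :
    S.unsplit (u * u') (τ * τ') = S.unsplit u τ * S.unsplit u' τ' :=
  map_mul S.A.splitting.symm (u, τ) (u', τ')

theorem unsplit_splitting (t : Torus k) :
    S.unsplit (S.A.splitting t).1 (S.A.splitting t).2 = t := S.A.splitting.symm_apply_apply t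

theorem unsplit_smul_slice (u : Torus S.n) (v : S.E) :
    S.unsplit u 1 • S.slice v = S.slice (rot u v) := by
  refine S.ext_coord (S.smul_mem _ (S.slice_mem _)) (S.slice_mem _) ?_ ?_
  · rw [S.coord_smul _ (S.slice_mem _)]; simp
  · rw [S.ang_smul _ (S.slice_mem _)]; simp

theorem unsplit_ang_smul_slice {x : M} (hx : x ∈ S.source) :
    S.unsplit 1 (S.ang x) • S.slice (S.coord x) = x := by
  refine S.ext_coord (S.smul_mem _ (S.slice_mem _)) hx ?_ ?_
  · rw [S.coord_smul _ (S.slice_mem _)]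
    simp [rot]
  · rw [S.ang_smul _ (S.slice_mem _)]; simp

theorem orbitMap_slice_rot (u : Torus S.n) (v : S.E) :
    orbitMap k (S.slice (rot u v)) = orbitMap k (S.slice v) := by
  rw [← unsplit_smul_slice]
  exact Quotient.sound ⟨_, rfl⟩

theorem orbitMap_slice_coord {x : M} (hx : x ∈ S.source) :
    orbitMap k (S.slice (S.coord x)) = orbitMap k x := by
  conv_rhs => rw [← S.unsplit_ang_smul_slice hx]
  exact (Quotient.sound ⟨_, rfl⟩ : orbitMap k (_ • _) = _).symm

theorem mem_source_of_orbitMap_eq {x y : M} (h : orbitMap k x = orbitMap k y)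
    (hy : y ∈ S.source) : x ∈ S.source := S.chart.mem_source_of_orbitMap_eq h hy

theorem orbitMap_eq_iff {x y : M} (hx : x ∈ S.source) (hy : y ∈ S.source) :
    orbitMap k x = orbitMap k y ↔
      (∀ i, ‖(S.coord x).1 i‖ = ‖(S.coord y).1 i‖) ∧ (S.coord x).2 = (S.coord y).2 := by
  rw [← S.chart.momentMap_eq_iff S.standard hx hy]
  constructor
  · intro h
    refine ⟨fun i => ?_, congrArg (fun p : Corner S.n S.m => p.2) h⟩
    have := congrArg (fun p : Corner S.n S.m => p.1.1 i) h
    exact (sq_eq_sq₀ (norm_nonneg _) (norm_nonneg _)).mp this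
  · rintro ⟨h1, h2⟩
    refine Prod.ext (Subtype.ext ?_) h2
    ext i
    exact congrArg (· ^ 2) (h1 i)

theorem contMDiff_slice : ContMDiff 𝓘(ℝ, S.E) (𝓡 d) ∞ S.slice := by
  intro v
  have h1 : ContMDiffAt 𝓘(ℝ, S.E) (localModelCorners S.n S.l S.m) ∞
      (fun v : S.E => ((v.1, 1, v.2) : LocalModel S.n S.l S.m)) v :=
    contDiff_fst.contMDiff.contMDiffAt.prodMk
      (contMDiffAt_const.prodMk contDiff_snd.contMDiff.contMDiffAt)
  have h2 : ContMDiffAt (localModelCorners S.n S.l S.m) (𝓡 d) ∞ S.chart.invFun (v.1, 1, v.2) :=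
    S.chart.contMDiffOn_invFun.contMDiffAt (by rw [S.chart.target_eq_univ]; exact Filter.univ_mem)
  exact h2.comp v h1

theorem contMDiffAt_chart {x : M} (hx : x ∈ S.source) :
    ContMDiffAt (𝓡 d) (localModelCorners S.n S.l S.m) ∞ S.chart.toFun x :=
  S.chart.contMDiffOn_toFun.contMDiffAt (S.isOpen_source.mem_nhds hx)

theorem contMDiffAt_coord {x : M} (hx : x ∈ S.source) :
    ContMDiffAt (𝓡 d) 𝓘(ℝ, S.E) ∞ S.coord x := by
  have h := S.contMDiffAt_chart hx
  have h1 : ContMDiffAt (𝓡 d) 𝓘(ℝ, Fin S.n → ℂ) ∞ (fun x => (S.chart.toFun x).1) x :=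
    contMDiffAt_fst.comp x h
  have h2 : ContMDiffAt (𝓡 d) 𝓘(ℝ, EuclideanSpace ℝ (Fin S.m)) ∞
      (fun x => (S.chart.toFun x).2.2) x :=
    contMDiffAt_snd.comp x (contMDiffAt_snd.comp x h)
  exact h1.prodMk_space h2

theorem contMDiffAt_ang {x : M} (hx : x ∈ S.source) :
    ContMDiffAt (𝓡 d) (torusModel S.l) ∞ S.ang x :=
  contMDiffAt_fst.comp x (contMDiffAt_snd.comp x (S.contMDiffAt_chart hx))

theorem contMDiffAt_unsplit {F H X : Type*} [NormedAddCommGroup F] [NormedSpace ℝ F]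
    [TopologicalSpace H] {I : ModelWithCorners ℝ F H} [TopologicalSpace X] [ChartedSpace H X]
    {f : X → Torus S.n} {g : X → Torus S.l} {x : X} (hf : ContMDiffAt I (torusModel S.n) ∞ f x)
    (hg : ContMDiffAt I (torusModel S.l) ∞ g x) :
    ContMDiffAt I (torusModel k) ∞ (fun y => S.unsplit (f y) (g y)) x :=
  contMDiffAt_torusProdHom (χ := (S.A.splitting.symm : Torus S.n × Torus S.l →* Torus k))
    S.A.splitting.symm.continuous hf hg

theorem continuous_unsplit : Continuous fun p : Torus S.n × Torus S.l => S.unsplit p.1 p.2 :=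
  S.A.splitting.symm.continuous

theorem mem_stabilizer_iff {x : M} (hx : x ∈ S.source) (t : Torus k) :
    t ∈ MulAction.stabilizer (Torus k) x ↔
      (S.A.splitting t).2 = 1 ∧ ∀ i, (S.coord x).1 i ≠ 0 → (S.A.splitting t).1 i = 1 := by
  rw [MulAction.mem_stabilizer_iff]
  constructor
  · intro h
    have h1 := S.coord_smul t hx
    have h2 := S.ang_smul t hx
    rw [h] at h1 h2
    refine ⟨by simpa using h2.symm, fun i hi => ?_⟩
    have h3 := congrFun (congrArg Prod.fst h1) i
    simp only [rot] at h3
    have h4 : ((S.A.splitting t).1 i : ℂ) = 1 := (mul_eq_right₀ hi).mp h3.symm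
    exact Circle.coe_eq_one.mp h4
  · rintro ⟨h1, h2⟩
    refine S.ext_coord (S.smul_mem t hx) hx ?_ ?_
    · rw [S.coord_smul t hx]
      refine Prod.ext ?_ rfl
      ext i
      by_cases hi : (S.coord x).1 i = 0
      · simp [rot, hi]
      · simp [rot, h2 i hi]
    · rw [S.ang_smul t hx, h1, one_mul]

end StdChart

/-! ### Free orbits and their density. -/

section Free

variable {k d : ℕ} {M : Type*} [MulAction (Torus k) M]

/-- The set of free orbits. -/
def freeOrbits (k : ℕ) (M : Type*) [MulAction (Torus k) M] : Set (OrbitSpace k M) :=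
  {p | charFun k M p = ⊥}

/-- The set of points with trivial isotropy group. -/
def freePoints (k : ℕ) (M : Type*) [MulAction (Torus k) M] : Set M :=
  {x | orbitMap k x ∈ freeOrbits k M}

theorem charFun_orbitMap (x : M) : charFun k M (orbitMap k x) = MulAction.stabilizer (Torus k) x :=
  rfl

theorem orbitMap_smul (t : Torus k) (x : M) : orbitMap k (t • x) = orbitMap k x :=
  Quotient.sound ⟨t, rfl⟩

theorem exists_smul_eq_of_orbitMap_eq {x y : M} (h : orbitMap k x = orbitMap k y) :
    ∃ t : Torus k, t • y = x := Quotient.exact h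

theorem orbitMap_surjective (p : OrbitSpace k M) : ∃ x, orbitMap k x = p :=
  ⟨_, orbitMap_out p⟩

theorem eq_of_smul_eq_smul {x : M} (hx : x ∈ freePoints k M) {s t : Torus k} (h : s • x = t • x) :
    s = t := by
  have h1 : t⁻¹ * s ∈ MulAction.stabilizer (Torus k) x := by
    rw [MulAction.mem_stabilizer_iff, mul_smul, h, inv_smul_smul]
  have h2 : MulAction.stabilizer (Torus k) x = ⊥ := hx
  rw [h2, Subgroup.mem_bot] at h1
  exact (inv_mul_eq_one.mp h1).symm

variable [TopologicalSpace M] [ChartedSpace (EuclideanSpace ℝ (Fin d)) M]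

theorem StdChart.mem_freePoints_iff (S : StdChart k d M) {x : M} (hx : x ∈ S.source) :
    x ∈ freePoints k M ↔ ∀ i, (S.coord x).1 i ≠ 0 := by
  change MulAction.stabilizer (Torus k) x = ⊥ ↔ _
  rw [Subgroup.eq_bot_iff_forall]
  constructor
  · intro h i hi
    -- The half-turn in a vanishing coordinate fixes the point without being trivial.
    have h1 := h (S.unsplit (Pi.mulSingle i (Circle.exp Real.pi)) 1) <| by
      rw [S.mem_stabilizer_iff hx]
      refine ⟨by simp, fun j hj => ?_⟩
      have : j ≠ i := fun h => hj (h ▸ hi)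
      simp [this]
    have h2 := congrArg (fun t => (S.A.splitting t).1 i) h1
    simp only [S.splitting_unsplit, Pi.mulSingle_eq_same, map_one, Prod.fst_one, Pi.one_apply] at h2
    exact circle_neg_one_ne_one h2
  · intro h t ht
    rw [S.mem_stabilizer_iff hx] at ht
    rw [← S.unsplit_splitting t, ht.1, funext fun i => ht.2 i (h i)]
    exact map_one S.A.splitting.symm

variable [ContMDiffSMul (torusModel k) (𝓡 d) ∞ (Torus k) M]

theorem contMDiffAt_const_smul (t : Torus k) (x : M) :
    ContMDiffAt (𝓡 d) (𝓡 d) ∞ (fun x : M => t • x) x :=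
  ContMDiffAt.smul (contMDiffAt_const (I' := torusModel k) (c := t)) contMDiffAt_id

theorem dense_freePoints (hcov : ∀ x : M, ∃ S : StdChart k d M, x ∈ S.source) :
    Dense (freePoints k M) := by
  intro x
  obtain ⟨S, hx⟩ := hcov x
  rw [← S.unsplit_ang_smul_slice hx]
  have hc : Continuous fun v => S.unsplit 1 (S.ang x) • S.slice v :=
    continuous_iff_continuousAt.mpr fun v => ContinuousAt.comp
      (g := fun y : M => S.unsplit 1 (S.ang x) • y)
      (contMDiffAt_const_smul (d := d) _ _).continuousAt S.contMDiff_slice.continuous.continuousAt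
  refine map_mem_closure (f := fun v => S.unsplit 1 (S.ang x) • S.slice v) hc
    (dense_coord_ne_zero (S.coord x)) fun v hv => ?_
  change orbitMap k _ ∈ freeOrbits k M
  rw [orbitMap_smul]
  exact (S.mem_freePoints_iff (S.slice_mem v)).mpr (by simpa using hv)

end Free

theorem isOpenMap_orbitMap {k : ℕ} (d : ℕ) {M : Type*} [TopologicalSpace M]
    [ChartedSpace (EuclideanSpace ℝ (Fin d)) M] [MulAction (Torus k) M]
    [ContMDiffSMul (torusModel k) (𝓡 d) ∞ (Torus k) M] :
    IsOpenMap (orbitMap k : M → OrbitSpace k M) := by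
  have : ContinuousConstSMul (Torus k) M := ⟨fun t => continuous_iff_continuousAt.mpr fun x =>
    (contMDiffAt_const_smul (d := d) t x).continuousAt⟩
  exact isOpenMap_quotient_mk'_mul

/-! ### Coordinates on the orbit space, standard sections and multipliers. -/

namespace StdChart

variable {k d : ℕ} {M : Type*} [TopologicalSpace M]
  [ChartedSpace (EuclideanSpace ℝ (Fin d)) M] [MulAction (Torus k) M] (S : StdChart k d M)

/-- The image of the domain of the chart in the orbit space. -/
def dom : Set (OrbitSpace k M) := orbitMap k '' S.source

theorem isOpen_dom : IsOpen S.dom := S.chart.isOpen_image_source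

theorem orbitMap_mem_dom_iff {x : M} : orbitMap k x ∈ S.dom ↔ x ∈ S.source := by
  constructor
  · rintro ⟨y, hy, h⟩
    exact S.mem_source_of_orbitMap_eq h.symm hy
  · exact fun h => ⟨x, h, rfl⟩

/-- The squares of the absolute values of the complex coordinates, on the orbit space. -/
noncomputable def sq (q : OrbitSpace k M) (i : Fin S.n) : ℝ := ‖(S.coord (Quotient.out q)).1 i‖ ^ 2

/-- The real coordinates, on the orbit space. -/
noncomputable def base (q : OrbitSpace k M) : EuclideanSpace ℝ (Fin S.m) :=
  (S.coord (Quotient.out q)).2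

/-- The standard section `(x, y) ↦ (√x, 1, y)` of the orbit map over the domain of the chart. -/
noncomputable def std (q : OrbitSpace k M) : M :=
  S.slice (fun i => (Real.sqrt (S.sq q i) : ℂ), S.base q)

/-- The phases of the complex coordinates together with the toral coordinate. -/
noncomputable def phases (x : M) : Torus k :=
  S.unsplit (fun i => phase ((S.coord x).1 i)) (S.ang x)

theorem sq_orbitMap {x : M} (hx : x ∈ S.source) (i : Fin S.n) :
    S.sq (orbitMap k x) i = ‖(S.coord x).1 i‖ ^ 2 := by
  have h := (orbitMap_out (orbitMap k x))
  have h1 := ((S.orbitMap_eq_iff (S.mem_source_of_orbitMap_eq h hx) hx).mp h).1 i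
  rw [sq, h1]

theorem base_orbitMap {x : M} (hx : x ∈ S.source) : S.base (orbitMap k x) = (S.coord x).2 := by
  have h := (orbitMap_out (orbitMap k x))
  exact ((S.orbitMap_eq_iff (S.mem_source_of_orbitMap_eq h hx) hx).mp h).2

theorem sq_nonneg (q : OrbitSpace k M) (i : Fin S.n) : 0 ≤ S.sq q i := _root_.sq_nonneg _

theorem std_mem (q : OrbitSpace k M) : S.std q ∈ S.source := S.slice_mem _

theorem phases_smul_std {x : M} (hx : x ∈ S.source) :
    S.phases x • S.std (orbitMap k x) = x := by
  refine S.ext_coord (S.smul_mem _ (S.std_mem _)) hx ?_ ?_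
  · rw [S.coord_smul _ (S.std_mem _)]
    refine Prod.ext ?_ ?_
    · ext i
      simp only [phases, splitting_unsplit, std, coord_slice, rot, S.sq_orbitMap hx,
        Real.sqrt_sq (norm_nonneg _), phase_mul_norm]
    · simp only [rot, std, coord_slice, S.base_orbitMap hx]
  · rw [S.ang_smul _ (S.std_mem _)]
    simp [phases, std]

theorem orbitMap_std {q : OrbitSpace k M} (hq : q ∈ S.dom) : orbitMap k (S.std q) = q := by
  obtain ⟨x, hx, rfl⟩ := hq
  conv_rhs => rw [← S.phases_smul_std hx]
  rw [orbitMap_smul]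

theorem mem_charFun_iff {q : OrbitSpace k M} (hq : q ∈ S.dom) (t : Torus k) :
    t ∈ charFun k M q ↔
      (S.A.splitting t).2 = 1 ∧ ∀ i, S.sq q i ≠ 0 → (S.A.splitting t).1 i = 1 := by
  obtain ⟨x, hx, rfl⟩ := hq
  rw [charFun_orbitMap, S.mem_stabilizer_iff hx]
  refine and_congr_right fun _ => forall_congr' fun i => ?_
  rw [S.sq_orbitMap hx, ne_eq, ne_eq, sq_eq_zero_iff, norm_eq_zero]

theorem mem_freeOrbits_iff {q : OrbitSpace k M} (hq : q ∈ S.dom) :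
    q ∈ freeOrbits k M ↔ ∀ i, 0 < S.sq q i := by
  obtain ⟨x, hx, rfl⟩ := hq
  change x ∈ freePoints k M ↔ _
  rw [S.mem_freePoints_iff hx]
  refine forall_congr' fun i => ?_
  rw [S.sq_orbitMap hx, sq_pos_iff, norm_ne_zero_iff]

/-- A smooth equivariant map which preserves orbits is multiplication by a smooth function on the
orbit space with values in the torus. -/
theorem exists_smooth_multiplier {V : Set (OrbitSpace k M)} (hV : IsOpen V) (hVS : V ⊆ S.dom)
    {G : M → M} (hG : ∀ x, orbitMap k x ∈ V → ContMDiffAt (𝓡 d) (𝓡 d) ∞ G x)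
    (hGo : ∀ x, orbitMap k x ∈ V → orbitMap k (G x) = orbitMap k x)
    (hGe : ∀ (t : Torus k) (x), orbitMap k x ∈ V → G (t • x) = t • G x) :
    ∃ f : OrbitSpace k M → Torus k, ∀ x, orbitMap k x ∈ V →
      ContMDiffAt (𝓡 d) (torusModel k) ∞ (fun y => f (orbitMap k y)) x ∧
      G x = f (orbitMap k x) • x := by
  set Ω : Set S.E := {v | orbitMap k (S.slice v) ∈ V} with hΩ
  have hΩo : IsOpen Ω := hV.preimage (continuous_orbitMap.comp S.contMDiff_slice.continuous)
  have hΩrot : ∀ v ∈ Ω, ∀ u, rot u v ∈ Ω := fun v hv u => by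
    change orbitMap k _ ∈ V
    rw [S.orbitMap_slice_rot]; exact hv
  have hGs : ∀ v ∈ Ω, G (S.slice v) ∈ S.source := fun v hv =>
    S.mem_source_of_orbitMap_eq (hGo _ hv) (S.slice_mem v)
  have hGv : ∀ v ∈ Ω, ContMDiffAt 𝓘(ℝ, S.E) (𝓡 d) ∞ (fun v => G (S.slice v)) v := fun v hv =>
    ContMDiffAt.comp v (g := G) (hG _ hv) (S.contMDiff_slice v)
  have hFE : ContDiffOn ℝ ∞ (fun v => S.coord (G (S.slice v))) Ω := fun v hv =>
    (contMDiffAt_iff_contDiffAt.mp (ContMDiffAt.comp v (g := S.coord)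
      (S.contMDiffAt_coord (hGs v hv)) (hGv v hv))).contDiffWithinAt
  have hF : ∀ i, ContDiffOn ℝ ∞ (fun v => (S.coord (G (S.slice v))).1 i) Ω := fun i =>
    contDiffOn_pi.mp hFE.fst i
  have hGrot : ∀ v ∈ Ω, ∀ u, G (S.slice (rot u v)) = S.unsplit u 1 • G (S.slice v) :=
    fun v hv u => by rw [← S.unsplit_smul_slice, hGe _ _ hv]
  have hnorm : ∀ v ∈ Ω, (∀ i, ‖(S.coord (G (S.slice v))).1 i‖ = ‖v.1 i‖) ∧
      (S.coord (G (S.slice v))).2 = v.2 := fun v hv => by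
    have := (S.orbitMap_eq_iff (hGs v hv) (S.slice_mem v)).mp (hGo _ hv)
    simpa using this
  -- On the slice the `i`-th coordinate of `G` has weight one and the same modulus as `v_i`, so `G`
  -- multiplies `v_i` by a smooth factor `g_i`.
  have hdiv := fun i => exists_division hΩo hΩrot i 1 (hF i)
    (fun v hv u => by
      rw [hGrot v hv, S.coord_smul _ (hGs v hv)]; simp [rot])
    (fun v hv h => by
      rw [← norm_eq_zero, (hnorm v hv).1, h, norm_zero])
  choose g hg hFg hgrot using hdiv
  -- By continuity the factor stays unimodular where `v_i = 0`, so its phase is smooth there as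
  -- well.
  have hg1 : ∀ i, ∀ v ∈ Ω, ‖g i v‖ = 1 := by
    intro i
    refine eqOn_of_dense_inter (f := fun v => ‖g i v‖) (g := fun _ => 1) dense_coord_ne_zero hΩo
      (hg i).continuousOn.norm continuousOn_const fun v hv hvD => ?_
    have h1 := (hnorm v hv).1 i
    rw [hFg i v hv, norm_mul] at h1
    exact (mul_eq_left₀ (norm_ne_zero_iff.mpr (hvD i))).mp h1
  set f₀ : S.E → Torus k := fun v => S.unsplit (fun i => phase (g i v)) (S.ang (G (S.slice v)))
    with hf₀
  -- Rotation invariance lets the multiplier descend from the slice to the orbit space.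
  have hf₀rot : ∀ v ∈ Ω, ∀ u, f₀ (rot u v) = f₀ v := by
    intro v hv u
    have h1 : ∀ i, g i (rot u v) = g i v := fun i => by
      have := hgrot i v hv u
      rw [pow_one] at this
      exact mul_left_cancel₀ (Circle.coe_ne_zero _) this
    simp only [hf₀, h1]
    rw [hGrot v hv, S.ang_smul _ (hGs v hv)]
    simp
  have hcoord : ∀ x, orbitMap k x ∈ V → S.coord x ∈ Ω := fun x hx => by
    change orbitMap k _ ∈ V
    rwa [S.orbitMap_slice_coord (S.orbitMap_mem_dom_iff.mp (hVS hx))]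
  have hf : ∀ x, orbitMap k x ∈ V →
      f₀ (S.coord (Quotient.out (orbitMap k x))) = f₀ (S.coord x) := by
    intro x hx
    obtain ⟨t, ht⟩ := exists_smul_eq_of_orbitMap_eq (orbitMap_out (orbitMap k x))
    rw [← ht, S.coord_smul _ (S.orbitMap_mem_dom_iff.mp (hVS hx)), hf₀rot _ (hcoord x hx)]
  refine ⟨fun q => f₀ (S.coord (Quotient.out q)), fun x hx => ⟨?_, ?_⟩⟩
  · have hxS := S.orbitMap_mem_dom_iff.mp (hVS hx)
    have hv := hcoord x hx
    have h1 : ContMDiffAt 𝓘(ℝ, S.E) (torusModel k) ∞ f₀ (S.coord x) := by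
      refine S.contMDiffAt_unsplit (contMDiffAt_torus_iff.mpr fun i => ?_) ?_
      · refine ContMDiffAt.comp (I' := 𝓘(ℝ, ℂ)) (S.coord x) (g := phase) (contMDiffAt_phase ?_)
          ((hg i).contDiffAt (hΩo.mem_nhds hv)).contMDiffAt
        rw [← norm_ne_zero_iff, hg1 i _ hv]; exact one_ne_zero
      · exact ContMDiffAt.comp (S.coord x) (g := S.ang) (S.contMDiffAt_ang (hGs _ hv)) (hGv _ hv)
    refine (ContMDiffAt.comp x h1 (S.contMDiffAt_coord hxS)).congr_of_eventuallyEq ?_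
    filter_upwards [(hV.preimage continuous_orbitMap).mem_nhds hx] with y hy
    exact hf y hy
  · have hxS := S.orbitMap_mem_dom_iff.mp (hVS hx)
    have hv := hcoord x hx
    simp only [hf x hx]
    set v := S.coord x with hvx
    have h1 : G (S.slice v) = f₀ v • S.slice v := by
      refine S.ext_coord (hGs v hv) (S.smul_mem _ (S.slice_mem v)) ?_ ?_
      · rw [S.coord_smul _ (S.slice_mem v)]
        refine Prod.ext ?_ ?_
        · ext i
          have h2 := phase_mul_norm (g i v)
          rw [hg1 i v hv, Complex.ofReal_one, mul_one] at h2
          simp only [hf₀, splitting_unsplit, rot, coord_slice, h2]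
          rw [hFg i v hv, mul_comm]
        · simp [rot, (hnorm v hv).2]
      · rw [S.ang_smul _ (S.slice_mem v)]
        simp [hf₀]
    conv_lhs => rw [← S.unsplit_ang_smul_slice hxS]
    rw [hGe _ _ hv, h1, ← mul_smul, mul_comm, mul_smul, S.unsplit_ang_smul_slice hxS]

end StdChart

/-! ### Smoothness of maps of orbit spaces, pulled back to the manifold. -/

section SmoothInChart

variable {k d₁ d₂ : ℕ} {M₁ M₂ : Type*}
  [TopologicalSpace M₁] [ChartedSpace (EuclideanSpace ℝ (Fin d₁)) M₁] [MulAction (Torus k) M₁]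
  [TopologicalSpace M₂] [ChartedSpace (EuclideanSpace ℝ (Fin d₂)) M₂] [MulAction (Torus k) M₂]

/-- The map `f` of orbit spaces sends `V` to the domain of the chart `S`, and its coordinates there
are smooth functions on the preimage of `V` in `M₁`. -/
structure SmoothInChart (d₁ : ℕ) {M₁ : Type*} [TopologicalSpace M₁]
    [ChartedSpace (EuclideanSpace ℝ (Fin d₁)) M₁] [MulAction (Torus k) M₁]
    (S : StdChart k d₂ M₂) (f : OrbitSpace k M₁ → OrbitSpace k M₂) (V : Set (OrbitSpace k M₁)) :
    Prop where
  isOpen : IsOpen V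
  mapsTo : ∀ q ∈ V, f q ∈ S.dom
  sq : ∀ x : M₁, orbitMap k x ∈ V → ∀ j,
    ContMDiffAt (𝓡 d₁) 𝓘(ℝ, ℝ) ∞ (fun x => S.sq (f (orbitMap k x)) j) x
  base : ∀ x : M₁, orbitMap k x ∈ V →
    ContMDiffAt (𝓡 d₁) 𝓘(ℝ, EuclideanSpace ℝ (Fin S.m)) ∞ (fun x => S.base (f (orbitMap k x))) x

theorem StdChart.contMDiffAt_normSq (S : StdChart k d₁ M₁) {x : M₁} (hx : x ∈ S.source)
    (j : Fin S.n) : ContMDiffAt (𝓡 d₁) 𝓘(ℝ, ℝ) ∞ (fun x => ‖(S.coord x).1 j‖ ^ 2) x := by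
  have h1 : ContDiff ℝ ∞ fun v : S.E => ‖v.1 j‖ ^ 2 :=
    (contDiff_norm_sq ℝ).comp (contDiff_pi.mp contDiff_fst j)
  exact ContMDiffAt.comp x (g := fun v : S.E => ‖v.1 j‖ ^ 2) h1.contMDiff.contMDiffAt
    (S.contMDiffAt_coord hx)

theorem StdChart.contMDiffAt_coord_snd (S : StdChart k d₁ M₁) {x : M₁} (hx : x ∈ S.source) :
    ContMDiffAt (𝓡 d₁) 𝓘(ℝ, EuclideanSpace ℝ (Fin S.m)) ∞ (fun x => (S.coord x).2) x :=
  ContMDiffAt.comp x (g := fun v : S.E => v.2) contDiff_snd.contMDiff.contMDiffAt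
    (S.contMDiffAt_coord hx)

theorem smoothInChart_id (S : StdChart k d₁ M₁) : SmoothInChart d₁ S id S.dom where
  isOpen := S.isOpen_dom
  mapsTo _ hq := hq
  sq x hx j := by
    refine (S.contMDiffAt_normSq (S.orbitMap_mem_dom_iff.mp hx) j).congr_of_eventuallyEq ?_
    filter_upwards [S.isOpen_source.mem_nhds (S.orbitMap_mem_dom_iff.mp hx)] with y hy
    exact S.sq_orbitMap hy j
  base x hx := by
    refine (S.contMDiffAt_coord_snd (S.orbitMap_mem_dom_iff.mp hx)).congr_of_eventuallyEq ?_
    filter_upwards [S.isOpen_source.mem_nhds (S.orbitMap_mem_dom_iff.mp hx)] with y hy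
    exact S.base_orbitMap hy

theorem SmoothInChart.mono {S : StdChart k d₂ M₂} {f : OrbitSpace k M₁ → OrbitSpace k M₂}
    {V W : Set (OrbitSpace k M₁)} (h : SmoothInChart d₁ S f V) (hW : IsOpen W) (hWV : W ⊆ V) :
    SmoothInChart d₁ S f W where
  isOpen := hW
  mapsTo q hq := h.mapsTo q (hWV hq)
  sq x hx := h.sq x (hWV hx)
  base x hx := h.base x (hWV hx)

theorem StdChart.contMDiffAt_momentMap (S : StdChart k d₁ M₁) {x : M₁} (hx : x ∈ S.source) :
    ContMDiffAt (𝓡 d₁) (cornerModel S.n S.m) ∞ (fun y => momentMap (S.chart.toFun y)) x := by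
  rw [contMDiffAt_iff_target]
  refine ⟨continuous_momentMap.continuousAt.comp (S.contMDiffAt_chart hx).continuousAt, ?_⟩
  have h1 : ContMDiffAt (𝓡 d₁) 𝓘(ℝ, EuclideanSpace ℝ (Fin S.n)) ∞
      (fun y => WithLp.toLp 2 fun i => ‖(S.coord y).1 i‖ ^ 2) x := by
    have h2 : ContMDiffAt (𝓡 d₁) 𝓘(ℝ, Fin S.n → ℝ) ∞ (fun y i => ‖(S.coord y).1 i‖ ^ 2) x :=
      contMDiffAt_pi_space.mpr fun i => S.contMDiffAt_normSq hx i
    exact ContMDiffAt.comp x (g := fun v : Fin S.n → ℝ => WithLp.toLp 2 v)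
      (PiLp.contDiff_toLp (𝕜 := ℝ) (p := 2)).contMDiff.contMDiffAt h2
  exact h1.prodMk_space (S.contMDiffAt_coord_snd hx)

/-- The moment map of a chart is smooth from the manifold to the corner. Composing with it turns
smoothness on manifolds with corners into smoothness of functions on the manifold without boundary.
-/
theorem IsOrbitSmooth.exists_smoothInChart {f : OrbitSpace k M₁ → OrbitSpace k M₂}
    (hf : IsOrbitSmooth d₁ d₂ f) (p : OrbitSpace k M₁) :
    ∃ (S₁ : StdChart k d₁ M₁) (S₂ : StdChart k d₂ M₂) (V : Set (OrbitSpace k M₁)),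
      p ∈ V ∧ V ⊆ S₁.dom ∧ SmoothInChart d₁ S₂ f V := by
  obtain ⟨hc, h⟩ := hf
  obtain ⟨n₁, m₁, n₂, m₂, φ₁, φ₂, ⟨l₁, A₁, hA₁, c₁, rfl⟩, ⟨l₂, A₂, hA₂, c₂, rfl⟩, hp, hfp, hs⟩ := h p
  let S₁ : StdChart k d₁ M₁ := ⟨n₁, l₁, m₁, A₁, hA₁, c₁⟩
  let S₂ : StdChart k d₂ M₂ := ⟨n₂, l₂, m₂, A₂, hA₂, c₂⟩
  set φ₁ := c₁.orbitChart hA₁ with hφ₁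
  set φ₂ := c₂.orbitChart hA₂ with hφ₂
  have hV : IsOpen (φ₁.source ∩ f ⁻¹' φ₂.source) := φ₁.open_source.inter (φ₂.open_source.preimage hc)
  refine ⟨S₁, S₂, φ₁.source ∩ f ⁻¹' φ₂.source, ⟨hp, hfp⟩, Set.inter_subset_left, ?_⟩
  have key : ∀ x : M₁, orbitMap k x ∈ φ₁.source ∩ f ⁻¹' φ₂.source →
      ContMDiffAt (𝓡 d₁) 𝓘(ℝ, EuclideanSpace ℝ (Fin n₂) × EuclideanSpace ℝ (Fin m₂)) ∞
        (fun y => cornerModel n₂ m₂ (φ₂ (f (orbitMap k y)))) x := by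
    intro x hx
    have hxS : x ∈ S₁.source := S₁.orbitMap_mem_dom_iff.mp hx.1
    have h1 := S₁.contMDiffAt_momentMap hxS
    have e1 : momentMap (c₁.toFun x) = φ₁ (orbitMap k x) := (c₁.orbitChart_orbitMap hA₁ hxS).symm
    have hT : IsOpen (φ₁.target ∩ φ₁.symm ⁻¹' (f ⁻¹' φ₂.source)) :=
      φ₁.isOpen_inter_preimage_symm (φ₂.open_source.preimage hc)
    have hxT : momentMap (c₁.toFun x) ∈ φ₁.target ∩ φ₁.symm ⁻¹' (f ⁻¹' φ₂.source) := by
      rw [e1]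
      refine ⟨φ₁.map_source hx.1, ?_⟩
      simp only [Set.mem_preimage, φ₁.left_inv hx.1]
      exact hx.2
    have h2 : ContMDiffAt (cornerModel n₁ m₁) (cornerModel n₂ m₂) ∞ (φ₂ ∘ f ∘ φ₁.symm)
      (momentMap (c₁.toFun x)) := hs.contMDiffAt (hT.mem_nhds hxT)
    have h3 : ContMDiffAt (𝓡 d₁) (cornerModel n₂ m₂) ∞
        (fun y => (φ₂ ∘ f ∘ φ₁.symm) (momentMap (c₁.toFun y))) x :=
      ContMDiffAt.comp x (g := φ₂ ∘ f ∘ φ₁.symm) h2 h1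
    have h4 := ContMDiffAt.comp x (g := cornerModel n₂ m₂)
      ((cornerModel n₂ m₂).contMDiff.contMDiffAt) h3
    refine h4.congr_of_eventuallyEq ?_
    filter_upwards [S₁.isOpen_source.mem_nhds hxS] with y hy
    have e2 : momentMap (c₁.toFun y) = φ₁ (orbitMap k y) := (c₁.orbitChart_orbitMap hA₁ hy).symm
    have e3 : orbitMap k y ∈ φ₁.source := S₁.orbitMap_mem_dom_iff.mpr hy
    simp only [Function.comp_apply, e2, φ₁.left_inv e3]
  refine ⟨hV, fun q hq => hq.2, fun x hx j => ?_, fun x hx => ?_⟩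
  · have h1 : ContDiff ℝ ∞ fun v : EuclideanSpace ℝ (Fin n₂) × EuclideanSpace ℝ (Fin m₂) => v.1 j :=
      (EuclideanSpace.proj (𝕜 := ℝ) j).contDiff.comp contDiff_fst
    exact ContMDiffAt.comp x
      (g := fun v : EuclideanSpace ℝ (Fin n₂) × EuclideanSpace ℝ (Fin m₂) => v.1 j)
      h1.contMDiff.contMDiffAt (key x hx)
  · exact ContMDiffAt.comp x
      (g := fun v : EuclideanSpace ℝ (Fin n₂) × EuclideanSpace ℝ (Fin m₂) => v.2)
      contDiff_snd.contMDiff.contMDiffAt (key x hx)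

end SmoothInChart

theorem circle_eq_exp_pi {a : Circle} (h : a * a = 1) (h1 : a ≠ 1) : a = Circle.exp Real.pi := by
  have h2 : (a : ℂ) * a = 1 := by exact_mod_cast congrArg (fun z : Circle => (z : ℂ)) h
  rcases mul_self_eq_one_iff.mp h2 with h3 | h3
  · exact absurd (Circle.coe_eq_one.mp h3) h1
  · refine Circle.ext ?_
    rw [h3, Circle.coe_exp, Complex.exp_pi_mul_I]

theorem circle_exp_pi_mul_self : Circle.exp Real.pi * Circle.exp Real.pi = 1 := by
  rw [← Circle.exp_add, ← two_mul, Circle.exp_two_pi]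

/-! ### Circle subgroups attached to the facets. -/

namespace StdChart

variable {k d : ℕ} {M : Type*} [TopologicalSpace M]
  [ChartedSpace (EuclideanSpace ℝ (Fin d)) M] [MulAction (Torus k) M] (S : StdChart k d M)

/-- The circle in `T^k` which rotates the `i`-th complex coordinate. -/
noncomputable def circ (i : Fin S.n) : Circle →* Torus k where
  toFun u := S.unsplit (Pi.mulSingle i u) 1
  map_one' := by rw [Pi.mulSingle_one]; exact map_one S.A.splitting.symm
  map_mul' u v := by rw [Pi.mulSingle_mul, ← S.unsplit_mul, one_mul]

theorem continuous_circ (i : Fin S.n) : Continuous (S.circ i) :=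
  S.continuous_unsplit.comp ((continuous_mulSingle (A := fun _ : Fin S.n => Circle) i).prodMk
    continuous_const)

theorem splitting_circ (i : Fin S.n) (u : Circle) :
    S.A.splitting (S.circ i u) = (Pi.mulSingle i u, 1) := S.splitting_unsplit _ _

theorem circ_injective (i : Fin S.n) : Function.Injective (S.circ i) := by
  intro u v h
  have h1 := congrArg (fun t => (S.A.splitting t).1 i) h
  simpa [splitting_circ] using h1

/-- The subgroup of `T^k` which rotates the `i`-th complex coordinate. -/
noncomputable def facet (i : Fin S.n) : Subgroup (Torus k) := (S.circ i).range

theorem facet_injective : Function.Injective S.facet := by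
  intro i j h
  have h1 : S.circ i (Circle.exp Real.pi) ∈ S.facet j := h ▸ ⟨_, rfl⟩
  obtain ⟨u, hu⟩ := h1
  by_contra hij
  have h2 := congrArg (fun t => (S.A.splitting t).1 i) hu
  simp only [splitting_circ, Pi.mulSingle_eq_same, Pi.mulSingle_eq_of_ne hij] at h2
  exact circle_neg_one_ne_one h2.symm

/-- This expresses the vanishing of a coordinate through the characteristic function alone, so that
it can be transported between charts and between the two manifolds. -/
theorem facet_le_charFun_iff {q : OrbitSpace k M} (hq : q ∈ S.dom) (i : Fin S.n) :
    S.facet i ≤ charFun k M q ↔ S.sq q i = 0 := by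
  constructor
  · intro h
    by_contra hi
    have h1 := ((S.mem_charFun_iff hq _).mp (h ⟨Circle.exp Real.pi, rfl⟩)).2 i hi
    rw [splitting_circ] at h1
    exact circle_neg_one_ne_one (by simpa using h1)
  · rintro h _ ⟨u, rfl⟩
    rw [S.mem_charFun_iff hq, splitting_circ]
    refine ⟨rfl, fun j hj => ?_⟩
    have : j ≠ i := fun hji => hj (hji ▸ h)
    simp [this]

theorem charFun_eq_facet {q : OrbitSpace k M} (hq : q ∈ S.dom) {i : Fin S.n} (hi : S.sq q i = 0)
    (h : ∀ j, S.sq q j = 0 → j = i) : charFun k M q = S.facet i := by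
  refine le_antisymm (fun t ht => ?_) ((S.facet_le_charFun_iff hq i).mpr hi)
  rw [S.mem_charFun_iff hq] at ht
  refine ⟨(S.A.splitting t).1 i, S.A.splitting.injective ?_⟩
  rw [splitting_circ]
  refine Prod.ext (funext fun j => ?_) ht.1.symm
  by_cases hj : j = i
  · subst hj; simp
  · dsimp only
    rw [Pi.mulSingle_eq_of_ne hj, ht.2 j fun h' => hj (h j h')]

theorem charFun_eq_bot {q : OrbitSpace k M} (hq : q ∈ S.dom) (h : ∀ j, S.sq q j ≠ 0) :
    charFun k M q = ⊥ :=
  (S.mem_freeOrbits_iff hq).mpr fun j => lt_of_le_of_ne (S.sq_nonneg q j) (h j).symm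

theorem exists_mem_charFun_eq_facet {V : Set (OrbitSpace k M)} (hV : IsOpen V) (hVS : V ⊆ S.dom)
    {p : OrbitSpace k M} (hp : p ∈ V) {i : Fin S.n} (hi : S.sq p i = 0) :
    ∃ q ∈ V, charFun k M q = S.facet i := by
  classical
  obtain ⟨x, rfl⟩ := orbitMap_surjective p
  have hxS := S.orbitMap_mem_dom_iff.mp (hVS hp)
  let h : S.E → S.E := fun w => (Function.update w.1 i 0, w.2)
  have hc : Continuous h := (continuous_fst.update i continuous_const).prodMk continuous_snd
  rw [S.sq_orbitMap hxS, sq_eq_zero_iff, norm_eq_zero] at hi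
  have hx : h (S.coord x) = S.coord x := by
    refine Prod.ext ?_ rfl
    simp only [h]
    rw [← hi, Function.update_eq_self]
  have hΩ : IsOpen {w | orbitMap k (S.slice (h w)) ∈ V} :=
    hV.preimage (continuous_orbitMap.comp (S.contMDiff_slice.continuous.comp hc))
  -- Pick a nearby point with no vanishing coordinate; `h` then kills the `i`-th coordinate and no
  -- other.
  obtain ⟨w, hw, hwD⟩ := dense_coord_ne_zero.exists_mem_open hΩ ⟨S.coord x, by
    change orbitMap k _ ∈ V
    rw [hx, S.orbitMap_slice_coord hxS]; exact hp⟩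
  refine ⟨_, hwD, S.charFun_eq_facet (hVS hwD) ?_ fun j hj => ?_⟩
  · rw [S.sq_orbitMap (S.slice_mem _), coord_slice]; simp [h]
  · rw [S.sq_orbitMap (S.slice_mem _), coord_slice] at hj
    by_contra hji
    simp only [h, Function.update_of_ne hji, sq_eq_zero_iff, norm_eq_zero] at hj
    exact hw j hj

end StdChart

/-! ### Matching facets and comparing squared moduli. -/

section Match

variable {k d₁ d₂ : ℕ} {M₁ M₂ : Type*}
  [TopologicalSpace M₁] [ChartedSpace (EuclideanSpace ℝ (Fin d₁)) M₁] [MulAction (Torus k) M₁]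
  [TopologicalSpace M₂] [ChartedSpace (EuclideanSpace ℝ (Fin d₂)) M₂] [MulAction (Torus k) M₂]
  {S₁ : StdChart k d₁ M₁} {S₂ : StdChart k d₂ M₂} {f : OrbitSpace k M₁ → OrbitSpace k M₂}
  {V : Set (OrbitSpace k M₁)}

/-- At a nearby orbit where only the `i`-th coordinate vanishes the isotropy group is a circle. At
the image orbit it is the product of the circles of the vanishing coordinates. A circle has exactly
one element of order two, so there is exactly one such coordinate. -/
theorem exists_facet_eq (hV : IsOpen V) (hVS : V ⊆ S₁.dom) (hf : ∀ q ∈ V, f q ∈ S₂.dom)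
    (hchar : ∀ q, charFun k M₁ q = charFun k M₂ (f q)) {p : OrbitSpace k M₁} (hp : p ∈ V)
    {i : Fin S₁.n} (hi : S₁.sq p i = 0) : ∃ j, S₂.facet j = S₁.facet i := by
  obtain ⟨q, hq, hqi⟩ := S₁.exists_mem_charFun_eq_facet hV hVS hp hi
  rw [hchar] at hqi
  have hneg : ∀ j, S₂.sq (f q) j = 0 →
      S₂.circ j (Circle.exp Real.pi) = S₁.circ i (Circle.exp Real.pi) := by
    intro j hj
    have h1 : S₂.circ j (Circle.exp Real.pi) ∈ S₁.facet i := by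
      rw [← hqi]
      exact (S₂.facet_le_charFun_iff (hf q hq) j).mpr hj ⟨_, rfl⟩
    obtain ⟨a, ha⟩ := h1
    have h2 : a * a = 1 := S₁.circ_injective i <| by
      rw [map_mul, map_one, ha, ← map_mul, circle_exp_pi_mul_self, map_one]
    have h3 : a ≠ 1 := by
      rintro rfl
      rw [map_one, ← map_one (S₂.circ j)] at ha
      exact circle_neg_one_ne_one (S₂.circ_injective j ha).symm
    rw [← ha, circle_eq_exp_pi h2 h3]
  have hex : ∃ j, S₂.sq (f q) j = 0 := by
    by_contra hne
    push Not at hne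
    have h1 : S₁.circ i (Circle.exp Real.pi) ∈ charFun k M₂ (f q) := hqi ▸ ⟨_, rfl⟩
    rw [S₂.charFun_eq_bot (hf q hq) hne, Subgroup.mem_bot, ← map_one (S₁.circ i)] at h1
    exact circle_neg_one_ne_one (S₁.circ_injective i h1)
  obtain ⟨j, hj⟩ := hex
  refine ⟨j, ?_⟩
  rw [← hqi, S₂.charFun_eq_facet (hf q hq) hj fun j' hj' => ?_]
  have h1 := (hneg j' hj').trans (hneg j hj).symm
  by_contra hne
  have h2 := congrArg (fun t => (S₂.A.splitting t).1 j') h1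
  simp only [S₂.splitting_circ, Pi.mulSingle_eq_same, Pi.mulSingle_eq_of_ne hne] at h2
  exact circle_neg_one_ne_one h2

theorem sq_eq_zero_iff_of_facet_eq {i : Fin S₁.n} {j : Fin S₂.n} (hij : S₂.facet j = S₁.facet i)
    {q : OrbitSpace k M₁} (hq : q ∈ S₁.dom) (hfq : f q ∈ S₂.dom)
    (hchar : charFun k M₁ q = charFun k M₂ (f q)) : S₂.sq (f q) j = 0 ↔ S₁.sq q i = 0 := by
  rw [← S₂.facet_le_charFun_iff hfq, ← S₁.facet_le_charFun_iff hq, hij, hchar]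

/-- The function `S₂.sq ∘ f` has weight zero and vanishes on `z_i = 0`. It is divided by `z_i`, and
the conjugate of the quotient, which has weight one, is divided by `z_i` again; this produces the
factor `|z_i|^2`. -/
theorem exists_sq_eq_mul (hVS : V ⊆ S₁.dom) (hf : SmoothInChart d₁ S₂ f V)
    (hchar : ∀ q, charFun k M₁ q = charFun k M₂ (f q)) {i : Fin S₁.n} {j : Fin S₂.n}
    (hij : S₂.facet j = S₁.facet i) :
    ∃ g : S₁.E → ℝ, ContDiffOn ℝ ∞ g {v | orbitMap k (S₁.slice v) ∈ V} ∧
      ∀ x, orbitMap k x ∈ V →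
        S₂.sq (f (orbitMap k x)) j = ‖(S₁.coord x).1 i‖ ^ 2 * g (S₁.coord x) := by
  set Ω : Set S₁.E := {v | orbitMap k (S₁.slice v) ∈ V} with hΩ
  have hΩo : IsOpen Ω :=
    hf.isOpen.preimage (continuous_orbitMap.comp S₁.contMDiff_slice.continuous)
  have hΩrot : ∀ v ∈ Ω, ∀ u, rot u v ∈ Ω := fun v hv u => by
    change orbitMap k _ ∈ V
    rw [S₁.orbitMap_slice_rot]; exact hv
  have hX : ContDiffOn ℝ ∞ (fun v => ((S₂.sq (f (orbitMap k (S₁.slice v))) j : ℝ) : ℂ)) Ω := by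
    intro v hv
    have h1 : ContMDiffAt 𝓘(ℝ, S₁.E) 𝓘(ℝ, ℝ) ∞
        (fun v => S₂.sq (f (orbitMap k (S₁.slice v))) j) v :=
      ContMDiffAt.comp v (g := fun x => S₂.sq (f (orbitMap k x)) j) (hf.sq _ hv j)
        (S₁.contMDiff_slice v)
    exact (Complex.ofRealCLM.contDiff.contDiffAt.comp v
      (contMDiffAt_iff_contDiffAt.mp h1)).contDiffWithinAt
  have hX0 : ∀ v ∈ Ω, v.1 i = 0 → ((S₂.sq (f (orbitMap k (S₁.slice v))) j : ℝ) : ℂ) = 0 := by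
    intro v hv hvi
    rw [Complex.ofReal_eq_zero, sq_eq_zero_iff_of_facet_eq hij (hVS hv) (hf.mapsTo _ hv) (hchar _),
      S₁.sq_orbitMap (S₁.slice_mem v), S₁.coord_slice, hvi]
    simp
  obtain ⟨F, hF, hXF, hFrot⟩ := exists_division hΩo hΩrot i 0 hX
    (fun v hv u => by rw [S₁.orbitMap_slice_rot, pow_zero, one_mul]) hX0
  have hFrot' : ∀ v ∈ Ω, ∀ u : Torus S₁.n, (u i : ℂ) * F (rot u v) = F v := fun v hv u => by
    simpa using hFrot v hv u
  obtain ⟨G, hG, hFG, -⟩ := exists_division hΩo hΩrot i 1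
    (F := fun v => (starRingEnd ℂ) (F v)) (Complex.conjCLE.contDiff.comp_contDiffOn hF)
    (fun v hv u => by
      rw [← hFrot' v hv u, map_mul, ← Circle.coe_inv_eq_conj, pow_one, ← mul_assoc,
        ← Circle.coe_mul, mul_inv_cancel, Circle.coe_one, one_mul])
    (fun v hv hvi => by
      -- The first quotient changes sign under the half-turn, which fixes `v` when `v_i = 0`; so it
      -- vanishes there.
      have h1 := hFrot' v hv (Pi.mulSingle i (Circle.exp Real.pi))
      have h2 : rot (Pi.mulSingle i (Circle.exp Real.pi)) v = v := by
        refine Prod.ext ?_ rfl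
        ext l
        by_cases hl : l = i
        · subst hl; simp [rot, hvi]
        · simp [rot, hl]
      rw [h2, Pi.mulSingle_eq_same, Circle.coe_exp, Complex.exp_pi_mul_I] at h1
      have h3 : F v = 0 := by linear_combination (-1 / 2 : ℂ) * h1
      simp [h3])
  refine ⟨fun v => (G v).re, Complex.reCLM.contDiff.comp_contDiffOn hG, fun x hx => ?_⟩
  have hxS := S₁.orbitMap_mem_dom_iff.mp (hVS hx)
  set v := S₁.coord x with hv
  have hvΩ : v ∈ Ω := by
    change orbitMap k _ ∈ V
    rwa [S₁.orbitMap_slice_coord hxS]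
  have h1 := hXF v hvΩ
  have h2 := congrArg (starRingEnd ℂ) (hFG v hvΩ)
  rw [Complex.conj_conj, map_mul] at h2
  rw [h2, ← mul_assoc, Complex.mul_conj, S₁.orbitMap_slice_coord hxS] at h1
  have h3 := congrArg Complex.re h1
  rw [Complex.ofReal_re, Complex.re_ofReal_mul, Complex.conj_re, Complex.normSq_eq_norm_sq] at h3
  exact h3

theorem exists_sq_le (hd₁ : IsOpenMap (orbitMap k : M₁ → OrbitSpace k M₁)) (hVS : V ⊆ S₁.dom)
    (hf : SmoothInChart d₁ S₂ f V) (hchar : ∀ q, charFun k M₁ q = charFun k M₂ (f q))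
    {i : Fin S₁.n} {j : Fin S₂.n} (hij : S₂.facet j = S₁.facet i) {p : OrbitSpace k M₁}
    (hp : p ∈ V) : ∃ C, 0 < C ∧ ∀ᶠ q in 𝓝 p, S₂.sq (f q) j ≤ C * S₁.sq q i := by
  obtain ⟨g, hg, hsq⟩ := exists_sq_eq_mul hVS hf hchar hij
  obtain ⟨x, rfl⟩ := orbitMap_surjective p
  have hxS := S₁.orbitMap_mem_dom_iff.mp (hVS hp)
  have hΩo : IsOpen {v | orbitMap k (S₁.slice v) ∈ V} :=
    hf.isOpen.preimage (continuous_orbitMap.comp S₁.contMDiff_slice.continuous)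
  have hvΩ : S₁.coord x ∈ {v | orbitMap k (S₁.slice v) ∈ V} := by
    change orbitMap k _ ∈ V
    rwa [S₁.orbitMap_slice_coord hxS]
  have hgc : ContinuousAt (fun y => g (S₁.coord y)) x :=
    ContinuousAt.comp (g := g) (hg.contDiffAt (hΩo.mem_nhds hvΩ)).continuousAt
      (S₁.contMDiffAt_coord hxS).continuousAt
  refine ⟨|g (S₁.coord x)| + 1, by positivity, ?_⟩
  have hev : ∀ᶠ y in 𝓝 x, g (S₁.coord y) < |g (S₁.coord x)| + 1 ∧ orbitMap k y ∈ V :=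
    (hgc.eventually_lt_const ((le_abs_self _).trans_lt (lt_add_one _))).and
      ((hf.isOpen.preimage continuous_orbitMap).mem_nhds hp)
  filter_upwards [hd₁.image_mem_nhds hev] with q hq
  obtain ⟨y, ⟨hy, hyV⟩, rfl⟩ := hq
  rw [hsq y hyV, S₁.sq_orbitMap (S₁.orbitMap_mem_dom_iff.mp (hVS hyV)), mul_comm]
  exact mul_le_mul_of_nonneg_right hy.le (sq_nonneg _)

/-- The reverse of `exists_sq_le`, from smoothness of the inverse map. That smoothness is given in
charts `S₂'`, `S₁'` of its own, so three estimates are chained: from `S₂` to `S₂'`, along `f'`, and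
from `S₁'` to `S₁`. The chart changes are the case of the identity map. -/
theorem exists_sq_le_sq_map (hd₁ : IsOpenMap (orbitMap k : M₁ → OrbitSpace k M₁))
    (hd₂ : IsOpenMap (orbitMap k : M₂ → OrbitSpace k M₂))
    (hf : Continuous f) (f' : OrbitSpace k M₂ → OrbitSpace k M₁) (hff' : ∀ q, f' (f q) = q)
    (hchar' : ∀ q, charFun k M₂ q = charFun k M₁ (f' q))
    (hsm : ∀ p, ∃ (S₂ : StdChart k d₂ M₂) (S₁ : StdChart k d₁ M₁) (V : Set (OrbitSpace k M₂)),
      p ∈ V ∧ V ⊆ S₂.dom ∧ SmoothInChart d₂ S₁ f' V)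
    {i : Fin S₁.n} {j : Fin S₂.n} (hij : S₂.facet j = S₁.facet i) {p : OrbitSpace k M₁}
    (hp : p ∈ S₁.dom) (hfp : f p ∈ S₂.dom) (hj : S₂.sq (f p) j = 0) :
    ∃ C, 0 < C ∧ ∀ᶠ q in 𝓝 p, S₁.sq q i ≤ C * S₂.sq (f q) j := by
  obtain ⟨S₂', S₁', V, hpV, hVS, hsmV⟩ := hsm (f p)
  have hp' : p ∈ S₁'.dom := hff' p ▸ hsmV.mapsTo _ hpV
  have hW₂ : IsOpen (S₂.dom ∩ S₂'.dom) := S₂.isOpen_dom.inter S₂'.isOpen_dom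
  have hW₁ : IsOpen (S₁'.dom ∩ S₁.dom) := S₁'.isOpen_dom.inter S₁.isOpen_dom
  have hid₂ : SmoothInChart d₂ S₂' id (S₂.dom ∩ S₂'.dom) :=
    (smoothInChart_id S₂').mono hW₂ Set.inter_subset_right
  have hid₁ : SmoothInChart d₁ S₁ id (S₁'.dom ∩ S₁.dom) :=
    (smoothInChart_id S₁).mono hW₁ Set.inter_subset_right
  obtain ⟨j', hj'⟩ := exists_facet_eq hW₂ Set.inter_subset_left hid₂.mapsTo (fun _ => rfl)
    ⟨hfp, hVS hpV⟩ hj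
  have hsj' : S₂'.sq (f p) j' = 0 :=
    (sq_eq_zero_iff_of_facet_eq (f := id) hj' hfp (hVS hpV) rfl).mpr hj
  obtain ⟨i', hi'⟩ := exists_facet_eq hsmV.isOpen hVS hsmV.mapsTo hchar' hpV hsj'
  obtain ⟨C₁, hC₁, h₁⟩ := exists_sq_le hd₂ Set.inter_subset_left hid₂ (fun _ => rfl) hj'
    (p := f p) ⟨hfp, hVS hpV⟩
  obtain ⟨C₂, hC₂, h₂⟩ := exists_sq_le hd₂ hVS hsmV hchar' hi' hpV
  obtain ⟨C₃, hC₃, h₃⟩ := exists_sq_le hd₁ (i := i') (j := i) Set.inter_subset_left hid₁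
    (fun _ => rfl) (by rw [← hij, hi', hj']) (p := p) ⟨hp', hp⟩
  refine ⟨C₃ * (C₂ * C₁), by positivity, ?_⟩
  filter_upwards [hf.continuousAt.eventually h₁, hf.continuousAt.eventually h₂, h₃] with q e₁ e₂ e₃
  rw [hff'] at e₂
  calc S₁.sq q i ≤ C₃ * S₁'.sq q i' := e₃
    _ ≤ C₃ * (C₂ * (C₁ * S₂.sq (f q) j)) := by gcongr; exact e₂.trans (by gcongr; exact e₁)
    _ = _ := by ring

end Match

/-! ### The local lift and its smoothness. -/

section Lift

variable {k d₁ d₂ : ℕ} {M₁ M₂ : Type*}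
  [TopologicalSpace M₁] [ChartedSpace (EuclideanSpace ℝ (Fin d₁)) M₁] [MulAction (Torus k) M₁]
  [TopologicalSpace M₂] [ChartedSpace (EuclideanSpace ℝ (Fin d₂)) M₂] [MulAction (Torus k) M₂]

theorem StdChart.unsplit_eq_prod_circ (S : StdChart k d₁ M₁) (u : Torus S.n) :
    S.unsplit u 1 = ∏ i, S.circ i (u i) := by
  let h : Torus S.n →* Torus k :=
    (S.A.splitting.symm : Torus S.n × Torus S.l →* Torus k).comp (MonoidHom.inl _ _)
  have h1 : ∀ u, S.unsplit u 1 = h u := fun _ => rfl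
  rw [h1]
  conv_lhs => rw [← Finset.univ_prod_mulSingle u]
  rw [map_prod]
  rfl

/-- Two parametrizations of the same circle differ by an automorphism, the identity or inversion. In
polar form this is `z ↦ z` or conjugation, smooth at `0` although the phase is not. -/
theorem exists_circ_eq {S₁ : StdChart k d₁ M₁} {S₂ : StdChart k d₂ M₂} {i : Fin S₁.n}
    {j : Fin S₂.n} (hij : S₂.facet j = S₁.facet i) :
    ∃ (ε : Circle → Circle) (c : ℂ → ℂ), (∀ u, S₁.circ i u = S₂.circ j (ε u)) ∧
      ContDiff ℝ ∞ c ∧ ∀ z, (ε (phase z) : ℂ) * ‖z‖ = c z := by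
  let ε : Circle →* Circle :=
    ((Pi.evalMonoidHom (fun _ : Fin S₂.n => Circle) j).comp (MonoidHom.fst _ (Torus S₂.l))).comp
      ((S₂.A.splitting : Torus k →* Torus S₂.n × Torus S₂.l).comp (S₁.circ i))
  have hε : ∀ u, ε u = (S₂.A.splitting (S₁.circ i u)).1 j := fun _ => rfl
  have hεc : Continuous ε := (continuous_apply j).comp (continuous_fst.comp
    (S₂.A.splitting.continuous.comp (S₁.continuous_circ i)))
  have hcirc : ∀ u, S₁.circ i u = S₂.circ j (ε u) := by
    intro u
    have h1 : S₁.circ i u ∈ S₂.facet j := hij ▸ ⟨u, rfl⟩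
    obtain ⟨v, hv⟩ := h1
    rw [hε, ← hv, S₂.splitting_circ]
    simp
  have hinj : Function.Injective ε := fun u v h =>
    S₁.circ_injective i (by rw [hcirc, hcirc, h])
  rcases circleHom_injective_eq ε hεc hinj with h | h
  · exact ⟨ε, id, hcirc, contDiff_id, fun z => by rw [h, phase_mul_norm]; rfl⟩
  · refine ⟨ε, starRingEnd ℂ, hcirc, Complex.conjCLE.contDiff, fun z => ?_⟩
    rw [h, Circle.coe_inv_eq_conj]
    conv_rhs => rw [← phase_mul_norm z]
    rw [map_mul, Complex.conj_ofReal]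

/-- The equivariant lift of a map of orbit spaces which respects the standard sections of two
charts. -/
noncomputable def localLift (S₁ : StdChart k d₁ M₁) (S₂ : StdChart k d₂ M₂)
    (f : OrbitSpace k M₁ → OrbitSpace k M₂) (x : M₁) : M₂ :=
  S₁.phases x • S₂.std (f (orbitMap k x))

variable {S₁ : StdChart k d₁ M₁} {S₂ : StdChart k d₂ M₂} {f : OrbitSpace k M₁ → OrbitSpace k M₂}

theorem orbitMap_localLift {x : M₁} (hfx : f (orbitMap k x) ∈ S₂.dom) :
    orbitMap k (localLift S₁ S₂ f x) = f (orbitMap k x) := by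
  rw [localLift, orbitMap_smul, S₂.orbitMap_std hfx]

/-- The phases are equivariant only up to the isotropy group of the standard section, and this group
also fixes the standard section over the image orbit. -/
theorem localLift_smul (hchar : ∀ q, charFun k M₁ q = charFun k M₂ (f q)) (t : Torus k) {x : M₁}
    (hx : x ∈ S₁.source) (hfx : f (orbitMap k x) ∈ S₂.dom) :
    localLift S₁ S₂ f (t • x) = t • localLift S₁ S₂ f x := by
  have h1 := S₁.phases_smul_std (S₁.smul_mem t hx)
  rw [orbitMap_smul] at h1
  conv_rhs at h1 => rw [← S₁.phases_smul_std hx]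
  have h2 : (t * S₁.phases x)⁻¹ * S₁.phases (t • x) ∈ charFun k M₁ (orbitMap k x) := by
    rw [← S₁.orbitMap_std (S₁.orbitMap_mem_dom_iff.mpr hx), charFun_orbitMap,
      MulAction.mem_stabilizer_iff, mul_smul, h1,
      ← mul_smul t, inv_smul_smul]
  rw [hchar, ← S₂.orbitMap_std hfx, charFun_orbitMap, MulAction.mem_stabilizer_iff, mul_smul,
    inv_smul_eq_iff] at h2
  rw [localLift, localLift, orbitMap_smul, h2, mul_smul]

/-- Only phases of coordinates vanishing at `x₀` are singular. They are moved through the common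
circles to the target chart, where each combines with a modulus `|z_i| √g` into a smooth coordinate.
-/
theorem contMDiffAt_localLift [ContMDiffSMul (torusModel k) (𝓡 d₁) ∞ (Torus k) M₁]
    [ContMDiffSMul (torusModel k) (𝓡 d₂) ∞ (Torus k) M₂]
    (hcov : ∀ x : M₁, ∃ S : StdChart k d₁ M₁, x ∈ S.source)
    (hf : Continuous f) {f' : OrbitSpace k M₂ → OrbitSpace k M₁} (hf' : Continuous f')
    (hff' : ∀ q, f' (f q) = q) (hf'f : ∀ q, f (f' q) = q)
    (hchar : ∀ q, charFun k M₁ q = charFun k M₂ (f q))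
    (hsm : ∀ p, ∃ (S₂ : StdChart k d₂ M₂) (S₁ : StdChart k d₁ M₁) (V : Set (OrbitSpace k M₂)),
      p ∈ V ∧ V ⊆ S₂.dom ∧ SmoothInChart d₂ S₁ f' V)
    {V : Set (OrbitSpace k M₁)} (hVS : V ⊆ S₁.dom) (hfV : SmoothInChart d₁ S₂ f V) {x₀ : M₁}
    (hx₀ : orbitMap k x₀ ∈ V) : ContMDiffAt (𝓡 d₁) (𝓡 d₂) ∞ (localLift S₁ S₂ f) x₀ := by
  classical
  have hchar' : ∀ q, charFun k M₂ q = charFun k M₁ (f' q) := fun q => by rw [hchar, hf'f]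
  set p := orbitMap k x₀ with hp
  have hpS : p ∈ S₁.dom := hVS hx₀
  have hxS : x₀ ∈ S₁.source := S₁.orbitMap_mem_dom_iff.mp hpS
  have hfp := hfV.mapsTo p hx₀
  have hcoordi : ∀ i, ContMDiffAt (𝓡 d₁) 𝓘(ℝ, ℂ) ∞ (fun x => (S₁.coord x).1 i) x₀ := fun i =>
    ContMDiffAt.comp x₀ (g := fun v : S₁.E => v.1 i)
      (contDiff_pi.mp contDiff_fst i).contMDiff.contMDiffAt (S₁.contMDiffAt_coord hxS)
  have hVx : ∀ᶠ x in 𝓝 x₀, orbitMap k x ∈ V :=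
    (hfV.isOpen.preimage continuous_orbitMap).mem_nhds hx₀
  have hdata : ∀ i, S₁.sq p i = 0 → ∃ (j : Fin S₂.n) (ε : Circle → Circle) (c : ℂ → ℂ),
      S₂.facet j = S₁.facet i ∧ (∀ u, S₁.circ i u = S₂.circ j (ε u)) ∧
      ContDiff ℝ ∞ c ∧ ∀ z, (ε (phase z) : ℂ) * ‖z‖ = c z := by
    intro i hi
    obtain ⟨j, hj⟩ := exists_facet_eq hfV.isOpen hVS hfV.mapsTo hchar hx₀ hi
    obtain ⟨ε, c, h⟩ := exists_circ_eq hj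
    exact ⟨j, ε, c, hj, h⟩
  choose σ ε c hσ hcirc hc hcz using hdata
  -- The singular phases, rewritten as rotations of the target coordinates.
  set w : M₁ → Torus S₂.n := fun x => ∏ i, if hi : S₁.sq p i = 0 then
    Pi.mulSingle (σ i hi) (ε i hi (phase ((S₁.coord x).1 i))) else 1 with hw
  have hw_apply : ∀ x j, w x j = ∏ i, if hi : S₁.sq p i = 0 then
      (Pi.mulSingle (σ i hi) (ε i hi (phase ((S₁.coord x).1 i))) : Torus S₂.n) j else 1 := by
    intro x j
    simp only [hw, Finset.prod_apply]
    refine Finset.prod_congr rfl fun i _ => ?_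
    split_ifs <;> rfl
  have hF : ∀ j, ∃ F : M₁ → ℂ, ContMDiffAt (𝓡 d₁) 𝓘(ℝ, ℂ) ∞ F x₀ ∧
      ∀ᶠ x in 𝓝 x₀, (w x j : ℂ) * (Real.sqrt (S₂.sq (f (orbitMap k x)) j) : ℂ) = F x := by
    intro j
    by_cases hj : ∃ i hi, σ i hi = j
    · obtain ⟨i, hi, rfl⟩ := hj
      obtain ⟨g, hg, hsq⟩ := exists_sq_eq_mul hVS hfV hchar (hσ i hi)
      have hΩo : IsOpen {v | orbitMap k (S₁.slice v) ∈ V} :=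
        hfV.isOpen.preimage (continuous_orbitMap.comp S₁.contMDiff_slice.continuous)
      have hvΩ : S₁.coord x₀ ∈ {v | orbitMap k (S₁.slice v) ∈ V} := by
        change orbitMap k _ ∈ V
        rwa [S₁.orbitMap_slice_coord hxS]
      have hgs : ContMDiffAt (𝓡 d₁) 𝓘(ℝ, ℝ) ∞ (fun y => g (S₁.coord y)) x₀ :=
        ContMDiffAt.comp x₀ (g := g) (hg.contDiffAt (hΩo.mem_nhds hvΩ)).contMDiffAt
          (S₁.contMDiffAt_coord hxS)
      -- Otherwise `g < C⁻¹` nearby, and at a free point the reverse estimate `|z_i|^2 ≤ C |z_i|^2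
      -- g` fails.
      have hgpos : 0 < g (S₁.coord x₀) := by
        by_contra hneg
        obtain ⟨C, hC, hle⟩ := exists_sq_le_sq_map (isOpenMap_orbitMap d₁) (isOpenMap_orbitMap d₂)
          hf f' hff' hchar' hsm (hσ i hi) hpS hfp
          ((sq_eq_zero_iff_of_facet_eq (hσ i hi) hpS hfp (hchar p)).mpr hi)
        have h1 : ∀ᶠ x in 𝓝 x₀, g (S₁.coord x) < C⁻¹ :=
          hgs.continuousAt.eventually_lt_const ((not_lt.mp hneg).trans_lt (by positivity))
        have h2 := (continuous_orbitMap (k := k) (M := M₁)).continuousAt.eventually hle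
        have h3 := h1.and (h2.and hVx)
        obtain ⟨x, ⟨h4, h5, h6⟩, hxf⟩ :=
          mem_closure_iff_nhds.mp (dense_freePoints hcov x₀) _ h3
        have hx := S₁.orbitMap_mem_dom_iff.mp (hVS h6)
        have h7 := (S₁.mem_freePoints_iff hx).mp hxf i
        rw [S₁.sq_orbitMap hx, hsq x h6] at h5
        have h8 : 0 < ‖(S₁.coord x).1 i‖ ^ 2 := by positivity
        have h9 : C * g (S₁.coord x) < 1 := by
          calc C * g (S₁.coord x) < C * C⁻¹ := by gcongr
            _ = 1 := mul_inv_cancel₀ hC.ne'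
        nlinarith
      refine ⟨fun x => c i hi ((S₁.coord x).1 i) * (Real.sqrt (g (S₁.coord x)) : ℂ), ?_, ?_⟩
      · have h1 : ContMDiffAt (𝓡 d₁) 𝓘(ℝ, ℂ) ∞ (fun x => c i hi ((S₁.coord x).1 i)) x₀ :=
          ContMDiffAt.comp x₀ (g := c i hi) (hc i hi).contMDiff.contMDiffAt (hcoordi i)
        have h2 : ContDiffAt ℝ ∞ (fun r : ℝ => (Real.sqrt r : ℂ)) (g (S₁.coord x₀)) :=
          Complex.ofRealCLM.contDiff.contDiffAt.comp _ (Real.contDiffAt_sqrt hgpos.ne')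
        have h3 := ContMDiffAt.comp x₀ (g := fun r : ℝ => (Real.sqrt r : ℂ)) h2.contMDiffAt hgs
        have h4 : ContDiff ℝ ∞ fun z : ℂ × ℂ => z.1 * z.2 := contDiff_fst.mul contDiff_snd
        exact ContMDiffAt.comp x₀ (g := fun z : ℂ × ℂ => z.1 * z.2) h4.contMDiff.contMDiffAt
          (h1.prodMk_space h3)
      · filter_upwards [hVx] with x hx
        have h1 : w x (σ i hi) = ε i hi (phase ((S₁.coord x).1 i)) := by
          rw [hw_apply, Finset.prod_eq_single i]
          · simp [hi]
          · intro i' _ hne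
            split_ifs with hi'
            · refine Pi.mulSingle_eq_of_ne (fun h => hne (S₁.facet_injective ?_)) _
              rw [← hσ i' hi', ← hσ i hi, h]
            · rfl
          · simp
        rw [h1, hsq x hx, Real.sqrt_mul (sq_nonneg _), Real.sqrt_sq (norm_nonneg _),
          Complex.ofReal_mul, ← mul_assoc, hcz]
    -- A coordinate vanishing at `f p` would be matched with one vanishing at `p` by applying
    -- `exists_facet_eq` to the inverse map. So the square root is smooth here.
    · have hne : S₂.sq (f p) j ≠ 0 := by
        intro h0
        have hW : IsOpen (f' ⁻¹' V ∩ S₂.dom) := (hfV.isOpen.preimage hf').inter S₂.isOpen_dom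
        obtain ⟨i, hi⟩ := exists_facet_eq (S₂ := S₁) (f := f') hW Set.inter_subset_right
          (fun q hq => hVS hq.1) hchar' (p := f p)
          ⟨by rw [Set.mem_preimage, hff']; exact hx₀, hfp⟩ h0
        have hi0 := (sq_eq_zero_iff_of_facet_eq hi.symm hpS hfp (hchar p)).mp h0
        exact hj ⟨i, hi0, S₂.facet_injective ((hσ i hi0).trans hi)⟩
      refine ⟨fun x => (Real.sqrt (S₂.sq (f (orbitMap k x)) j) : ℂ), ?_, ?_⟩
      · have h2 : ContDiffAt ℝ ∞ (fun r : ℝ => (Real.sqrt r : ℂ)) (S₂.sq (f p) j) :=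
          Complex.ofRealCLM.contDiff.contDiffAt.comp _ (Real.contDiffAt_sqrt hne)
        exact ContMDiffAt.comp x₀ (g := fun r : ℝ => (Real.sqrt r : ℂ)) h2.contMDiffAt
          (hfV.sq x₀ hx₀ j)
      · refine Filter.Eventually.of_forall fun x => ?_
        have h1 : w x j = 1 := by
          rw [hw_apply]
          refine Finset.prod_eq_one fun i _ => ?_
          split_ifs with hi
          · exact Pi.mulSingle_eq_of_ne (fun h => hj ⟨i, hi, h.symm⟩) _
          · rfl
        rw [h1, Circle.coe_one, one_mul]
  choose F hFs hFe using hF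
  -- The remaining phases, which are smooth near `x₀`.
  set u : M₁ → Torus S₁.n := fun x i => if S₁.sq p i = 0 then 1 else phase ((S₁.coord x).1 i)
    with hu
  have hus : ContMDiffAt (𝓡 d₁) (torusModel S₁.n) ∞ u x₀ := by
    refine contMDiffAt_torus_iff.mpr fun i => ?_
    by_cases hi : S₁.sq p i = 0
    · simp only [hu, hi, if_true]; exact contMDiffAt_const
    · simp only [hu, hi, if_false]
      refine ContMDiffAt.comp x₀ (g := phase) (contMDiffAt_phase ?_) (hcoordi i)
      rwa [hp, S₁.sq_orbitMap hxS, sq_eq_zero_iff, norm_eq_zero] at hi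
  have hts := S₁.contMDiffAt_unsplit hus (S₁.contMDiffAt_ang hxS)
  have hss : ContMDiffAt (𝓡 d₁) (𝓡 d₂) ∞
      (fun x => S₂.slice (fun j => F j x, S₂.base (f (orbitMap k x)))) x₀ := by
    refine ContMDiffAt.comp x₀ (g := S₂.slice) (S₂.contMDiff_slice _) ?_
    exact (contMDiffAt_pi_space.mpr hFs).prodMk_space (hfV.base x₀ hx₀)
  refine (hts.smul hss).congr_of_eventuallyEq ?_
  filter_upwards [Filter.eventually_all.mpr hFe, hVx] with x hFx hx
  have h1 : S₁.phases x = S₁.unsplit (u x) (S₁.ang x) * S₂.unsplit (w x) 1 := by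
    have h2 : S₂.unsplit (w x) 1 = S₁.unsplit
        (fun i => if S₁.sq p i = 0 then phase ((S₁.coord x).1 i) else 1) 1 := by
      let h : Torus S₂.n →* Torus k :=
        (S₂.A.splitting.symm : Torus S₂.n × Torus S₂.l →* Torus k).comp (MonoidHom.inl _ _)
      have h3 : ∀ u, S₂.unsplit u 1 = h u := fun _ => rfl
      rw [S₁.unsplit_eq_prod_circ, h3, hw, map_prod]
      refine Finset.prod_congr rfl fun i _ => ?_
      split_ifs with hi
      · rw [hcirc i hi]; rfl
      · rw [map_one, map_one]
    rw [h2, ← S₁.unsplit_mul, mul_one, StdChart.phases]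
    congr 1
    funext i
    simp only [hu, Pi.mul_apply]
    split_ifs <;> simp
  rw [localLift, h1, mul_smul, StdChart.std, S₂.unsplit_smul_slice]
  congr 2
  refine Prod.ext (funext fun j => ?_) rfl
  exact hFx j

end Lift

/-! ### Neighbourhoods whose free part is convex in coordinates. -/

section Convex

variable {k d : ℕ} {M : Type*} [TopologicalSpace M]
  [ChartedSpace (EuclideanSpace ℝ (Fin d)) M] [MulAction (Torus k) M]

theorem continuousAt_of_comp_orbitMap [ContMDiffSMul (torusModel k) (𝓡 d) ∞ (Torus k) M]
    {X : Type*} [TopologicalSpace X] {g : OrbitSpace k M → X} {x : M}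
    (h : ContinuousAt (fun y => g (orbitMap k y)) x) : ContinuousAt g (orbitMap k x) := by
  have hq : IsOpenQuotientMap (orbitMap k : M → OrbitSpace k M) :=
    ⟨orbitMap_surjective, continuous_orbitMap, isOpenMap_orbitMap d⟩
  exact hq.continuousAt_comp_iff.mp h

theorem StdChart.contMDiffAt_phases (S : StdChart k d M) {x : M} (hx : x ∈ S.source)
    (hf : x ∈ freePoints k M) : ContMDiffAt (𝓡 d) (torusModel k) ∞ S.phases x := by
  refine S.contMDiffAt_unsplit (contMDiffAt_torus_iff.mpr fun i => ?_) (S.contMDiffAt_ang hx)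
  exact ContMDiffAt.comp x (g := phase) (contMDiffAt_phase ((S.mem_freePoints_iff hx).mp hf i))
    (ContMDiffAt.comp x (g := fun v : S.E => v.1 i)
      (contDiff_pi.mp contDiff_fst i).contMDiff.contMDiffAt (S.contMDiffAt_coord hx))

/-- In the coordinates `(sq, base)` the free part of a suitable neighbourhood is a ball intersected
with an open orthant condition. This is convex, hence connected, and circle-valued functions on it
lift to `ℝ`. -/
theorem StdChart.exists_nhds_lift [ContMDiffSMul (torusModel k) (𝓡 d) ∞ (Torus k) M]
    (S : StdChart k d M) {V : Set (OrbitSpace k M)} (hV : IsOpen V) (hVS : V ⊆ S.dom)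
    {p : OrbitSpace k M} (hp : p ∈ V) :
    ∃ W, IsOpen W ∧ p ∈ W ∧ W ⊆ V ∧ IsPreconnected (W ∩ freeOrbits k M) ∧
      ∀ θ : OrbitSpace k M → Circle, ContinuousOn θ (W ∩ freeOrbits k M) →
        ∃ a : OrbitSpace k M → ℝ, ContinuousOn a (W ∩ freeOrbits k M) ∧
          ∀ q ∈ W ∩ freeOrbits k M, Circle.exp (a q) = θ q := by
  let B := (Fin S.n → ℝ) × EuclideanSpace ℝ (Fin S.m)
  let κ : OrbitSpace k M → B := fun q => (S.sq q, S.base q)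
  let τ : B → OrbitSpace k M := fun b => orbitMap k (S.slice (fun i => (Real.sqrt (b.1 i) : ℂ), b.2))
  have hτκ : ∀ q ∈ S.dom, τ (κ q) = q := fun q hq => S.orbitMap_std hq
  have hτdom : ∀ b, τ b ∈ S.dom := fun b => ⟨_, S.slice_mem _, rfl⟩
  have hκτ : ∀ b : B, (∀ i, 0 ≤ b.1 i) → κ (τ b) = b := by
    intro b hb
    refine Prod.ext (funext fun i => ?_) ?_
    · simp only [κ, τ]
      rw [S.sq_orbitMap (S.slice_mem _), S.coord_slice, Complex.norm_real, Real.norm_eq_abs, sq_abs,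
        Real.sq_sqrt (hb i)]
    · simp only [κ, τ]
      rw [S.base_orbitMap (S.slice_mem _), S.coord_slice]
  have hτc : Continuous τ := by
    refine continuous_orbitMap.comp (S.contMDiff_slice.continuous.comp ?_)
    refine Continuous.prodMk (continuous_pi fun i => ?_) continuous_snd
    exact Complex.continuous_ofReal.comp (Real.continuous_sqrt.comp
      ((continuous_apply i).comp continuous_fst))
  have hκc : ∀ q ∈ S.dom, ContinuousAt κ q := by
    intro q hq
    obtain ⟨x, rfl⟩ := orbitMap_surjective q
    refine ContinuousAt.prodMk (continuousAt_pi.mpr fun i => ?_) ?_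
    · exact continuousAt_of_comp_orbitMap (d := d) ((smoothInChart_id S).sq x hq i).continuousAt
    · exact continuousAt_of_comp_orbitMap (d := d) ((smoothInChart_id S).base x hq).continuousAt
  have hκco : ContinuousOn κ S.dom := fun q hq => (hκc q hq).continuousWithinAt
  obtain ⟨ε, hε, hball⟩ := Metric.isOpen_iff.mp (hV.preimage hτc) (κ p)
    (by rw [Set.mem_preimage, hτκ p (hVS hp)]; exact hp)
  set W : Set (OrbitSpace k M) := S.dom ∩ κ ⁻¹' Metric.ball (κ p) ε with hW
  have hWo : IsOpen W := hκco.isOpen_inter_preimage S.isOpen_dom Metric.isOpen_ball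
  set C : Set B := Metric.ball (κ p) ε ∩ {b | ∀ i, 0 < b.1 i} with hC
  have hCo : IsOpen C := by
    refine Metric.isOpen_ball.inter ?_
    have : {b : B | ∀ i, 0 < b.1 i} = ⋂ i, {b : B | 0 < b.1 i} := by ext; simp
    rw [this]
    exact isOpen_iInter_of_finite fun i => isOpen_lt continuous_const
      ((continuous_apply i).comp continuous_fst)
  have hCc : Convex ℝ C := by
    refine (convex_ball _ _).inter ?_
    intro x hx y hy s t hs ht hst i
    have h1 : (s • x + t • y).1 i = s * x.1 i + t * y.1 i := rfl
    rw [h1]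
    rcases hs.eq_or_lt with rfl | hs'
    · have : t = 1 := by linarith
      simpa [this] using hy i
    · exact add_pos_of_pos_of_nonneg (mul_pos hs' (hx i)) (mul_nonneg ht (hy i).le)
  have hκC : ∀ q ∈ W ∩ freeOrbits k M, κ q ∈ C := fun q hq =>
    ⟨hq.1.2, (S.mem_freeOrbits_iff hq.1.1).mp hq.2⟩
  have hτC : ∀ b ∈ C, τ b ∈ W ∩ freeOrbits k M := by
    intro b hb
    have h1 := hκτ b fun i => (hb.2 i).le
    refine ⟨⟨hτdom b, ?_⟩, (S.mem_freeOrbits_iff (hτdom b)).mpr fun i => ?_⟩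
    · rw [Set.mem_preimage, h1]; exact hb.1
    · have := congrArg (fun b : B => b.1 i) h1
      simp only [κ] at this
      rw [this]; exact hb.2 i
  have himg : W ∩ freeOrbits k M = τ '' C := by
    refine Set.Subset.antisymm (fun q hq => ⟨κ q, hκC q hq, hτκ q hq.1.1⟩) ?_
    rintro _ ⟨b, hb, rfl⟩
    exact hτC b hb
  refine ⟨W, hWo, ⟨hVS hp, Metric.mem_ball_self hε⟩, fun q hq => ?_, ?_, fun θ hθ => ?_⟩
  · rw [← hτκ q hq.1]
    exact hball hq.2
  · rw [himg]
    exact hCc.isPreconnected.image _ hτc.continuousOn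
  · obtain ⟨a, ha, hae⟩ := exists_lift_of_convex hCc hCo (hθ.comp hτc.continuousOn hτC)
    refine ⟨fun q => a (κ q), ha.comp (hκco.mono fun q hq => hq.1.1) hκC, fun q hq => ?_⟩
    rw [hae _ (hκC q hq), Function.comp_apply, hτκ q hq.1.1]

end Convex

/-! ### Local lifts compared with the sections. -/

section CharDiffeo

variable {k d₁ d₂ : ℕ} {M₁ M₂ : Type*}
  [TopologicalSpace M₁] [ChartedSpace (EuclideanSpace ℝ (Fin d₁)) M₁] [MulAction (Torus k) M₁]
  [TopologicalSpace M₂] [ChartedSpace (EuclideanSpace ℝ (Fin d₂)) M₂] [MulAction (Torus k) M₂]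

/-- The maps `f` and `f'` of orbit spaces are mutually inverse, smooth in suitable charts, and
preserve the isotropy groups. -/
structure IsCharDiffeo (d₁ d₂ : ℕ) {M₁ M₂ : Type*}
    [TopologicalSpace M₁] [ChartedSpace (EuclideanSpace ℝ (Fin d₁)) M₁] [MulAction (Torus k) M₁]
    [TopologicalSpace M₂] [ChartedSpace (EuclideanSpace ℝ (Fin d₂)) M₂] [MulAction (Torus k) M₂]
    (f : OrbitSpace k M₁ → OrbitSpace k M₂) (f' : OrbitSpace k M₂ → OrbitSpace k M₁) : Prop where
  left_inv : ∀ q, f' (f q) = q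
  right_inv : ∀ q, f (f' q) = q
  continuous : Continuous f
  continuous_inv : Continuous f'
  charFun_eq : ∀ q, charFun k M₁ q = charFun k M₂ (f q)
  smooth : ∀ p, ∃ (S₁ : StdChart k d₁ M₁) (S₂ : StdChart k d₂ M₂) (V : Set (OrbitSpace k M₁)),
    p ∈ V ∧ V ⊆ S₁.dom ∧ SmoothInChart d₁ S₂ f V
  smooth_inv : ∀ p, ∃ (S₂ : StdChart k d₂ M₂) (S₁ : StdChart k d₁ M₁) (V : Set (OrbitSpace k M₂)),
    p ∈ V ∧ V ⊆ S₂.dom ∧ SmoothInChart d₂ S₁ f' V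

namespace IsCharDiffeo

variable {f : OrbitSpace k M₁ → OrbitSpace k M₂} {f' : OrbitSpace k M₂ → OrbitSpace k M₁}

theorem symm (h : IsCharDiffeo d₁ d₂ f f') : IsCharDiffeo d₂ d₁ f' f where
  left_inv := h.right_inv
  right_inv := h.left_inv
  continuous := h.continuous_inv
  continuous_inv := h.continuous
  charFun_eq q := by rw [h.charFun_eq, h.right_inv]
  smooth := h.smooth_inv
  smooth_inv := h.smooth

theorem exists_chart (h : IsCharDiffeo d₁ d₂ f f') (x : M₁) :
    ∃ S : StdChart k d₁ M₁, x ∈ S.source := by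
  obtain ⟨S, -, V, hp, hV, -⟩ := h.smooth (orbitMap k x)
  exact ⟨S, S.orbitMap_mem_dom_iff.mp (hV hp)⟩

theorem mem_freeOrbits (h : IsCharDiffeo d₁ d₂ f f') {q : OrbitSpace k M₁}
    (hq : q ∈ freeOrbits k M₁) : f q ∈ freeOrbits k M₂ :=
  (h.charFun_eq q).symm.trans hq

end IsCharDiffeo

/-- The map `Ψ` is smooth and equivariant over `W` and covers the map `f` of orbit spaces. -/
structure IsLift (d₁ d₂ : ℕ) {M₁ M₂ : Type*}
    [TopologicalSpace M₁] [ChartedSpace (EuclideanSpace ℝ (Fin d₁)) M₁] [MulAction (Torus k) M₁]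
    [TopologicalSpace M₂] [ChartedSpace (EuclideanSpace ℝ (Fin d₂)) M₂] [MulAction (Torus k) M₂]
    (f : OrbitSpace k M₁ → OrbitSpace k M₂) (W : Set (OrbitSpace k M₁)) (Ψ : M₁ → M₂) : Prop where
  smooth : ∀ x, orbitMap k x ∈ W → ContMDiffAt (𝓡 d₁) (𝓡 d₂) ∞ Ψ x
  smul : ∀ (t : Torus k) x, orbitMap k x ∈ W → Ψ (t • x) = t • Ψ x
  orbitMap_eq : ∀ x, orbitMap k x ∈ W → orbitMap k (Ψ x) = f (orbitMap k x)

theorem IsLift.mono {f : OrbitSpace k M₁ → OrbitSpace k M₂} {W W' : Set (OrbitSpace k M₁)}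
    {Ψ : M₁ → M₂} (h : IsLift d₁ d₂ f W Ψ) (hW : W' ⊆ W) : IsLift d₁ d₂ f W' Ψ where
  smooth x hx := h.smooth x (hW hx)
  smul t x hx := h.smul t x (hW hx)
  orbitMap_eq x hx := h.orbitMap_eq x (hW hx)

theorem IsLift.exists_multiplier (S : StdChart k d₁ M₁) {f : OrbitSpace k M₁ → OrbitSpace k M₂}
    {f' : OrbitSpace k M₂ → OrbitSpace k M₁} (hff' : ∀ q, f' (f q) = q)
    {W : Set (OrbitSpace k M₁)} {W' : Set (OrbitSpace k M₂)} {Ψ : M₁ → M₂} {Ψ' : M₂ → M₁}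
    (hΨ : IsLift d₁ d₂ f W Ψ) (hΨ' : IsLift d₂ d₁ f' W' Ψ') (hW : IsOpen W) (hWS : W ⊆ S.dom)
    (hWW' : ∀ q ∈ W, f q ∈ W') :
    ∃ m : OrbitSpace k M₁ → Torus k, ∀ x, orbitMap k x ∈ W →
      ContMDiffAt (𝓡 d₁) (torusModel k) ∞ (fun y => m (orbitMap k y)) x ∧
      Ψ' (Ψ x) = m (orbitMap k x) • x := by
  have hW' : ∀ x, orbitMap k x ∈ W → orbitMap k (Ψ x) ∈ W' := fun x hx => by
    rw [hΨ.orbitMap_eq x hx]; exact hWW' _ hx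
  refine S.exists_smooth_multiplier hW hWS (G := fun x => Ψ' (Ψ x)) (fun x hx => ?_)
    (fun x hx => ?_) fun t x hx => ?_
  · exact ContMDiffAt.comp x (g := Ψ') (hΨ'.smooth _ (hW' x hx)) (hΨ.smooth x hx)
  · rw [hΨ'.orbitMap_eq _ (hW' x hx), hΨ.orbitMap_eq x hx, hff']
  · rw [hΨ.smul t x hx, hΨ'.smul t _ (hW' x hx)]

variable [ContMDiffSMul (torusModel k) (𝓡 d₁) ∞ (Torus k) M₁]
  [ContMDiffSMul (torusModel k) (𝓡 d₂) ∞ (Torus k) M₂]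
  {f : OrbitSpace k M₁ → OrbitSpace k M₂} {f' : OrbitSpace k M₂ → OrbitSpace k M₁}

theorem IsCharDiffeo.isLift_localLift (h : IsCharDiffeo d₁ d₂ f f') {S₁ : StdChart k d₁ M₁}
    {S₂ : StdChart k d₂ M₂} {V : Set (OrbitSpace k M₁)} (hVS : V ⊆ S₁.dom)
    (hfV : SmoothInChart d₁ S₂ f V) : IsLift d₁ d₂ f V (localLift S₁ S₂ f) where
  smooth _ hx := contMDiffAt_localLift h.exists_chart h.continuous h.continuous_inv h.left_inv
    h.right_inv h.charFun_eq h.smooth_inv hVS hfV hx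
  smul t _ hx := localLift_smul h.charFun_eq t (S₁.orbitMap_mem_dom_iff.mp (hVS hx))
    (hfV.mapsTo _ hx)
  orbitMap_eq _ hx := orbitMap_localLift (hfV.mapsTo _ hx)

/-- Over `f q`, both `s₂ (f q)` and the lift of `s₁ q` are phases times the same standard point. The
quotient of the phases is continuous on free orbits and is lifted through the exponential. -/
theorem IsCharDiffeo.exists_isLift (h : IsCharDiffeo d₁ d₂ f f') {s₁ : OrbitSpace k M₁ → M₁}
    (hs₁ : Continuous s₁) (hs₁' : ∀ p, orbitMap k (s₁ p) = p) {s₂ : OrbitSpace k M₂ → M₂}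
    (hs₂ : Continuous s₂) (hs₂' : ∀ p, orbitMap k (s₂ p) = p) (p : OrbitSpace k M₁) :
    ∃ (W : Set (OrbitSpace k M₁)) (Ψ : M₁ → M₂) (a : OrbitSpace k M₁ → Fin k → ℝ),
      IsOpen W ∧ p ∈ W ∧ IsLift d₁ d₂ f W Ψ ∧ ContinuousOn a (W ∩ freeOrbits k M₁) ∧
      ∀ q ∈ W ∩ freeOrbits k M₁, s₂ (f q) = torusExp (a q) • Ψ (s₁ q) := by
  obtain ⟨S₁, S₂, V, hpV, hVS, hfV⟩ := h.smooth p
  have hlift := h.isLift_localLift hVS hfV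
  obtain ⟨W, hW, hpW, hWV, -, hWl⟩ := S₁.exists_nhds_lift hfV.isOpen hVS hpV
  set θ : OrbitSpace k M₁ → Torus k := fun q => S₂.phases (s₂ (f q)) * (S₁.phases (s₁ q))⁻¹ with hθ
  have hs₂S : ∀ q ∈ W, s₂ (f q) ∈ S₂.source := fun q hq =>
    S₂.orbitMap_mem_dom_iff.mp (by rw [hs₂']; exact hfV.mapsTo q (hWV hq))
  have hs₁S : ∀ q ∈ W, s₁ q ∈ S₁.source := fun q hq =>
    S₁.orbitMap_mem_dom_iff.mp (by rw [hs₁']; exact hVS (hWV hq))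
  have hθc : ContinuousOn θ (W ∩ freeOrbits k M₁) := by
    intro q hq
    refine ContinuousAt.continuousWithinAt ?_
    have h2 : s₂ (f q) ∈ freePoints k M₂ := by
      change orbitMap k (s₂ (f q)) ∈ freeOrbits k M₂
      rw [hs₂']; exact h.mem_freeOrbits hq.2
    have h1 : s₁ q ∈ freePoints k M₁ := by
      change orbitMap k (s₁ q) ∈ freeOrbits k M₁
      rw [hs₁']; exact hq.2
    exact (ContinuousAt.comp (f := fun q => s₂ (f q))
      (S₂.contMDiffAt_phases (hs₂S q hq.1) h2).continuousAt
      (hs₂.comp h.continuous).continuousAt).mul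
      (ContinuousAt.comp (f := s₁) (S₁.contMDiffAt_phases (hs₁S q hq.1) h1).continuousAt
      hs₁.continuousAt).inv
  choose a ha hae using fun i => hWl (fun q => θ q i)
    ((continuous_apply i).comp_continuousOn hθc)
  refine ⟨W, localLift S₁ S₂ f, fun q i => a i q, hW, hpW, hlift.mono hWV,
    continuousOn_pi.mpr ha, fun q hq => ?_⟩
  have h1 : torusExp (fun i => a i q) = θ q := funext fun i => hae i q hq
  have h2 := S₂.phases_smul_std (hs₂S q hq.1)
  rw [hs₂'] at h2
  rw [h1, localLift, hs₁', hθ, ← mul_smul, inv_mul_cancel_right, h2]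

/-- A local lift `Ξ` of the inverse map turns `Ψ` and `Ψ'` into multiplications by smooth functions
`m` and `m'`. On free orbits `exp (a - a') = m' / m`, and the right side is smooth on all orbits. A
local logarithm of it differs from `a - a'` by a locally constant function. -/
theorem IsCharDiffeo.exists_smooth_difference (h : IsCharDiffeo d₁ d₂ f f')
    {s₁ : OrbitSpace k M₁ → M₁} (hs₁' : ∀ p, orbitMap k (s₁ p) = p) {s₂ : OrbitSpace k M₂ → M₂}
    {W W' : Set (OrbitSpace k M₁)} (hW : IsOpen W) (hW' : IsOpen W') {Ψ Ψ' : M₁ → M₂}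
    (hΨ : IsLift d₁ d₂ f W Ψ) (hΨ' : IsLift d₁ d₂ f W' Ψ') {a a' : OrbitSpace k M₁ → Fin k → ℝ}
    (ha : ContinuousOn a (W ∩ freeOrbits k M₁)) (ha' : ContinuousOn a' (W' ∩ freeOrbits k M₁))
    (hs : ∀ q ∈ W ∩ freeOrbits k M₁, s₂ (f q) = torusExp (a q) • Ψ (s₁ q))
    (hs' : ∀ q ∈ W' ∩ freeOrbits k M₁, s₂ (f q) = torusExp (a' q) • Ψ' (s₁ q))
    {p : OrbitSpace k M₁} (hp : p ∈ W) (hp' : p ∈ W') :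
    ∃ (V : Set (OrbitSpace k M₁)) (b : OrbitSpace k M₁ → Fin k → ℝ), IsOpen V ∧ p ∈ V ∧
      (∀ x, orbitMap k x ∈ V →
        ContMDiffAt (𝓡 d₁) 𝓘(ℝ, Fin k → ℝ) ∞ (fun y => b (orbitMap k y)) x) ∧
      ∀ q ∈ V ∩ freeOrbits k M₁, a q - a' q = b q := by
  obtain ⟨S₂, S₁, V₂, hfp, hV₂S, hfV₂⟩ := h.smooth_inv (f p)
  have hΞ := h.symm.isLift_localLift hV₂S hfV₂
  set Ξ := localLift S₂ S₁ f' with hΞdef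
  set V₀ : Set (OrbitSpace k M₁) := (W ∩ W') ∩ f ⁻¹' V₂ with hV₀
  have hV₀o : IsOpen V₀ := (hW.inter hW').inter (hfV₂.isOpen.preimage h.continuous)
  have hV₀S : V₀ ⊆ S₁.dom := fun q hq => by
    have := hfV₂.mapsTo _ hq.2
    rwa [h.left_inv] at this
  obtain ⟨m, hm⟩ := IsLift.exists_multiplier S₁ h.left_inv (hΨ.mono fun q hq => hq.1.1) hΞ hV₀o hV₀S
    fun q hq => hq.2
  obtain ⟨m', hm'⟩ := IsLift.exists_multiplier S₁ h.left_inv (hΨ'.mono fun q hq => hq.1.2) hΞ hV₀o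
    hV₀S fun q hq => hq.2
  set r : OrbitSpace k M₁ → Torus k := fun q => m' q * (m q)⁻¹ with hr
  have hrs : ∀ x, orbitMap k x ∈ V₀ →
      ContMDiffAt (𝓡 d₁) (torusModel k) ∞ (fun y => r (orbitMap k y)) x := fun x hx =>
    contMDiffAt_torus_mul (hm' x hx).1 (contMDiffAt_torus_inv (hm x hx).1)
  have hpV₀ : p ∈ V₀ := ⟨⟨hp, hp'⟩, hfp⟩
  have hrc : ∀ q ∈ V₀, ContinuousAt r q := by
    intro q hq
    obtain ⟨x, rfl⟩ := orbitMap_surjective q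
    exact continuousAt_of_comp_orbitMap (d := d₁) (hrs x hq).continuousAt
  have hV₁ : ∀ᶠ q in 𝓝 p, q ∈ V₀ ∧ ∀ i, (((r p i)⁻¹ * r q i : Circle) : ℂ) ∈ Complex.slitPlane :=
    (hV₀o.eventually_mem hpV₀).and ((hrc p hpV₀).eventually (torus_log_nhds (r p)))
  obtain ⟨V₁, hV₁s, hV₁o, hpV₁⟩ := mem_nhds_iff.mp hV₁
  obtain ⟨V, hV, hpV, hVV₁, hVc, -⟩ := S₁.exists_nhds_lift hV₁o
    (fun q hq => hV₀S (hV₁s hq).1) hpV₁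
  set b₀ : OrbitSpace k M₁ → Fin k → ℝ := fun q => torusLog (r p) (r q) with hb₀
  have hb₀s : ∀ x, orbitMap k x ∈ V →
      ContMDiffAt (𝓡 d₁) 𝓘(ℝ, Fin k → ℝ) ∞ (fun y => b₀ (orbitMap k y)) x := fun x hx =>
    contMDiffAt_torusLog (hrs x (hV₁s (hVV₁ hx)).1) (hV₁s (hVV₁ hx)).2
  have hb₀c : ContinuousOn b₀ V := by
    intro q hq
    obtain ⟨x, rfl⟩ := orbitMap_surjective q
    exact (continuousAt_of_comp_orbitMap (d := d₁) (hb₀s x hq).continuousAt).continuousWithinAt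
  have hexp : ∀ q ∈ V ∩ freeOrbits k M₁, torusExp (a q - a' q - b₀ q) = 1 := by
    intro q hq
    have hqV₀ := (hV₁s (hVV₁ hq.1)).1
    have hx : orbitMap k (s₁ q) = q := hs₁' q
    have hxV₀ : orbitMap k (s₁ q) ∈ V₀ := hx.symm ▸ hqV₀
    have e1 := (hs q ⟨hqV₀.1.1, hq.2⟩).symm.trans (hs' q ⟨hqV₀.1.2, hq.2⟩)
    have e2 := congrArg Ξ e1
    have e3 : orbitMap k (Ψ (s₁ q)) ∈ V₂ := by
      rw [hΨ.orbitMap_eq _ hxV₀.1.1, hx]; exact hqV₀.2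
    have e4 : orbitMap k (Ψ' (s₁ q)) ∈ V₂ := by
      rw [hΨ'.orbitMap_eq _ hxV₀.1.2, hx]; exact hqV₀.2
    rw [hΞ.smul _ _ e3, hΞ.smul _ _ e4, (hm _ hxV₀).2, (hm' _ hxV₀).2, hx, ← mul_smul,
      ← mul_smul] at e2
    have e5 := eq_of_smul_eq_smul (x := s₁ q) (by
      change orbitMap k (s₁ q) ∈ freeOrbits k M₁
      rw [hx]; exact hq.2) e2
    have e6 : torusExp (a q) = torusExp (a' q) * m' q * (m q)⁻¹ := eq_mul_inv_of_mul_eq e5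
    rw [torusExp_sub, torusExp_sub, e6, hb₀, torusExp_torusLog, hr, div_eq_one, div_eq_iff_eq_mul,
      mul_assoc, mul_comm]
  have hdiff : ContinuousOn (fun q => a q - a' q - b₀ q) (V ∩ freeOrbits k M₁) := by
    have hsub : V ⊆ V₀ := fun q hq => (hV₁s (hVV₁ hq)).1
    exact ((ha.mono (Set.inter_subset_inter_left _ fun q hq => (hsub hq).1.1)).sub
      (ha'.mono (Set.inter_subset_inter_left _ fun q hq => (hsub hq).1.2))).sub
      (hb₀c.mono Set.inter_subset_left)
  -- The difference takes values in the kernel of the exponential, and the free part of `V` is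
  -- connected.
  obtain ⟨c, hc⟩ : ∃ c : Fin k → ℝ, ∀ q ∈ V ∩ freeOrbits k M₁, a q - a' q - b₀ q = c := by
    rcases (V ∩ freeOrbits k M₁).eq_empty_or_nonempty with he | ⟨q₀, hq₀⟩
    · exact ⟨0, fun q hq => absurd (he ▸ hq) (Set.notMem_empty q)⟩
    · refine ⟨_, fun q hq => funext fun i => const_of_exp_eq_one hVc
        ((continuous_apply i).comp_continuousOn hdiff) (fun q hq => congrFun (hexp q hq) i) hq hq₀⟩
  refine ⟨V, fun q => b₀ q + c, hV, hpV, fun x hx => (hb₀s x hx).add contMDiffAt_const,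
    fun q hq => ?_⟩
  simp [← hc q hq]

end CharDiffeo

/-! ### Splitting an invariant cocycle by a partition of unity. -/

section Splitting

variable {k d : ℕ} {M : Type*} [TopologicalSpace M] [T2Space M] [SecondCountableTopology M]
  [ChartedSpace (EuclideanSpace ℝ (Fin d)) M] [IsManifold (𝓡 d) ∞ M]
  [MulAction (Torus k) M] [ContMDiffSMul (torusModel k) (𝓡 d) ∞ (Torus k) M]

/-- Invariant functions `a i`, defined on a dense set, whose differences extend to smooth functions
on the overlaps of an invariant open cover, have the same differences as invariant functions which
are smooth on the members of the cover. -/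
theorem exists_smooth_splitting {ι : Type*} {q : ℕ} {D : Set M} (hD : Dense D)
    (hDinv : ∀ t : Torus k, ∀ x ∈ D, t • x ∈ D) {W : ι → Set M} (hWo : ∀ i, IsOpen (W i))
    (hWinv : ∀ i, ∀ t : Torus k, ∀ x ∈ W i, t • x ∈ W i) (hcov : ∀ x, ∃ i, x ∈ W i)
    {a : ι → M → Fin q → ℝ} (ha : ∀ i (t : Torus k) x, a i (t • x) = a i x)
    (hsm : ∀ i j, ∀ x ∈ W i ∩ W j, ∃ (U : Set M) (b : M → Fin q → ℝ), IsOpen U ∧ x ∈ U ∧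
      (∀ y ∈ U, ContMDiffAt (𝓡 d) 𝓘(ℝ, Fin q → ℝ) ∞ b y) ∧ ∀ y ∈ U, y ∈ D → a i y - a j y = b y) :
    ∃ v : ι → M → Fin q → ℝ,
      (∀ i, ∀ x ∈ W i, ContMDiffAt (𝓡 d) 𝓘(ℝ, Fin q → ℝ) ∞ (v i) x) ∧
      (∀ i (t : Torus k), ∀ x ∈ W i, v i (t • x) = v i x) ∧
      ∀ i j, ∀ x ∈ W i ∩ W j, x ∈ D → v i x - v j x = a i x - a j x := by
  -- The extension from `D` does not depend on the local smooth functions `b`, so these fit together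
  -- into one smooth cocycle on each overlap.
  set c : ι → ι → M → Fin q → ℝ := fun i j => extendFrom D fun y => a i y - a j y with hc
  have hcb : ∀ i j, ∀ x ∈ W i ∩ W j, ContMDiffAt (𝓡 d) 𝓘(ℝ, Fin q → ℝ) ∞ (c i j) x ∧
      (x ∈ D → c i j x = a i x - a j x) := by
    intro i j x hx
    obtain ⟨U, b, hU, hxU, hb, hbD⟩ := hsm i j x hx
    have h1 : ∀ y ∈ U, c i j y = b y := fun y hy => extendFrom_eq_of_continuousOn hD hU
      (fun z hz => (hb z hz).continuousAt.continuousWithinAt) hbD hy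
    refine ⟨(hb x hxU).congr_of_eventuallyEq ?_, fun hxD => (h1 x hxU).trans (hbD x hxU hxD).symm⟩
    filter_upwards [hU.mem_nhds hxU] with y hy using h1 y hy
  have hcc : ∀ i j, ContinuousOn (c i j) (W i ∩ W j) := fun i j x hx =>
    (hcb i j x hx).1.continuousAt.continuousWithinAt
  have hWW : ∀ i j, IsOpen (W i ∩ W j) := fun i j => (hWo i).inter (hWo j)
  have hWWinv : ∀ i j, ∀ t : Torus k, ∀ x ∈ W i ∩ W j, t • x ∈ W i ∩ W j := fun i j t x hx =>
    ⟨hWinv i t x hx.1, hWinv j t x hx.2⟩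
  have hcinv : ∀ i j, ∀ t : Torus k, ∀ x ∈ W i ∩ W j, c i j (t • x) = c i j x := by
    intro i j t
    refine eqOn_of_dense_inter hD (hWW i j) (f := fun x => c i j (t • x)) ?_ (hcc i j) ?_
    · exact (hcc i j).comp (fun x _ =>
        (contMDiffAt_const_smul (d := d) t x).continuousAt.continuousWithinAt) (hWWinv i j t)
    · intro x hx hxD
      rw [(hcb i j x hx).2 hxD, (hcb i j _ (hWWinv i j t x hx)).2 (hDinv t x hxD), ha, ha]
  have : LocallyCompactSpace M := ChartedSpace.locallyCompactSpace (EuclideanSpace ℝ (Fin d)) M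
  obtain ⟨ρ, hρ⟩ := SmoothPartitionOfUnity.exists_isSubordinate (𝓡 d) isClosed_univ W hWo
    fun x _ => Set.mem_iUnion.mpr (hcov x)
  -- The usual splitting; by the cocycle identity on `D` and `∑ ρ j = 1` its differences are `c i
  -- j`. Invariance is restored afterwards by averaging.
  set w : ι → M → Fin q → ℝ := fun i x => ∑ᶠ j, ρ j x • c i j x with hw
  have hwW : ∀ i, ∀ x ∈ W i, ContMDiffAt (𝓡 d) 𝓘(ℝ, Fin q → ℝ) ∞ (w i) x := fun i x hx =>
    ρ.contMDiffAt_finsum fun j hj => (hcb i j x ⟨hx, hρ j hj⟩).1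
  have hwc : ∀ i j, ∀ x ∈ W i ∩ W j, w i x - w j x = c i j x := by
    intro i j
    refine eqOn_of_dense_inter hD (hWW i j) (f := fun x => w i x - w j x)
      (fun x hx => ((hwW i x hx.1).continuousAt.sub
        (hwW j x hx.2).continuousAt).continuousWithinAt) (hcc i j) ?_
    intro x hx hxD
    simp only [hw, ← ρ.sum_finsupport_smul_eq_finsum]
    rw [← Finset.sum_sub_distrib, (hcb i j x hx).2 hxD]
    have h1 : ∀ l ∈ ρ.finsupport x, ρ l x • c i l x - ρ l x • c j l x = ρ l x • (a i x - a j x) := by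
      intro l hl
      have hl' : x ∈ W l := hρ l (subset_tsupport _ ((ρ.mem_finsupport x).mp hl))
      rw [(hcb i l x ⟨hx.1, hl'⟩).2 hxD, (hcb j l x ⟨hx.2, hl'⟩).2 hxD, ← smul_sub]
      congr 1
      abel
    rw [Finset.sum_congr rfl h1, ← Finset.sum_smul, ρ.sum_finsupport x (Set.mem_univ x), one_smul]
  refine ⟨fun i => listAvg (List.finRange k) (w i), fun i =>
    contMDiffAt_listAvg (hWo i) (hWinv i) _ (hwW i), fun i t => ?_, fun i j x hx hxD => ?_⟩
  · exact invariant_of_coordCircle (hWinv i) (fun l u =>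
      listAvg_smul (hWinv i) (w i) (List.mem_finRange l) u) t
  · rw [← (hcb i j x hx).2 hxD]
    exact listAvg_sub (hWW i j) (hWWinv i j) _ (fun x hx => hwW i x hx.1)
      (fun x hx => hwW j x hx.2) (hcinv i j) (hwc i j) x hx

end Splitting

/-! ### Gluing the local lifts. -/

section Global

variable {k d₁ d₂ : ℕ} {M₁ M₂ : Type*}
  [TopologicalSpace M₁] [T2Space M₁] [SecondCountableTopology M₁]
  [ChartedSpace (EuclideanSpace ℝ (Fin d₁)) M₁] [IsManifold (𝓡 d₁) ∞ M₁]
  [MulAction (Torus k) M₁] [ContMDiffSMul (torusModel k) (𝓡 d₁) ∞ (Torus k) M₁]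
  [TopologicalSpace M₂] [T2Space M₂]
  [ChartedSpace (EuclideanSpace ℝ (Fin d₂)) M₂]
  [MulAction (Torus k) M₂] [ContMDiffSMul (torusModel k) (𝓡 d₂) ∞ (Torus k) M₂]
  {f : OrbitSpace k M₁ → OrbitSpace k M₂} {f' : OrbitSpace k M₂ → OrbitSpace k M₁}

theorem IsCharDiffeo.exists_isLift_univ (h : IsCharDiffeo d₁ d₂ f f') {s₁ : OrbitSpace k M₁ → M₁}
    (hs₁ : Continuous s₁) (hs₁' : ∀ p, orbitMap k (s₁ p) = p) {s₂ : OrbitSpace k M₂ → M₂}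
    (hs₂ : Continuous s₂) (hs₂' : ∀ p, orbitMap k (s₂ p) = p) :
    ∃ Ψ : M₁ → M₂, IsLift d₁ d₂ f Set.univ Ψ := by
  choose W Ψ a hWo hpW hΨ hac has using fun p => h.exists_isLift hs₁ hs₁' hs₂ hs₂' p
  have hD := dense_freePoints h.exists_chart
  have hWM : ∀ p, IsOpen (orbitMap k ⁻¹' W p : Set M₁) := fun p =>
    (hWo p).preimage continuous_orbitMap
  obtain ⟨v, hvs, hvi, hva⟩ := exists_smooth_splitting (d := d₁) (k := k) hD
    (fun t x hx => by
      change orbitMap k (t • x) ∈ freeOrbits k M₁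
      rw [orbitMap_smul]; exact hx)
    (W := fun p => orbitMap k ⁻¹' W p) hWM
    (fun p t x hx => by
      change orbitMap k (t • x) ∈ W p
      rw [orbitMap_smul]; exact hx)
    (fun x => ⟨orbitMap k x, hpW _⟩) (a := fun p x => a p (orbitMap k x))
    (fun p t x => by rw [orbitMap_smul])
    (fun p p' x hx => by
      obtain ⟨V, b, hV, hxV, hb, hab⟩ := h.exists_smooth_difference hs₁' (hWo p) (hWo p') (hΨ p)
        (hΨ p') (hac p) (hac p') (has p) (has p') hx.1 hx.2
      exact ⟨orbitMap k ⁻¹' V, fun y => b (orbitMap k y), hV.preimage continuous_orbitMap, hxV, hb,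
        fun y hy hyD => hab _ ⟨hy, hyD⟩⟩)
  set Θ : OrbitSpace k M₁ → M₁ → M₂ := fun p x => torusExp (v p x) • Ψ p x with hΘ
  have hΘs : ∀ p, ∀ x, orbitMap k x ∈ W p → ContMDiffAt (𝓡 d₁) (𝓡 d₂) ∞ (Θ p) x := fun p x hx =>
    (contMDiffAt_torusExp (hvs p x hx)).smul ((hΨ p).smooth x hx)
  -- At free points `exp(a_p) • Ψ_p` and `exp(a_p') • Ψ_p'` agree on the section `s₁`, hence on its
  -- orbits by equivariance. Since `v_p - v_p' = a_p - a_p'`, replacing `a` by `v` keeps the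
  -- agreement, and density extends it to all points.
  have hagree : ∀ p p' x, orbitMap k x ∈ W p → orbitMap k x ∈ W p' → Θ p x = Θ p' x := by
    intro p p' x hx hx'
    refine eqOn_of_dense_inter hD ((hWM p).inter (hWM p'))
      (fun y hy => (hΘs p y hy.1).continuousAt.continuousWithinAt)
      (fun y hy => (hΘs p' y hy.2).continuousAt.continuousWithinAt) ?_ x ⟨hx, hx'⟩
    intro y hy hyD
    obtain ⟨t, ht⟩ := exists_smul_eq_of_orbitMap_eq (hs₁' (orbitMap k y)).symm
    have e := (has p _ ⟨hy.1, hyD⟩).symm.trans (has p' _ ⟨hy.2, hyD⟩)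
    have h1 : orbitMap k (s₁ (orbitMap k y)) ∈ W p := by rw [hs₁']; exact hy.1
    have h2 : orbitMap k (s₁ (orbitMap k y)) ∈ W p' := by rw [hs₁']; exact hy.2
    have hv := congrArg torusExp (hva p p' y hy hyD)
    rw [torusExp_sub, torusExp_sub, div_eq_div_iff_mul_eq_mul] at hv
    have e' : Ψ p (s₁ (orbitMap k y)) = (torusExp (a p (orbitMap k y)))⁻¹ •
        torusExp (a p' (orbitMap k y)) • Ψ p' (s₁ (orbitMap k y)) := by
      rw [← e, inv_smul_smul]
    have e'' : torusExp (v p y) * t * (torusExp (a p (orbitMap k y)))⁻¹ *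
        torusExp (a p' (orbitMap k y)) = torusExp (v p' y) * t := by
      rw [← eq_mul_inv_iff_mul_eq] at hv
      rw [hv]
      generalize torusExp (a p (orbitMap k y)) = A
      generalize torusExp (a p' (orbitMap k y)) = B
      generalize torusExp (v p' y) = C
      calc A * C * B⁻¹ * t * A⁻¹ * B = C * t * (A * A⁻¹) * (B⁻¹ * B) := by
            simp only [mul_assoc, mul_comm, mul_left_comm]
        _ = C * t := by simp
    simp only [hΘ]
    have ey : Ψ p y = t • Ψ p (s₁ (orbitMap k y)) := by rw [← (hΨ p).smul t _ h1, ht]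
    have ey' : Ψ p' y = t • Ψ p' (s₁ (orbitMap k y)) := by rw [← (hΨ p').smul t _ h2, ht]
    rw [ey, ey', e', smul_smul, smul_smul, smul_smul, smul_smul, e'']
  refine ⟨fun x => Θ (orbitMap k x) x, fun x _ => ?_, fun t x _ => ?_, fun x _ => ?_⟩
  · refine (hΘs (orbitMap k x) x (hpW _)).congr_of_eventuallyEq ?_
    filter_upwards [(hWM (orbitMap k x)).mem_nhds (hpW _)] with y hy
    exact hagree _ _ y (hpW _) hy
  · simp only [orbitMap_smul, hΘ]
    rw [hvi _ t x (hpW _), (hΨ _).smul t x (hpW _), smul_smul, smul_smul, mul_comm]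
  · simp only [hΘ]
    rw [orbitMap_smul, (hΨ _).orbitMap_eq x (hpW _)]

end Global

/-! ### Bijectivity and smoothness of the inverse. -/

section Inverse

variable {k d₁ d₂ : ℕ} {M₁ M₂ : Type*}
  [TopologicalSpace M₁] [ChartedSpace (EuclideanSpace ℝ (Fin d₁)) M₁]
  [MulAction (Torus k) M₁]
  [TopologicalSpace M₂] [ChartedSpace (EuclideanSpace ℝ (Fin d₂)) M₂] [MulAction (Torus k) M₂]
  {f : OrbitSpace k M₁ → OrbitSpace k M₂} {f' : OrbitSpace k M₂ → OrbitSpace k M₁}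

theorem IsCharDiffeo.bijective_of_isLift (h : IsCharDiffeo d₁ d₂ f f') {Ψ : M₁ → M₂}
    (hΨ : IsLift d₁ d₂ f Set.univ Ψ) : Function.Bijective Ψ := by
  constructor
  · intro x y hxy
    have h1 : orbitMap k x = orbitMap k y := by
      rw [← h.left_inv (orbitMap k x), ← hΨ.orbitMap_eq x trivial, hxy, hΨ.orbitMap_eq y trivial,
        h.left_inv]
    obtain ⟨t, rfl⟩ := exists_smul_eq_of_orbitMap_eq h1
    have h2 : t ∈ charFun k M₂ (orbitMap k (Ψ y)) := by
      rw [charFun_orbitMap, MulAction.mem_stabilizer_iff, ← hΨ.smul t y trivial, hxy]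
    rwa [hΨ.orbitMap_eq y trivial, ← h.charFun_eq, charFun_orbitMap] at h2
  · intro y
    obtain ⟨x, hx⟩ := orbitMap_surjective (f' (orbitMap k y))
    have h1 : orbitMap k y = orbitMap k (Ψ x) := by
      rw [hΨ.orbitMap_eq x trivial, hx, h.right_inv]
    obtain ⟨t, ht⟩ := exists_smul_eq_of_orbitMap_eq h1
    exact ⟨t • x, by rw [hΨ.smul t x trivial, ht]⟩

/-- Locally `Ψ' ∘ Ψ` is multiplication by a smooth invariant function `m`. So the inverse is `m⁻¹ •
Ψ'`, with `m` evaluated at the orbit of `Ψ' z`. -/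
theorem IsCharDiffeo.contMDiff_of_leftInverse
    [ContMDiffSMul (torusModel k) (𝓡 d₁) ∞ (Torus k) M₁] (h : IsCharDiffeo d₁ d₂ f f') {Ψ : M₁ → M₂}
    {Ψ' Ξ : M₂ → M₁} (hΨ : IsLift d₁ d₂ f Set.univ Ψ) (hΨ' : IsLift d₂ d₁ f' Set.univ Ψ')
    (hΞ : ∀ y, Ψ (Ξ y) = y) : ContMDiff (𝓡 d₂) (𝓡 d₁) ∞ Ξ := by
  intro y
  obtain ⟨S, hS⟩ := h.exists_chart (Ψ' y)
  obtain ⟨m, hm⟩ := IsLift.exists_multiplier S h.left_inv (hΨ.mono (Set.subset_univ S.dom)) hΨ'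
    S.isOpen_dom subset_rfl fun _ _ => trivial
  have hy : orbitMap k (Ψ' y) ∈ S.dom := S.orbitMap_mem_dom_iff.mpr hS
  have h1 : ContMDiffAt (𝓡 d₂) (torusModel k) ∞ (fun z => m (orbitMap k (Ψ' z))) y :=
    ContMDiffAt.comp y (g := fun x => m (orbitMap k x)) (hm _ hy).1 (hΨ'.smooth y trivial)
  refine ((contMDiffAt_torus_inv h1).smul (hΨ'.smooth y trivial)).congr_of_eventuallyEq ?_
  filter_upwards [(hΨ'.smooth y trivial).continuousAt.preimage_mem_nhds
    (S.isOpen_source.mem_nhds hS)] with z hz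
  have h2 : orbitMap k (Ξ z) = orbitMap k (Ψ' z) := by
    rw [hΨ'.orbitMap_eq z trivial, ← hΞ z, hΨ.orbitMap_eq _ trivial, h.left_inv, hΞ]
  have h3 := (hm (Ξ z) (by rw [h2]; exact S.orbitMap_mem_dom_iff.mpr hz)).2
  rw [hΞ, h2] at h3
  exact eq_inv_smul_iff.mpr h3.symm

end Inverse

end LocallyStandard

open LocallyStandard in
theorem mainTheorem1 (k d₁ d₂ : ℕ)
    (M₁ : Type*) [TopologicalSpace M₁] [T2Space M₁] [SecondCountableTopology M₁]
    [ChartedSpace (EuclideanSpace ℝ (Fin d₁)) M₁] [IsManifold (𝓡 d₁) ∞ M₁]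
    [MulAction (Torus k) M₁] [ContMDiffSMul (torusModel k) (𝓡 d₁) ∞ (Torus k) M₁]
    (M₂ : Type*) [TopologicalSpace M₂] [T2Space M₂] [SecondCountableTopology M₂]
    [ChartedSpace (EuclideanSpace ℝ (Fin d₂)) M₂] [IsManifold (𝓡 d₂) ∞ M₂]
    [MulAction (Torus k) M₂] [ContMDiffSMul (torusModel k) (𝓡 d₂) ∞ (Torus k) M₂]
    (hM₁ : IsLocallyStandard k d₁ M₁) (hM₂ : IsLocallyStandard k d₂ M₂)
    (hs₁ : ∃ s₁ : C(OrbitSpace k M₁, M₁), ∀ p, orbitMap k (s₁ p) = p)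
    (hs₂ : ∃ s₂ : C(OrbitSpace k M₂, M₂), ∀ p, orbitMap k (s₂ p) = p)
    (Φ : OrbitDiffeo k d₁ d₂ M₁ M₂)
    (hΦ : ∀ p, charFun k M₁ p = charFun k M₂ (Φ.toEquiv p)) :
    ∃ Ψ : M₁ ≃ₘ^∞⟮𝓡 d₁, 𝓡 d₂⟯ M₂, ∀ (t : Torus k) (x : M₁), Ψ (t • x) = t • Ψ x := by
  obtain ⟨s₁, hs₁⟩ := hs₁
  obtain ⟨s₂, hs₂⟩ := hs₂
  have h : IsCharDiffeo d₁ d₂ Φ.toEquiv Φ.toEquiv.symm :=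
    { left_inv := Φ.toEquiv.symm_apply_apply
      right_inv := Φ.toEquiv.apply_symm_apply
      continuous := Φ.smooth_toFun.1
      continuous_inv := Φ.smooth_invFun.1
      charFun_eq := hΦ
      smooth := Φ.smooth_toFun.exists_smoothInChart
      smooth_inv := Φ.smooth_invFun.exists_smoothInChart }
  obtain ⟨Ψ, hΨ⟩ := h.exists_isLift_univ s₁.continuous hs₁ s₂.continuous hs₂
  obtain ⟨Ψ', hΨ'⟩ := h.symm.exists_isLift_univ s₂.continuous hs₂ s₁.continuous hs₁
  let e := Equiv.ofBijective Ψ (h.bijective_of_isLift hΨ)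
  exact ⟨⟨e, fun x => hΨ.smooth x trivial,
    h.contMDiff_of_leftInverse hΨ hΨ' e.apply_symm_apply⟩, fun t x => hΨ.smul t x trivial⟩
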